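/- Let $n\ge 1$ and let $f(\mathbf z,\bar{\mathbf z})=\sum_{\nu,\mu}c_{\nu,\mu}\mathbf z^{\nu}\bar{\mathbf z}^{\mu}$ be a mixed analytic function near the origin of $\mathbb C^n$ with $c_{0,0}=0$, and let $V=f^{-1}(0)$. Let $\Gamma_+(f)$ be the convex hull of $\bigcup_{c_{\nu,\mu}\ne0}\big((\nu+\mu)+\mathbb R_{\ge0}^n\big)$. For a weight vector $P$ with non-negative entries let $\Delta(P;f)$ be the face of $\Gamma_+(f)$ where $x\mapsto\sum_j p_jx_j$ is minimal, $d(P;f)=\min\{\sum_j p_j(\nu_j+\mu_j)\mid c_{\nu,\mu}\neq0\}$ and $f_P=\sum_{\nu+\mu\in\Delta(P;f)}c_{\nu,\mu}\mathbf z^\nu\bar{\mathbf z}^\mu$. Assume that $f$ is non-degenerate (for every strictly positive integer vector $P$, no point of $f_P^{-1}(0)\cap(\mathbb C^*)^n$ is a critical point of $f_P:(\mathbb C^*)^n\to\mathbb C=\mathbb R^2$) and convenient (the restriction of $f$ to every coordinate axis is not identically zero). Let $\Sigma^*$ be a regular simplicial cone subdivision of $\mathbb R_{\ge0}^n$ such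 that $\Delta(\cdot\,;f)$ is constant on each of its open cones, and whose vertices that are not strictly positive belong to the standard basis; let $\mathcal V^+$ be the set of its strictly positive vertices. Let $\hat\pi:X\to\mathbb C^n$ be the associated toric modification, obtained by gluing the charts $\mathbb C^n_\sigma$ of the $n$-dimensional cones $\sigma$, and for $P\in\mathcal V^+$ let $\hat E(P)\subset X$ be the corresponding exceptional divisor. Let $\omega_p:\mathcal PX\to X$ and $\omega_{\mathbb R}:\mathcal RX\to X$ be the normal polar and the normal real blowing-ups along the $\hat E(P)$, $P\in\mathcal V^+$: in the chart of $\sigma$ every coordinate plane transverse to some $\hat E(P)$ is replaced by $\mathcal P\mathbb C=\mathbb R_{\ge0}\times S^1$, $(r,w)\mapsto rw$, respectively by the closure $\mathcal R\mathbb C\subset\mathbb C\times\mathbb{RP}^1$ of the graph of $x+iy\mapsto[x:y]$. Put $\Phi_p=\hat\pi\circ\omega_p$, $\Phi=\hat\pi\circ\omega_{\mathbb R}$, $E=\Phi_p^{-1}(O)$, $\tilde E(P)=\omega_p^{-1}(\hat E(P))$, and let $\tilde V$ be the closure of $\Phi_p^{-1}(V\setminus\{O\})$. Then, for the real analytic structures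 given by the coordinates $(r,\theta)$ of $\mathcal P\mathbb C$ and $(\tilde x,t)$, $(s,\tilde y)$ (with $z=\tilde x(1+it)=\tilde y(s+i)$) of $\mathcal R\mathbb C$, the space $\mathcal RX$ is a real analytic manifold of dimension $2n$ without boundary, and $\Phi_p:\mathcal PX\to\mathbb C^n$ is a good resolution of polar type of $f$ with exceptional divisors $\tilde E(P)$, $P\in\mathcal V^+$. That is: 1. $\mathcal PX$ is a real analytic manifold of dimension $2n$ with boundary (with corners where several $\tilde E(P)$ meet), $\partial\mathcal PX=E$, and $\Phi_p$ is proper and real analytic. 2. The irreducible components of $E$ are the pairwise distinct sets $\tilde E(P)$, $P\in\mathcal V^+$; their union is $E$ and each of them is a smooth subvariety of real codimension one. 3. $\Phi_p:\mathcal PX\setminus E\to\mathbb C^n\setminus\{O\}$ is a real analytic diffeomorphism. 4. In an open neighbourhood of $E$, $\tilde V$ is a smooth submanifold of real codimension $2$. 5. If $x\in E\cap\tilde V$ lies on $\tilde E(P_1),\dots,\tilde E(P_t)$ and on no other $\tilde E(P)$, there is a real analytic coordinate system $(U,(u_1,\dots,u_{2n}))$ centered at $x$ in which $\mathcal PX$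 is given by $u_1\ge0,\dots,u_t\ge0$, $U\cap\tilde E(P_j)=\{u_j=0\}$, $U\cap\tilde V=\{u_{t+1}=u_{t+2}=0\}$ and $$\Phi_p^*f=u_1^{d(P_1;f)}\cdots u_t^{d(P_t;f)}\,(u_{t+1}+iu_{t+2}).$$ The multiplicity of $\Phi_p^*f$ along $\tilde E(P)$ is $d(P;f)$ for every $P\in\mathcal V^+$. Finally, there is a canonical factorization: there is a unique continuous map $\eta:\mathcal PX\to\mathcal RX$ with $\omega_p=\omega_{\mathbb R}\circ\eta$; it is real analytic, satisfies $\Phi_p=\Phi\circ\eta$, and is given in each chart by $(r,e^{i\theta})\mapsto(re^{i\theta},[\cos\theta:\sin\theta])$ on each factor $\mathcal P\mathbb C$ and by the identity on the remaining coordinates. -/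

import Mathlib

open scoped ContDiff Manifold NNReal

noncomputable section

namespace MixedResolution

/-! ### Mixed analytic functions, Newton boundary, non-degeneracy -/

/-- The mixed monomial `z ^ ν * conj z ^ μ`. -/
def mixedMonomial {n : ℕ} (z : Fin n → ℂ) (ν μ : Fin n → ℕ) : ℂ :=
  ∏ j, z j ^ ν j * (starRingEnd ℂ (z j)) ^ μ j

/-- A (germ at the origin of a) mixed analytic function of `n` complex variables: the sum, on an
open neighbourhood of the origin, of a convergent power series in `z` and `conj z` without constant
term. -/
structure MixedFunction (n : ℕ) where
  /-- the coefficients `c_{ν, μ}` -/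
  coeff : (Fin n → ℕ) → (Fin n → ℕ) → ℂ
  /-- an open neighbourhood of the origin on which the series converges -/
  domain : Set (Fin n → ℂ)
  /-- the function -/
  toFun : (Fin n → ℂ) → ℂ
  isOpen_domain : IsOpen domain
  zero_mem : 0 ∈ domain
  hasSum : ∀ z ∈ domain, HasSum
    (fun e : (Fin n → ℕ) × (Fin n → ℕ) => coeff e.1 e.2 * mixedMonomial z e.1 e.2) (toFun z)
  coeff_zero : coeff 0 0 = 0

/-- Strictly positive integer weight vectors. -/
abbrev StrictlyPos {n : ℕ} (P : Fin n → ℕ) : Prop := ∀ k, 0 < P k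

namespace MixedFunction

variable {n : ℕ} (f : MixedFunction n)

/-- The mixed hypersurface `V = f⁻¹(0)`. -/
def zeroLocus : Set (Fin n → ℂ) := {z | z ∈ f.domain ∧ f.toFun z = 0}

/-- The Newton polygon `Γ₊(f)`: the convex hull of the union of the sets `(ν + μ) + (ℝ≥0)ⁿ` over
the monomials of `f`. -/
def newtonPolygon : Set (Fin n → ℝ) :=
  convexHull ℝ {x | ∃ ν μ : Fin n → ℕ, f.coeff ν μ ≠ 0 ∧ ∀ j, ((ν j + μ j : ℕ) : ℝ) ≤ x j}

/-- The face `Δ(P; f)` on which the linear function with coefficients `P` takes its minimum. -/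
def face (P : Fin n → ℝ) : Set (Fin n → ℝ) :=
  {x | x ∈ f.newtonPolygon ∧ ∀ y ∈ f.newtonPolygon, ∑ j, P j * x j ≤ ∑ j, P j * y j}

/-- `d(P; f)`, the minimal radial degree, for the weight `P`, of a monomial of `f`. -/
def minDegree (P : Fin n → ℕ) : ℕ :=
  sInf {d | ∃ ν μ : Fin n → ℕ, f.coeff ν μ ≠ 0 ∧ d = ∑ j, P j * (ν j + μ j)}

/-- The exponents of the monomials of `f` that lie on the face `Δ(P; f)`. -/
def faceExponents (P : Fin n → ℕ) : Set ((Fin n → ℕ) × (Fin n → ℕ)) :=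
  {e | f.coeff e.1 e.2 ≠ 0 ∧
    (fun j => ((e.1 j + e.2 j : ℕ) : ℝ)) ∈ f.face (fun j => (P j : ℝ))}

/-- The face function `f_P`. For strictly positive `P` the sum is finite. -/
def faceFunction (P : Fin n → ℕ) (z : Fin n → ℂ) : ℂ :=
  ∑ᶠ e ∈ f.faceExponents P, f.coeff e.1 e.2 * mixedMonomial z e.1 e.2

/-- `f` is non-degenerate: for every strictly positive weight vector `P`, no point of
`f_P⁻¹(0)` in the torus is a critical point of `f_P` as a map to the real plane `ℂ`. -/
def IsNondegenerate : Prop :=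
  ∀ P : Fin n → ℕ, StrictlyPos P → ∀ z : Fin n → ℂ, (∀ j, z j ≠ 0) → f.faceFunction P z = 0 →
    Function.Surjective (fderiv ℝ (f.faceFunction P) z)

/-- The sets `J` of indices for which `f` is not identically zero on `ℂ^J`. -/
def nonVanishing : Set (Finset (Fin n)) :=
  {J | ∃ z ∈ f.domain, (∀ j, j ∉ J → z j = 0) ∧ f.toFun z ≠ 0}

/-- `k`-convenience. -/
def IsKConvenient (k : ℕ) : Prop :=
  ∀ J : Finset (Fin n), J.card + k = n → J ∈ f.nonVanishing

/-- `f` is convenient if it is `(n - 1)`-convenient. -/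
def IsConvenient : Prop := f.IsKConvenient (n - 1)

end MixedFunction

/-! ### Regular fans and the toric modification -/

/-- The closed real cone generated by a finite set of integer vectors. -/
def cone {n : ℕ} (s : Finset (Fin n → ℕ)) : Set (Fin n → ℝ) :=
  {x | ∃ t : (Fin n → ℕ) → ℝ, (∀ P ∈ s, 0 ≤ t P) ∧ ∀ k, x k = ∑ P ∈ s, t P * (P k : ℝ)}

/-- The open real cone generated by a finite set of integer vectors. -/
def intCone {n : ℕ} (s : Finset (Fin n → ℕ)) : Set (Fin n → ℝ) :=
  {x | ∃ t : (Fin n → ℕ) → ℝ, (∀ P ∈ s, 0 < t P) ∧ ∀ k, x k = ∑ P ∈ s, t P * (P k : ℝ)}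

/-- A regular simplicial cone subdivision of `(ℝ≥0)ⁿ`, given by its `n`-dimensional cones. Each of
them is given by the set of its vertices, which is a `ℤ`-basis of `ℤⁿ`; all other cones of the
subdivision are faces of these, i.e. are generated by subsets of their sets of vertices. -/
structure RegularFan (n : ℕ) where
  maxCones : Finset (Finset (Fin n → ℕ))
  linearIndependent : ∀ s ∈ maxCones,
    LinearIndependent ℤ (fun (P : s) (k : Fin n) => ((P.1 k : ℕ) : ℤ))
  span_eq_top : ∀ s ∈ maxCones,
    Submodule.span ℤ (Set.range (fun (P : s) (k : Fin n) => ((P.1 k : ℕ) : ℤ))) = ⊤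
  inter : ∀ s ∈ maxCones, ∀ t ∈ maxCones, cone s ∩ cone t = cone (s ∩ t)
  cover : (⋃ s ∈ maxCones, cone s) = {x : Fin n → ℝ | ∀ k, 0 ≤ x k}

/-- `a` is the matrix `τ⁻¹ σ`, where `σ` and `τ` are the matrices with columns the elements of `s`
and of `t`. -/
def IsTransition {n : ℕ} {s t : Finset (Fin n → ℕ)} (a : s → t → ℤ) : Prop :=
  ∀ (P : s) (k : Fin n), (P.1 k : ℤ) = ∑ Q : t, a P Q * (Q.1 k : ℤ)

/-- The monomial map attached to the exponents `a` is well defined at `u`. -/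
def IsDefinedAt {n : ℕ} {s t : Finset (Fin n → ℕ)} (a : s → t → ℤ) (u : s → ℂ) : Prop :=
  ∀ P, u P = 0 → ∀ Q, 0 ≤ a P Q

/-- The map `π_σ : ℂ^σ → ℂⁿ`, `z_k = ∏ u_P ^ {p_k}` (product over the vertices `P` of `σ`). -/
def chartProj {n : ℕ} (s : Finset (Fin n → ℕ)) (u : s → ℂ) : Fin n → ℂ :=
  fun k => ∏ P : s, u P ^ (P.1 k)

theorem chartProj_eq {n : ℕ} {s t : Finset (Fin n → ℕ)} {a : s → t → ℤ} (ha : IsTransition a)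
    {u : s → ℂ} (hu : IsDefinedAt a u) {v : t → ℂ} (hv : ∀ Q, v Q = ∏ P, u P ^ a P Q) :
    chartProj s u = chartProj t v := by
  funext k
  have key : ∀ P : s, u P ^ (P.1 k) = ∏ Q : t, (u P ^ a P Q) ^ (Q.1 k) := by
    intro P
    have h1 : ∀ Q : t, (u P ^ a P Q) ^ (Q.1 k) = u P ^ (a P Q * (Q.1 k : ℤ)) := by
      intro Q
      rw [zpow_mul, zpow_natCast]
    have h2 : u P ^ (P.1 k) = u P ^ (∑ Q : t, a P Q * (Q.1 k : ℤ)) := by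
      rw [← ha P k, zpow_natCast]
    rw [h2, Finset.prod_congr rfl (fun Q _ => h1 Q)]
    by_cases h0 : u P = 0
    · have hnn : ∀ Q : t, 0 ≤ a P Q * (Q.1 k : ℤ) := fun Q =>
        mul_nonneg (hu P h0 Q) (by positivity)
      rw [← Int.toNat_of_nonneg (Finset.sum_nonneg fun Q _ => hnn Q), zpow_natCast]
      have h3 : ∀ Q : t, u P ^ (a P Q * (Q.1 k : ℤ)) = u P ^ (a P Q * (Q.1 k : ℤ)).toNat := by
        intro Q
        conv_lhs => rw [← Int.toNat_of_nonneg (hnn Q)]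
        rw [zpow_natCast]
      rw [Finset.prod_congr rfl (fun Q _ => h3 Q), Finset.prod_pow_eq_pow_sum]
      congr 1
      zify
      rw [Int.toNat_of_nonneg (Finset.sum_nonneg fun Q _ => hnn Q)]
      exact Finset.sum_congr rfl fun Q _ => (Int.toNat_of_nonneg (hnn Q)).symm
    · have h4 : ∀ S : Finset t, u P ^ (∑ Q ∈ S, a P Q * (Q.1 k : ℤ)) =
          ∏ Q ∈ S, u P ^ (a P Q * (Q.1 k : ℤ)) := by
        intro S
        classical
        induction S using Finset.induction_on with
        | empty => simp
        | insert Q S hQ ih => rw [Finset.sum_insert hQ, Finset.prod_insert hQ, zpow_add₀ h0, ih]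
      exact h4 Finset.univ
  simp only [chartProj, hv]
  rw [Finset.prod_congr rfl (fun P _ => key P), Finset.prod_comm]
  exact Finset.prod_congr rfl fun Q _ => Finset.prod_pow _ _ _

namespace RegularFan

variable {n : ℕ} (F : RegularFan n)

/-- The set of vertices of the fan. -/
def vertices : Finset (Fin n → ℕ) := F.maxCones.biUnion id

/-- The set of strictly positive vertices. -/
def posVertices : Finset (Fin n → ℕ) := F.vertices.filter StrictlyPos

/-- The fan is a subdivision of the dual Newton diagram of `f`: the face `Δ(P; f)` is constant for
`P` in any open cone of the fan. -/
def IsAdmissible (f : MixedFunction n) : Prop :=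
  ∀ s ∈ F.maxCones, ∀ t ⊆ s, ∀ P ∈ intCone t, ∀ Q ∈ intCone t, f.face P = f.face Q

/-- The gluing relation between the affine charts `ℂ^σ`. -/
def toricRel (x y : Σ s : F.maxCones, (s.1 → ℂ)) : Prop :=
  ∃ a : x.1.1 → y.1.1 → ℤ, IsTransition a ∧ IsDefinedAt a x.2 ∧
    ∀ Q, y.2 Q = ∏ P, x.2 P ^ a P Q

/-- The toric manifold `X`: the charts `ℂ^σ` glued along `toricRel`, with the quotient topology. -/
def Toric : Type := Quot F.toricRel

instance : TopologicalSpace F.Toric := inferInstanceAs (TopologicalSpace (Quot F.toricRel))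

/-- The toric modification `X → ℂⁿ`. -/
def toricMap : F.Toric → Fin n → ℂ :=
  Quot.lift (fun x => chartProj x.1.1 x.2) (by
    rintro x y ⟨a, ha, hu, hv⟩
    exact chartProj_eq ha hu hv)

/-- The divisor of `X` attached to the vertex `P`: it is `{u_P = 0}` in each chart of a cone
having `P` as a vertex. -/
def divisor (P : Fin n → ℕ) : Set F.Toric :=
  {x | ∃ (s : F.maxCones) (u : s.1 → ℂ) (hP : P ∈ s.1), x = Quot.mk _ ⟨s, u⟩ ∧ u ⟨P, hP⟩ = 0}

end RegularFan

/-! ### The polar and the real modification of the complex plane -/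

/-- A modification of the plane `ℂ` at the origin, whose points determine a direction, an element
of an abelian group `Dir` on which nonzero complex numbers also have a value, together with its
coordinate systems: maps from a region of the real plane. -/
structure PlaneModification where
  /-- the points of the modification -/
  Pt : Type
  /-- the group of directions -/
  Dir : Type
  [top : TopologicalSpace Pt]
  [grp : CommGroup Dir]
  /-- the projection to `ℂ` -/
  val : Pt → ℂ
  /-- the direction of a point -/
  dir : Pt → Dir
  /-- the direction of a nonzero complex number -/
  dirOf : ℂ → Dir
  /-- the region of the real plane parametrized by the coordinates -/
  region : Set (ℝ × ℝ)
  /-- the coordinate systems, as parametrizations -/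
  params : Set (ℝ × ℝ → Pt)

attribute [instance] PlaneModification.top PlaneModification.grp

/-- The polar modification: `ℝ≥0 × S¹ → ℂ`, `(r, w) ↦ r w`, with polar coordinates `(r, θ)`,
`r ≥ 0`. -/
def polarPlane : PlaneModification where
  Pt := ℝ≥0 × Circle
  Dir := Circle
  val p := ((p.1 : ℝ) : ℂ) * (p.2 : ℂ)
  dir p := p.2
  dirOf z := Circle.exp z.arg
  region := {a | 0 ≤ a.1}
  params := {fun a => (a.1.toNNReal, Circle.exp a.2)}

/-- The real projective line, as the space of real lines through the origin of `ℂ = ℝ²`: the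
quotient of `ℂ \ {0}` by the multiplicative group of nonzero reals. -/
abbrev RealProjLine : Type := ℂˣ ⧸ (Units.map (algebraMap ℝ ℂ : ℝ →* ℂ)).range

/-- The line `[x : y]` spanned by `x + i y`. -/
def lineOf (w : ℂˣ) : RealProjLine := QuotientGroup.mk w

/-- The real blowing up of `ℂ`: the closure of the graph of `z ↦ [x : y]` in `ℂ × ℝP¹`. -/
def RealPlane : Type :=
  {p : ℂ × RealProjLine // p ∈ closure (Set.range fun z : ℂˣ => ((z : ℂ), lineOf z))}

instance : TopologicalSpace RealPlane := instTopologicalSpaceSubtype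

theorem mem_realPlane (t : ℝ) (w : ℂˣ) :
    ((t : ℂ) * (w : ℂ), lineOf w) ∈ closure (Set.range fun z : ℂˣ => ((z : ℂ), lineOf z)) := by
  have hc : Continuous (fun r : ℝ => (((r : ℂ) * (w : ℂ), lineOf w) : ℂ × RealProjLine)) := by
    fun_prop
  have hd : t ∈ closure {r : ℝ | r ≠ 0} := by
    have : Dense {r : ℝ | r ≠ 0} := dense_compl_singleton 0
    exact this t
  refine closure_mono ?_ (image_closure_subset_closure_image hc ⟨t, hd, rfl⟩)
  rintro _ ⟨r, hr, rfl⟩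
  have hr' : r ≠ 0 := hr
  refine ⟨Units.map (algebraMap ℝ ℂ : ℝ →* ℂ) (Units.mk0 r hr') * w, ?_⟩
  refine Prod.ext (by simp) ?_
  refine (QuotientGroup.eq.2 ?_)
  refine ⟨(Units.mk0 r hr')⁻¹, ?_⟩
  simp [mul_comm]

/-- The point of the real blowing up given by the point `t w` of the line spanned by `w`. -/
def RealPlane.mk (t : ℝ) (w : ℂˣ) : RealPlane := ⟨((t : ℂ) * (w : ℂ), lineOf w), mem_realPlane t w⟩

/-- The nonzero number `x + i y`, for `(x, y) ≠ 0`. -/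
def unitOf (x y : ℝ) (h : x ≠ 0 ∨ y ≠ 0) : ℂˣ :=
  Units.mk0 (⟨x, y⟩ : ℂ) (by
    intro h0
    have h1 := congrArg Complex.re h0
    have h2 := congrArg Complex.im h0
    simp only [Complex.zero_re, Complex.zero_im] at h1 h2
    tauto)

open Classical in
/-- The real modification of `ℂ`, with its coordinates `(x, t)`, `z = x (1 + i t)`, and `(s, y)`,
`z = y (s + i)`. -/
def realPlane : PlaneModification where
  Pt := RealPlane
  Dir := RealProjLine
  val p := p.1.1
  dir p := p.1.2
  dirOf z := if h : z = 0 then 1 else lineOf (Units.mk0 z h)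
  region := Set.univ
  params := {fun a => RealPlane.mk a.1 (unitOf 1 a.2 (Or.inl one_ne_zero)),
    fun a => RealPlane.mk a.2 (unitOf a.1 1 (Or.inr one_ne_zero))}

/-- The canonical map from the polar to the real modification of `ℂ`,
`(r, exp (i θ)) ↦ (r exp (i θ), [cos θ : sin θ])`. -/
def polarToReal (p : ℝ≥0 × Circle) : RealPlane := RealPlane.mk p.1 (Circle.toUnits p.2)

/-! ### Normal blowing up of the toric manifold along its compact divisors -/

/-- The strictly positive vertices of a cone. -/
abbrev PosIdx {n : ℕ} (s : Finset (Fin n → ℕ)) : Type := {P : s // StrictlyPos P.1}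

/-- The other vertices of a cone. -/
abbrev NonposIdx {n : ℕ} (s : Finset (Fin n → ℕ)) : Type := {P : s // ¬ StrictlyPos P.1}

/-- The part of the blowing up over the chart `ℂ^σ`: the coordinate planes transverse to the
divisors `{u_P = 0}`, `P` strictly positive, are replaced by their modification. -/
abbrev BlowupChart {n : ℕ} (M : PlaneModification) (s : Finset (Fin n → ℕ)) : Type :=
  (PosIdx s → M.Pt) × (NonposIdx s → ℂ)

namespace BlowupChart

variable {n : ℕ} {M : PlaneModification} {s : Finset (Fin n → ℕ)}

/-- The coordinates in `ℂ^σ` of a point of the blowing up. -/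
def coord (x : BlowupChart M s) (P : s) : ℂ :=
  if h : StrictlyPos P.1 then M.val (x.1 ⟨P, h⟩) else x.2 ⟨P, h⟩

/-- The directions of the coordinates. (For `P` not strictly positive with vanishing coordinate
this is a dummy value, which never enters a gluing map.) -/
def dir (x : BlowupChart M s) (P : s) : M.Dir :=
  if h : StrictlyPos P.1 then M.dir (x.1 ⟨P, h⟩) else M.dirOf (x.2 ⟨P, h⟩)

end BlowupChart

namespace RegularFan

variable {n : ℕ} (F : RegularFan n) (M : PlaneModification)

/-- The gluing relation: the coordinates are related by the gluing maps of the toric manifold, and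
the directions normal to the divisors by the same monomials. -/
def blowupRel (x y : Σ s : F.maxCones, BlowupChart M s.1) : Prop :=
  ∃ a : x.1.1 → y.1.1 → ℤ, IsTransition a ∧ IsDefinedAt a x.2.coord ∧
    (∀ Q, y.2.coord Q = ∏ P, x.2.coord P ^ a P Q) ∧
    (∀ Q, StrictlyPos Q.1 → y.2.dir Q = ∏ P, x.2.dir P ^ a P Q)

/-- The normal blowing up of the toric manifold along the divisors of the strictly positive
vertices, with the quotient topology. -/
def Blowup : Type := Quot (F.blowupRel M)

instance : TopologicalSpace (F.Blowup M) :=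
  inferInstanceAs (TopologicalSpace (Quot (F.blowupRel M)))

/-- The chart of the blowing up over `ℂ^σ`. -/
def blowupMk (s : F.maxCones) (x : BlowupChart M s.1) : F.Blowup M := Quot.mk _ ⟨s, x⟩

/-- The projection `ω` of the blowing up to the toric manifold. -/
def blowupProj : F.Blowup M → F.Toric :=
  Quot.map (fun x => ⟨x.1, x.2.coord⟩) (by
    rintro x y ⟨a, h1, h2, h3, -⟩
    exact ⟨a, h1, h2, h3⟩)

/-- The composite of the normal blowing up with the toric modification. -/
def blowupMap (p : F.Blowup M) : Fin n → ℂ := F.toricMap (F.blowupProj M p)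

/-- The inverse image of the divisor of `P` in the blowing up. -/
def blowupDivisor (P : Fin n → ℕ) : Set (F.Blowup M) := F.blowupProj M ⁻¹' F.divisor P

/-- The normal polar blowing up `𝒫X`. -/
abbrev PolarBlowup : Type := F.Blowup polarPlane

/-- The normal real blowing up `ℛX`. -/
abbrev RealBlowup : Type := F.Blowup realPlane

/-- The domain of the coordinate systems of the blowing up over `ℂ^σ`. -/
def coordRegion (s : Finset (Fin n → ℕ)) : Set ((PosIdx s → ℝ × ℝ) × (NonposIdx s → ℂ)) :=
  {b | ∀ P, b.1 P ∈ M.region}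

/-- The parametrization of the chart over `ℂ^σ` by real coordinates, for a choice of a coordinate
system on each of the modified coordinate planes. -/
def blowupParam (s : F.maxCones) (p : PosIdx s.1 → ℝ × ℝ → M.Pt)
    (b : (PosIdx s.1 → ℝ × ℝ) × (NonposIdx s.1 → ℂ)) : F.Blowup M :=
  F.blowupMk M s (fun P => p P (b.1 P), b.2)

end RegularFan

/-! ### Real analytic manifolds (with corners), analytic subsets, resolutions -/

/-- `u : U → V` is an analytic coordinate system on the open set `U` with inverse `g`, which
identifies `U` with a relatively open subset of `C`. -/
structure IsLocalCoord {E H Y V : Type*} [NormedAddCommGroup E] [NormedSpace ℝ E]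
    [TopologicalSpace H] (I : ModelWithCorners ℝ E H) [TopologicalSpace Y] [ChartedSpace H Y]
    [NormedAddCommGroup V] [NormedSpace ℝ V] (C : Set V) (U : Set Y) (u : Y → V) (g : V → Y) :
    Prop where
  isOpen : IsOpen U
  analytic : ContMDiffOn I 𝓘(ℝ, V) ω u U
  image : ∃ W : Set V, IsOpen W ∧ u '' U = W ∩ C
  left_inv : ∀ y ∈ U, g (u y) = y
  analytic_symm : ContMDiffOn 𝓘(ℝ, V) I ω g (u '' U)

/-- The real analytic structure on the blowing up is the one defined by its coordinate systems:
each parametrization is, near each point of its domain, the inverse of an analytic coordinate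
system. -/
def RegularFan.IsBlowupStructure {n : ℕ} (F : RegularFan n) (M : PlaneModification)
    {E H : Type*} [NormedAddCommGroup E] [NormedSpace ℝ E] [TopologicalSpace H]
    (I : ModelWithCorners ℝ E H) [ChartedSpace H (F.Blowup M)] : Prop :=
  ∀ (s : F.maxCones) (p : PosIdx s.1 → ℝ × ℝ → M.Pt), (∀ P, p P ∈ M.params) →
    ∀ b ∈ RegularFan.coordRegion M s.1, ∃ (U : Set (F.Blowup M))
      (u : F.Blowup M → (PosIdx s.1 → ℝ × ℝ) × (NonposIdx s.1 → ℂ)),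
      F.blowupParam M s p b ∈ U ∧ u (F.blowupParam M s p b) = b ∧
      IsLocalCoord I (RegularFan.coordRegion M s.1) U u (F.blowupParam M s p)

section Analytic

variable {E H Y : Type*} [NormedAddCommGroup E] [NormedSpace ℝ E] [TopologicalSpace H]
  (I : ModelWithCorners ℝ E H) [TopologicalSpace Y] [ChartedSpace H Y]

/-- Closed real analytic subsets: closed subsets that are locally the zero set of a real analytic
function (equivalently, of finitely many). -/
def IsAnalyticSubset (A : Set Y) : Prop :=
  IsClosed A ∧ ∀ x ∈ A, ∃ (U : Set Y) (h : Y → ℝ), IsOpen U ∧ x ∈ U ∧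
    ContMDiffOn I 𝓘(ℝ, ℝ) ω h U ∧ U ∩ A = {y | y ∈ U ∧ h y = 0}

/-- Irreducible analytic subsets. -/
def IsIrreducibleAnalytic (A : Set Y) : Prop :=
  IsAnalyticSubset I A ∧ A.Nonempty ∧ ∀ B C : Set Y, IsAnalyticSubset I B → IsAnalyticSubset I C →
    A = B ∪ C → A = B ∨ A = C

/-- `A` is an irreducible component of `S`. -/
def IsIrredComponent (A S : Set Y) : Prop :=
  Maximal (fun B => IsIrreducibleAnalytic I B ∧ B ⊆ S) A

end Analytic

/-- The model of `2n`-dimensional manifolds with boundary (and corners). -/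
abbrev cornerModel (n : ℕ) :
    ModelWithCorners ℝ (EuclideanSpace ℝ (Fin (2 * n))) (EuclideanQuadrant (2 * n)) :=
  modelWithCornersEuclideanQuadrant (2 * n)

section Resolution

variable {n : ℕ} {Y : Type*} [TopologicalSpace Y] [ChartedSpace (EuclideanQuadrant (2 * n)) Y]

/-- `(U, u)` is a local analytic coordinate system centered at `x`, with coordinates
`u_1, …, u_{2n}`, in which `Y` is given by the inequalities `u_i ≥ 0`, `i ∈ S`. -/
def IsCenteredCoord (x : Y) (S : Set (Fin (2 * n))) (U : Set Y) (u : Y → Fin (2 * n) → ℝ) : Prop :=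
  x ∈ U ∧ u x = 0 ∧
    ∃ g, IsLocalCoord (cornerModel n) {v : Fin (2 * n) → ℝ | ∀ i ∈ S, 0 ≤ v i} U u g

/-- The strict transform: the closure of the inverse image of `V` minus the origin. -/
def strictTransform (f : MixedFunction n) (Φ : Y → Fin n → ℂ) : Set Y :=
  closure (Φ ⁻¹' (f.zeroLocus \ {0}))

/-- The function `h` has multiplicity `m` along the boundary hypersurface `D`: near every point of
`D` it is the product of the `m`-th power of a local coordinate defining `D` and of an analytic
function which does not vanish identically on `D` near the point. -/
def HasMultiplicityAlong (h : Y → ℂ) (D : Set Y) (m : ℕ) : Prop :=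
  ∀ x ∈ D, ∃ (S : Set (Fin (2 * n))) (U : Set Y) (u : Y → Fin (2 * n) → ℝ) (i : Fin (2 * n))
    (q : Y → ℂ), IsCenteredCoord x S U u ∧ i ∈ S ∧ U ∩ D = {y | y ∈ U ∧ u y i = 0} ∧
      ContMDiffOn (cornerModel n) 𝓘(ℝ, ℂ) ω q U ∧ (∀ y ∈ U, h y = ((u y i ^ m : ℝ) : ℂ) * q y) ∧
      x ∈ closure {y | y ∈ U ∧ y ∈ D ∧ q y ≠ 0}

open Classical in
/-- `Φ : Y → ℂⁿ` is a good resolution of polar type of `f`, with exceptional divisors `D i`, and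
`m i` is the exponent of the equation of `D i` in the normal form of `f ∘ Φ`. -/
structure IsPolarResolution {ι : Type*} [Fintype ι] (f : MixedFunction n) (Φ : Y → Fin n → ℂ)
    (D : ι → Set Y) (m : ι → ℕ) : Prop where
  /-- `Y` is a real analytic manifold with boundary of dimension `2n` -/
  manifold : IsManifold (cornerModel n) ω Y
  t2 : T2Space Y
  secondCountable : SecondCountableTopology Y
  /-- `Φ` is proper and real analytic -/
  proper : IsProperMap Φ
  analytic : ContMDiff (cornerModel n) 𝓘(ℝ, Fin n → ℂ) ω Φ
  /-- the `D i` are the irreducible components of the exceptional set -/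
  injective : Function.Injective D
  components : ∀ A : Set Y, (∃ i, D i = A) ↔ IsIrredComponent (cornerModel n) A (Φ ⁻¹' {0})
  union : Φ ⁻¹' {0} = ⋃ i, D i
  /-- each of them is a smooth subvariety of real codimension one -/
  smooth_divisor : ∀ i, ∀ x ∈ D i, ∃ (S : Set (Fin (2 * n))) (U : Set Y)
    (u : Y → Fin (2 * n) → ℝ) (k : Fin (2 * n)), IsCenteredCoord x S U u ∧ k ∈ S ∧
      U ∩ D i = {y | y ∈ U ∧ u y k = 0}
  /-- the boundary of `Y` is the exceptional set -/
  boundary : (cornerModel n).boundary Y = Φ ⁻¹' {0}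
  /-- off the exceptional set, `Φ` is an analytic diffeomorphism onto the complement of `0` -/
  diffeo : ∃ g : (Fin n → ℂ) → Y, Set.MapsTo Φ (Φ ⁻¹' {0})ᶜ {0}ᶜ ∧
    Set.MapsTo g {0}ᶜ (Φ ⁻¹' {0})ᶜ ∧ Set.InvOn g Φ (Φ ⁻¹' {0})ᶜ {0}ᶜ ∧
    ContMDiffOn 𝓘(ℝ, Fin n → ℂ) (cornerModel n) ω g {0}ᶜ
  /-- the strict transform is smooth of codimension two near the exceptional set -/
  smooth_strict : ∃ O : Set Y, IsOpen O ∧ Φ ⁻¹' {0} ⊆ O ∧ ∀ x ∈ strictTransform f Φ ∩ O,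
    ∃ (S : Set (Fin (2 * n))) (U : Set Y) (u : Y → Fin (2 * n) → ℝ) (k l : Fin (2 * n)),
      IsCenteredCoord x S U u ∧ k ≠ l ∧ k ∉ S ∧ l ∉ S ∧
      U ∩ strictTransform f Φ = {y | y ∈ U ∧ u y k = 0 ∧ u y l = 0}
  /-- the normal form of `f ∘ Φ` at a point of the strict transform lying on the divisors `D i`,
  `i ∈ J`, and on no other: the coordinate defining `D i` is `u_{κ i}` -/
  normal_form : ∀ x ∈ strictTransform f Φ ∩ Φ ⁻¹' {0},
    ∀ J : Finset ι, (∀ i, i ∈ J ↔ x ∈ D i) →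
    ∃ (κ : ι → Fin (2 * n)) (k l : Fin (2 * n)) (U : Set Y) (u : Y → Fin (2 * n) → ℝ),
      Set.InjOn κ J ∧ k ≠ l ∧ k ∉ κ '' J ∧ l ∉ κ '' J ∧ IsCenteredCoord x (κ '' J) U u ∧
      (∀ i ∈ J, U ∩ D i = {y | y ∈ U ∧ u y (κ i) = 0}) ∧
      U ∩ strictTransform f Φ = {y | y ∈ U ∧ u y k = 0 ∧ u y l = 0} ∧
      Φ '' U ⊆ f.domain ∧
      ∀ y ∈ U, f.toFun (Φ y) =
        ((∏ i ∈ J, u y (κ i) ^ m i : ℝ) : ℂ) * ((u y k : ℂ) + Complex.I * (u y l : ℂ))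

end Resolution

end MixedResolution

end

open MixedResolution

/-!
The theorem is a local computation in the charts of the blowing up, once the blowing up is known to
be a Hausdorff manifold on which the projection to `ℂⁿ` is proper. Both the polar and the real
modification of the plane satisfy the same few axioms (`PlaneModification.IsAnalytic`), so that the
gluing is treated once for both.

*Gluing.* Two points of two charts are identified exactly if the monomial change of charts is defined
at one of them and maps it to the other (`blowupMk_eq_iff`); hence the charts are open embeddings.
The coefficients of a vector in the cones containing it form a Lipschitz function
(`exists_coef_lipschitz`). Applied to the logarithms of the absolute values of the coordinates, this
bounds from below the coordinates of the vertices not common to two cones (`exists_lower_bound`),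
which gives separatedness. Similarly every point of the torus over a bounded set has bounded
coordinates in the chart of the cone that contains the vector `log R - log |z|`, which gives
properness (`isProperMap_blowupMap`). The real analytic structures come from the parametrizations,
whose transition maps are analytic (`IsParamSystem.exists_chartedSpace`).

*The exceptional set.* By convenience no cone is generated by the standard basis if `n ≥ 2`:
otherwise the face would be constant on the open quadrant and some monomial would be minimal for all
standard vectors at once, hence constant. Therefore a point lies over the origin if and only if it
lies on the divisor of a strictly positive vertex (`blowupMap_eq_zero_iff`), and off this set the
projection has the analytic inverse given by monomials. The divisors are connected, and irreducible
by the identity theorem on the slices `r_P = 0` of the charts.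

*The normal form.* Near a point on the divisors of the vertices `P ∈ J` the pull-back of `f` is
`∏ r_P ^ d(P; f)` times an analytic function `g` of the polar coordinates; on the intersection of
these divisors `g` is the sum of the monomials that are minimal for all `P ∈ J`
(`MixedFunction.exists_factorization`). Non-degeneracy for the sum `Q` of all vertices with vanishing
coordinate says that `g` is a submersion along this intersection at its zeros
(`exists_fderiv_factor_eq`): after replacing the vanishing coordinates by `1`, the function `g`
becomes the face function `f_Q`, because `f_Q` is homogeneous in the radii and because, for the
standard vectors, the minimal degree is `0`. So the radii `r_P`, the real and the imaginary part of
`g` are part of an analytic coordinate system by the inverse function theorem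
(`exists_normal_coordinates`). In it the strict transform is the zero set of `g`, since every zero of
`g` is a limit of zeros off the divisors. The multiplicity is read off from the factorization in the
same way, as `g` does not vanish identically on a divisor.

*The canonical factorization.* The map is defined in the charts by the given formula, which is
compatible with the gluing; it is unique because over the dense torus both projections to the toric
manifold are injective.
-/

noncomputable section

open scoped Topology

namespace MixedResolution

/-! ### Linear algebra of the cones of a regular fan -/

namespace RegularFan

variable {n : ℕ} (F : RegularFan n)

theorem exists_dual (s : F.maxCones) : ∃ b : Fin n → s.1 → ℤ,
    (∀ k j, ∑ P : s.1, b k P * (P.1 j : ℤ) = if k = j then 1 else 0) ∧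
    ∀ P Q : s.1, ∑ k, (P.1 k : ℤ) * b k Q = if P = Q then 1 else 0 := by
  set B := Module.Basis.mk (F.linearIndependent s.1 s.2) (F.span_eq_top s.1 s.2).ge with hB
  have h1 : ∀ v : Fin n → ℤ, ∀ Q, B.repr v Q = ∑ k, v k * B.repr (Pi.single k 1) Q := by
    intro v Q
    have hv : v = ∑ k, v k • (Pi.single k (1 : ℤ) : Fin n → ℤ) := by
      funext j
      simp [Finset.sum_apply, Pi.single_apply]
    conv_lhs => rw [hv]
    simp only [map_sum, map_smul, Finsupp.coe_finsetSum, Finset.sum_apply, Finsupp.smul_apply,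
      smul_eq_mul]
  refine ⟨fun k P => B.repr (Pi.single k 1) P, fun k j => ?_, fun P Q => ?_⟩
  · have := congrFun (B.sum_repr (Pi.single k 1)) j
    rw [Finset.sum_apply] at this
    simp only [hB, Module.Basis.mk_apply, Pi.smul_apply, smul_eq_mul] at this
    simp only [hB, this, Pi.single_apply]
    simp [eq_comm]
  · rw [← h1 (fun k => ((P.1 k : ℕ) : ℤ)) Q]
    have : (fun k => ((P.1 k : ℕ) : ℤ)) = B P := by simp [hB]
    rw [this, B.repr_self, Finsupp.single_apply]

/-- The coordinates of the standard basis vectors in the basis of `ℤⁿ` formed by the vertices of a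
cone: `e_k = ∑ P, dual s k P • P`. -/
def dual (s : F.maxCones) : Fin n → s.1 → ℤ := (F.exists_dual s).choose

theorem dual_mul (s : F.maxCones) (k j : Fin n) :
    ∑ P : s.1, F.dual s k P * (P.1 j : ℤ) = if k = j then 1 else 0 :=
  (F.exists_dual s).choose_spec.1 k j

theorem mul_dual (s : F.maxCones) (P Q : s.1) :
    ∑ k, (P.1 k : ℤ) * F.dual s k Q = if P = Q then 1 else 0 :=
  (F.exists_dual s).choose_spec.2 P Q

theorem card_eq (s : F.maxCones) : s.1.card = n := by
  have B := Module.Basis.mk (F.linearIndependent s.1 s.2) (F.span_eq_top s.1 s.2).ge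
  have h := Module.finrank_eq_card_basis B
  simpa using h.symm

/-- The matrix `τ⁻¹ σ` of the change of charts. -/
def transMat (s t : F.maxCones) (P : s.1) (Q : t.1) : ℤ := ∑ k, (P.1 k : ℤ) * F.dual t k Q

theorem isTransition_transMat (s t : F.maxCones) : IsTransition (F.transMat s t) := by
  intro P j
  simp only [transMat, Finset.sum_mul]
  rw [Finset.sum_comm]
  simp only [mul_assoc, ← Finset.mul_sum, dual_mul]
  simp

theorem eq_transMat {s t : F.maxCones} {a : s.1 → t.1 → ℤ} (ha : IsTransition a) :
    a = F.transMat s t := by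
  funext P Q
  simp only [transMat, ha P, Finset.sum_mul]
  rw [Finset.sum_comm]
  simp only [mul_assoc, ← Finset.mul_sum, mul_dual]
  simp

theorem transMat_of_mem {s t : F.maxCones} (P : s.1) (h : P.1 ∈ t.1) (Q : t.1) :
    F.transMat s t P Q = if P.1 = Q.1 then 1 else 0 := by
  have := F.mul_dual t ⟨P.1, h⟩ Q
  simp only [Subtype.ext_iff] at this
  exact this

theorem transMat_mul (s t r : F.maxCones) (P : s.1) (R : r.1) :
    ∑ Q : t.1, F.transMat s t P Q * F.transMat t r Q R = F.transMat s r P R := by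
  have h : ∀ Q : t.1, F.transMat s t P Q * F.transMat t r Q R =
      ∑ k, F.transMat s t P Q * (Q.1 k : ℤ) * F.dual r k R := by
    intro Q
    simp only [transMat, Finset.mul_sum]
    exact Finset.sum_congr rfl fun k _ => by ring
  simp only [h]
  rw [Finset.sum_comm]
  simp only [← Finset.sum_mul, ← F.isTransition_transMat s t P]
  rfl

/-- The coefficient of the vertex `P` in the expression of the real vector `x` in the basis formed
by the vertices of a cone; it is `0` if `P` is not a vertex of the cone. -/
def coef (s : F.maxCones) (x : Fin n → ℝ) (P : Fin n → ℕ) : ℝ :=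
  if h : P ∈ s.1 then ∑ k, x k * (F.dual s k ⟨P, h⟩ : ℝ) else 0

theorem sum_coef (s : F.maxCones) (x : Fin n → ℝ) (j : Fin n) :
    ∑ P ∈ s.1, F.coef s x P * (P j : ℝ) = x j := by
  rw [← Finset.sum_coe_sort]
  have h : ∀ P : s.1, F.coef s x P.1 * (P.1 j : ℝ) = ∑ k, x k * ((F.dual s k P * (P.1 j : ℤ) : ℤ) : ℝ) := by
    intro P
    simp only [coef, P.2, dif_pos, Finset.sum_mul]
    refine Finset.sum_congr rfl fun k _ => ?_
    push_cast
    ring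
  simp only [h]
  rw [Finset.sum_comm]
  simp only [← Finset.mul_sum, ← Int.cast_sum, dual_mul]
  simp

theorem coef_of_sum (s : F.maxCones) {u : Finset (Fin n → ℕ)} (hu : u ⊆ s.1)
    {x : Fin n → ℝ} {c : (Fin n → ℕ) → ℝ} (hx : ∀ k, x k = ∑ P ∈ u, c P * (P k : ℝ))
    (P : Fin n → ℕ) : F.coef s x P = if P ∈ u then c P else 0 := by
  by_cases h : P ∈ s.1
  · have key : ∀ Q ∈ u, ∑ k, (Q k : ℝ) * (F.dual s k ⟨P, h⟩ : ℝ) = if Q = P then 1 else 0 := by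
      intro Q hQ
      have := F.mul_dual s ⟨Q, hu hQ⟩ ⟨P, h⟩
      simp only [Subtype.mk.injEq] at this
      exact_mod_cast this
    simp only [coef, h, dif_pos, hx, Finset.sum_mul]
    rw [Finset.sum_comm]
    simp only [mul_assoc, ← Finset.mul_sum]
    rw [Finset.sum_congr rfl fun Q hQ => by rw [key Q hQ]]
    simp
  · have h' : P ∉ u := fun hP => h (hu hP)
    simp [coef, h, h']

theorem mem_cone_iff (s : F.maxCones) (x : Fin n → ℝ) :
    x ∈ cone s.1 ↔ ∀ P, 0 ≤ F.coef s x P := by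
  constructor
  · rintro ⟨t, ht, hx⟩ P
    rw [F.coef_of_sum s subset_rfl hx]
    split_ifs with h
    · exact ht P h
    · exact le_rfl
  · intro h
    exact ⟨F.coef s x, fun P _ => h P, fun k => (F.sum_coef s x k).symm⟩

theorem coef_eq_of_mem {s t : F.maxCones} {x : Fin n → ℝ} (hs : x ∈ cone s.1)
    (ht : x ∈ cone t.1) (P : Fin n → ℕ) : F.coef s x P = F.coef t x P := by
  have h : x ∈ cone (s.1 ∩ t.1) := by rw [← F.inter s.1 s.2 t.1 t.2]; exact ⟨hs, ht⟩
  obtain ⟨c, -, hx⟩ := h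
  rw [F.coef_of_sum s Finset.inter_subset_left hx, F.coef_of_sum t Finset.inter_subset_right hx]

theorem coef_vertex (s : F.maxCones) {P : Fin n → ℕ} (hP : P ∈ s.1) :
    F.coef s (fun k => (P k : ℝ)) P = 1 := by
  rw [F.coef_of_sum s (u := {P}) (c := 1) (by simpa using hP) (by simp)]
  simp

theorem mem_of_mem_cone {s t : F.maxCones} {P : Fin n → ℕ} (hP : P ∈ s.1)
    (h : (fun k => (P k : ℝ)) ∈ cone t.1) : P ∈ t.1 := by
  have hs : (fun k => (P k : ℝ)) ∈ cone s.1 := by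
    rw [mem_cone_iff]
    intro Q
    rw [F.coef_of_sum s (u := {P}) (c := 1) (by simpa using hP) (by simp)]
    split_ifs <;> simp
  have h1 := F.coef_eq_of_mem hs h P
  rw [F.coef_vertex s hP] at h1
  by_contra hPt
  simp [coef, hPt] at h1

theorem coef_natCast {s t : F.maxCones} (P : s.1) (Q : t.1) :
    F.coef t (fun k => (P.1 k : ℝ)) Q.1 = (F.transMat s t P Q : ℝ) := by
  simp [coef, transMat]

/-- The change of charts from `ℂ^σ` to `ℂ^τ` has no negative exponent on the coordinate of `P`
exactly when `P` is a common vertex. -/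
theorem transMat_nonneg_iff {s t : F.maxCones} (P : s.1) :
    (∀ Q, 0 ≤ F.transMat s t P Q) ↔ P.1 ∈ t.1 := by
  constructor
  · intro h
    refine F.mem_of_mem_cone P.2 ((F.mem_cone_iff t _).2 fun Q => ?_)
    by_cases hQ : Q ∈ t.1
    · have := F.coef_natCast P (⟨Q, hQ⟩ : t.1)
      rw [this]
      exact_mod_cast h ⟨Q, hQ⟩
    · simp [coef, hQ]
  · intro h Q
    rw [F.transMat_of_mem P h]
    split_ifs <;> norm_num

theorem isDefinedAt_iff {s t : F.maxCones} (u : s.1 → ℂ) :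
    IsDefinedAt (F.transMat s t) u ↔ ∀ P : s.1, P.1 ∉ t.1 → u P ≠ 0 := by
  simp only [IsDefinedAt, F.transMat_nonneg_iff]
  exact forall_congr' fun P => by tauto

theorem exists_mem_cone {x : Fin n → ℝ} (hx : ∀ k, 0 ≤ x k) : ∃ s : F.maxCones, x ∈ cone s.1 := by
  have : x ∈ ⋃ s ∈ F.maxCones, cone s := by rw [F.cover]; exact hx
  simp only [Set.mem_iUnion] at this
  obtain ⟨s, hs, h⟩ := this
  exact ⟨⟨s, hs⟩, h⟩

theorem isClosed_cone (s : F.maxCones) : IsClosed (cone s.1) := by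
  have : cone s.1 = ⋂ P, {x | 0 ≤ F.coef s x P} := by
    ext x; simp [mem_cone_iff]
  rw [this]
  refine isClosed_iInter fun P => isClosed_le continuous_const ?_
  unfold coef
  split_ifs
  · fun_prop
  · exact continuous_const

theorem coef_sub (s : F.maxCones) (x y : Fin n → ℝ) (P : Fin n → ℕ) :
    F.coef s (x - y) P = F.coef s x P - F.coef s y P := by
  unfold coef
  split_ifs
  · simp [sub_mul, Finset.sum_sub_distrib]
  · simp

theorem coef_smul (s : F.maxCones) (c : ℝ) (x : Fin n → ℝ) (P : Fin n → ℕ) :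
    F.coef s (c • x) P = c * F.coef s x P := by
  unfold coef
  split_ifs
  · simp [mul_assoc, Finset.mul_sum]
  · simp

theorem exists_coef_bound : ∃ L : ℝ, 0 ≤ L ∧
    ∀ (s : F.maxCones) (x : Fin n → ℝ) (P : Fin n → ℕ), |F.coef s x P| ≤ L * ‖x‖ := by
  refine ⟨∑ s : F.maxCones, ∑ P : s.1, ∑ k, |(F.dual s k P : ℝ)|, by positivity,
    fun s x P => ?_⟩
  unfold coef
  split_ifs with h
  · calc |∑ k, x k * (F.dual s k ⟨P, h⟩ : ℝ)| ≤ ∑ k, |x k * (F.dual s k ⟨P, h⟩ : ℝ)| :=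
          Finset.abs_sum_le_sum_abs _ _
      _ ≤ ∑ k, |(F.dual s k ⟨P, h⟩ : ℝ)| * ‖x‖ := by
          refine Finset.sum_le_sum fun k _ => ?_
          rw [abs_mul, mul_comm]
          exact mul_le_mul_of_nonneg_left (norm_le_pi_norm x k) (abs_nonneg _)
      _ = (∑ k, |(F.dual s k ⟨P, h⟩ : ℝ)|) * ‖x‖ := by rw [Finset.sum_mul]
      _ ≤ _ := by
          refine mul_le_mul_of_nonneg_right ?_ (norm_nonneg _)
          refine le_trans ?_ (Finset.single_le_sum (f := fun s : F.maxCones =>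
            ∑ P : s.1, ∑ k, |(F.dual s k P : ℝ)|) (fun _ _ => by positivity) (Finset.mem_univ s))
          exact Finset.single_le_sum (f := fun P : s.1 => ∑ k, |(F.dual s k P : ℝ)|)
            (fun _ _ => by positivity) (Finset.mem_univ (⟨P, h⟩ : s.1))
  · simp only [abs_zero]; positivity

/-- A function on `[0, 1]` that is `K`-Lipschitz on each of finitely many closed sets covering this
interval increases by at most `K`. -/
theorem _root_.lipschitz_of_finite_closed_cover {ι : Type*} [Finite ι] {A : ι → Set ℝ}
    (hA : ∀ i, IsClosed (A i)) (hcov : Set.Icc (0 : ℝ) 1 ⊆ ⋃ i, A i) {g : ℝ → ℝ} {K : ℝ}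
    (hg : ∀ i, ∀ x ∈ A i, ∀ y ∈ A i, |g x - g y| ≤ K * |x - y|) : g 1 - g 0 ≤ K := by
  have hcont : ∀ x ∈ Set.Icc (0 : ℝ) 1, ContinuousWithinAt g (⋃ i, A i) x := by
    intro x _
    have : (𝓝[⋃ i, A i] x) = ⨆ i, 𝓝[A i] x := nhdsWithin_iUnion A x
    rw [ContinuousWithinAt, this]
    refine Filter.tendsto_iSup.2 fun i => ?_
    by_cases hx : x ∈ A i
    · have h0 : Filter.Tendsto (fun y => K * |y - x|) (𝓝[A i] x) (𝓝 0) := by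
        have : ContinuousAt (fun y : ℝ => K * |y - x|) x := by fun_prop
        have h := this.tendsto
        simp only [sub_self, abs_zero, mul_zero] at h
        exact h.mono_left nhdsWithin_le_nhds
      rw [tendsto_iff_dist_tendsto_zero]
      refine squeeze_zero' (Filter.Eventually.of_forall fun _ => dist_nonneg) ?_ h0
      filter_upwards [self_mem_nhdsWithin] with y hy
      exact hg i y hy x hx
    · have : 𝓝[A i] x = ⊥ := by
        rw [← notMem_closure_iff_nhdsWithin_eq_bot]
        rwa [(hA i).closure_eq]
      rw [this]
      exact Filter.tendsto_bot
  have key := image_le_of_liminf_slope_right_le_deriv_boundary (f := g) (a := 0) (b := 1)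
    (B := fun x => g 0 + K * x) (B' := fun _ => K)
    (fun x hx => (hcont x hx).mono hcov) (by simp) (by fun_prop)
    (fun x _ => by
      have := ((hasDerivWithinAt_id x (Set.Ici x)).const_mul K).const_add (g 0)
      simpa using this)
    (fun x hx r hr => by
      have hev : ∃ᶠ z in 𝓝[>] x, ∃ i, z ∈ A i := by
        refine Filter.Eventually.frequently ?_
        filter_upwards [Ioo_mem_nhdsGT hx.2] with z hz
        exact Set.mem_iUnion.1 (hcov ⟨hx.1.trans hz.1.le, hz.2.le⟩)
      rw [Filter.frequently_exists] at hev
      obtain ⟨i, hi⟩ := hev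
      have hxA : x ∈ A i := by
        rw [← (hA i).closure_eq, mem_closure_iff_frequently]
        exact hi.filter_mono nhdsWithin_le_nhds
      refine (hi.and_eventually self_mem_nhdsWithin).mono ?_
      rintro z ⟨hz, hxz⟩
      have hxz' : 0 < z - x := sub_pos.2 hxz
      have h1 := (abs_le.1 (hg i z hz x hxA)).2
      rw [abs_of_pos hxz'] at h1
      rw [slope_def_field, div_lt_iff₀ hxz']
      exact h1.trans_lt (mul_lt_mul_of_pos_right hr hxz'))
  have := key (Set.right_mem_Icc.2 zero_le_one)
  simp only [mul_one] at this
  linarith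

/-- The coefficients of a vector of `(ℝ≥0)ⁿ` in the cones that contain it form a piecewise linear
Lipschitz function. This is the source of the separatedness of the toric manifold. -/
theorem exists_coef_lipschitz : ∃ L : ℝ, 0 ≤ L ∧ ∀ (s t : F.maxCones) (x y : Fin n → ℝ),
    x ∈ cone s.1 → y ∈ cone t.1 → ∀ P, F.coef s x P - F.coef t y P ≤ L * ‖x - y‖ := by
  obtain ⟨L, hL, hb⟩ := F.exists_coef_bound
  refine ⟨L, hL, fun s t x y hx hy P => ?_⟩
  have hpos : ∀ (r : F.maxCones) (z : Fin n → ℝ), z ∈ cone r.1 → ∀ k, 0 ≤ z k := by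
    intro r z ⟨c, hc, hz⟩ k
    rw [hz]
    exact Finset.sum_nonneg fun Q hQ => mul_nonneg (hc Q hQ) (Nat.cast_nonneg _)
  -- on the part in each cone of the segment from `y` to `x` the coefficient is linear
  set γ : ℝ → Fin n → ℝ := fun τ => y + τ • (x - y) with hγ
  have hγc : Continuous γ := by fun_prop
  have hγpos : ∀ τ ∈ Set.Icc (0 : ℝ) 1, ∀ k, 0 ≤ γ τ k := by
    intro τ hτ k
    have : γ τ k = τ * x k + (1 - τ) * y k := by simp [hγ]; ring
    rw [this]
    exact add_nonneg (mul_nonneg hτ.1 (hpos s x hx k))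
      (mul_nonneg (by linarith [hτ.2]) (hpos t y hy k))
  classical
  set g : ℝ → ℝ := fun τ => if h : ∃ r : F.maxCones, γ τ ∈ cone r.1
    then F.coef h.choose (γ τ) P else 0 with hg
  have hgr : ∀ (r : F.maxCones) τ, γ τ ∈ cone r.1 → g τ = F.coef r (γ τ) P := by
    intro r τ h
    have h' : ∃ r : F.maxCones, γ τ ∈ cone r.1 := ⟨r, h⟩
    simp only [hg, h', dif_pos]
    exact F.coef_eq_of_mem h'.choose_spec h P
  have h := lipschitz_of_finite_closed_cover (A := fun r : F.maxCones => γ ⁻¹' cone r.1)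
    (fun r => (F.isClosed_cone r).preimage hγc)
    (fun τ hτ => by
      obtain ⟨r, hr⟩ := F.exists_mem_cone (hγpos τ hτ)
      exact Set.mem_iUnion.2 ⟨r, hr⟩)
    (g := g) (K := L * ‖x - y‖) (by
      intro r τ hτ τ' hτ'
      rw [hgr r τ hτ, hgr r τ' hτ', ← F.coef_sub]
      have : γ τ - γ τ' = (τ - τ') • (x - y) := by
        simp only [hγ, add_sub_add_left_eq_sub, sub_smul]
      rw [this, F.coef_smul, abs_mul, mul_comm]
      exact mul_le_mul_of_nonneg_right (hb r _ P) (abs_nonneg _))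
  rw [hgr s 1 (by simpa [hγ] using hx), hgr t 0 (by simpa [hγ] using hy)] at h
  simpa [hγ] using h

end RegularFan

/-! ### Analyticity of the modifications of the plane -/

/-- `g` parametrizes the open set `U` by the relatively open subset `W ∩ C` of `C`, with inverse
`u`. -/
structure IsPatch {V Y : Type*} [TopologicalSpace V] [TopologicalSpace Y] (C : Set V) (U : Set Y)
    (u : Y → V) (g : V → Y) (W : Set V) : Prop where
  isOpen_source : IsOpen U
  isOpen_target : IsOpen W
  image : u '' U = W ∩ C
  left_inv : ∀ y ∈ U, g (u y) = y
  continuousOn : ContinuousOn u U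
  continuousOn_symm : ContinuousOn g (W ∩ C)

namespace IsPatch

variable {V Y : Type*} [TopologicalSpace V] [TopologicalSpace Y] {C : Set V} {U : Set Y}
  {u : Y → V} {g : V → Y} {W : Set V} (h : IsPatch C U u g W)
include h

theorem mapsTo {y : Y} (hy : y ∈ U) : u y ∈ W ∩ C := h.image ▸ Set.mem_image_of_mem u hy

theorem symm_mapsTo {v : V} (hv : v ∈ W ∩ C) : g v ∈ U := by
  rw [← h.image] at hv
  obtain ⟨y, hy, rfl⟩ := hv
  rwa [h.left_inv y hy]

theorem right_inv {v : V} (hv : v ∈ W ∩ C) : u (g v) = v := by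
  rw [← h.image] at hv
  obtain ⟨y, hy, rfl⟩ := hv
  rw [h.left_inv y hy]

theorem restrict {W' : Set V} (hW' : IsOpen W') : IsPatch C (U ∩ u ⁻¹' W') u g (W ∩ W') where
  isOpen_source := h.continuousOn.isOpen_inter_preimage h.isOpen_source hW'
  isOpen_target := h.isOpen_target.inter hW'
  image := by
    ext v
    constructor
    · rintro ⟨y, ⟨hy, hy'⟩, rfl⟩
      exact ⟨⟨(h.mapsTo hy).1, hy'⟩, (h.mapsTo hy).2⟩
    · rintro ⟨⟨h1, h2⟩, h3⟩
      have := h.right_inv ⟨h1, h3⟩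
      exact ⟨g v, ⟨h.symm_mapsTo ⟨h1, h3⟩, by rw [Set.mem_preimage, this]; exact h2⟩, this⟩
  left_inv y hy := h.left_inv y hy.1
  continuousOn := h.continuousOn.mono Set.inter_subset_left
  continuousOn_symm := h.continuousOn_symm.mono (by intro v hv; exact ⟨hv.1.1, hv.2⟩)

end IsPatch

/-- What the gluing construction uses of a modification `M` of the plane: the multiplicative group
of `ℂ` acts on `M` compatibly with the projection and with the directions, the action is analytic
in the coordinate systems of `M`, and off the origin the modification is an isomorphism. -/
structure PlaneModification.IsAnalytic (M : PlaneModification) where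
  /-- the action of a nonzero complex number -/
  act : ℂ → M.Pt → M.Pt
  /-- the point over `1` -/
  one : M.Pt
  val_one : M.val one = 1
  val_act : ∀ c, c ≠ 0 → ∀ p, M.val (act c p) = c * M.val p
  dir_act : ∀ c, c ≠ 0 → ∀ p, M.dir (act c p) = M.dirOf c * M.dir p
  dirOf_mul : ∀ c d, c ≠ 0 → d ≠ 0 → M.dirOf (c * d) = M.dirOf c * M.dirOf d
  dir_eq : ∀ p, M.val p ≠ 0 → M.dir p = M.dirOf (M.val p)
  ext : ∀ p q, M.val p = M.val q → M.dir p = M.dir q → p = q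
  continuous_val : Continuous M.val
  continuousAt_act : ∀ c p, c ≠ 0 → ContinuousAt (fun x : ℂ × M.Pt => act x.1 x.2) (c, p)
  dense : Dense {p | M.val p ≠ 0}
  t2 : T2Space M.Pt
  secondCountable : SecondCountableTopology M.Pt
  exists_param : ∀ x, ∃ p ∈ M.params, ∃ a ∈ M.region, p a = x
  patch : ∀ p ∈ M.params, ∀ a ∈ M.region, ∃ U u W, a ∈ W ∧ IsPatch M.region U u p W
  analytic_val : ∀ p ∈ M.params, ∃ F : ℝ × ℝ → ℂ, ContDiff ℝ ω F ∧ ∀ a ∈ M.region, M.val (p a) = F a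
  analytic_act : ∀ p ∈ M.params, ∀ q ∈ M.params, ∀ c ≠ 0, ∀ a ∈ M.region, ∀ b ∈ M.region,
    act c (p a) = q b → ∃ ψ : ℂ × (ℝ × ℝ) → ℝ × ℝ, ContDiffAt ℝ ω ψ (c, a) ∧ ψ (c, a) = b ∧
      ∀ᶠ x in 𝓝 (c, a), x.2 ∈ M.region → ψ x ∈ M.region ∧ act x.1 (p x.2) = q (ψ x)

/-! #### The polar modification -/

theorem coe_exp_arg {c : ℂ} (hc : c ≠ 0) : (Circle.exp c.arg : ℂ) = c / ‖c‖ := by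
  rw [eq_div_iff (by simpa using hc), Circle.coe_exp, mul_comm]
  exact Complex.norm_mul_exp_arg_mul_I c

theorem exp_arg_mul {c d : ℂ} (hc : c ≠ 0) (hd : d ≠ 0) :
    Circle.exp (c * d).arg = Circle.exp c.arg * Circle.exp d.arg := by
  ext
  rw [Circle.coe_mul, coe_exp_arg hc, coe_exp_arg hd, coe_exp_arg (mul_ne_zero hc hd), norm_mul]
  push_cast
  field_simp

theorem contDiffAt_log_div {c₀ c : ℂ} (h : c / c₀ ∈ Complex.slitPlane) :
    ContDiffAt ℝ ω (fun c : ℂ => Complex.log (c / c₀)) c := by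
  refine ContDiffAt.restrict_scalars ℝ (𝕜' := ℂ) ?_
  exact ContDiffAt.comp c (Complex.contDiffAt_log h) (contDiffAt_id.div_const c₀)

theorem isPatch_polar (θ₀ : ℝ) : IsPatch {a : ℝ × ℝ | 0 ≤ a.1}
    {p : ℝ≥0 × Circle | ((p.2 * Circle.exp (-θ₀) : Circle) : ℂ) ∈ Complex.slitPlane}
    (fun p => (p.1, θ₀ + ((p.2 * Circle.exp (-θ₀) : Circle) : ℂ).arg))
    (fun a => (a.1.toNNReal, Circle.exp a.2)) {a | a.2 - θ₀ ∈ Set.Ioo (-Real.pi) Real.pi} where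
  isOpen_source := Complex.isOpen_slitPlane.preimage (by fun_prop)
  isOpen_target := isOpen_Ioo.preimage (by fun_prop)
  image := by
    ext a
    constructor
    · rintro ⟨p, hp, rfl⟩
      refine ⟨?_, p.1.2⟩
      have h := (Complex.mem_slitPlane_iff_arg.1 hp).1
      simp only [Set.mem_ofPred_eq, add_sub_cancel_left]
      exact ⟨Complex.neg_pi_lt_arg _, lt_of_le_of_ne (Complex.arg_le_pi _) h⟩
    · rintro ⟨h1, h2⟩
      have h3 : Circle.exp a.2 * Circle.exp (-θ₀) = Circle.exp (a.2 - θ₀) := by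
        rw [← Circle.exp_add, sub_eq_add_neg]
      have h4 : (Circle.exp (a.2 - θ₀) : ℂ).arg = a.2 - θ₀ := Circle.arg_exp h1.1 h1.2.le
      refine ⟨(a.1.toNNReal, Circle.exp a.2), ?_, ?_⟩
      · simp only [Set.mem_ofPred_eq, h3, Complex.mem_slitPlane_iff_arg, h4]
        exact ⟨h1.2.ne, Circle.coe_ne_zero _⟩
      · simp only [h3, h4]
        ext
        · exact Real.coe_toNNReal _ h2
        · simp
  left_inv := by
    rintro ⟨r, w⟩ _
    ext1
    · simp
    · simp only [Circle.exp_add, Circle.exp_arg]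
      rw [mul_comm, mul_assoc, ← Circle.exp_add]
      simp
  continuousOn := by
    intro p hp
    refine ContinuousAt.continuousWithinAt (ContinuousAt.prodMk (by fun_prop) ?_)
    refine continuousAt_const.add ?_
    exact ContinuousAt.comp (f := fun p : ℝ≥0 × Circle => ((p.2 * Circle.exp (-θ₀) : Circle) : ℂ))
      (Complex.continuousAt_arg hp) (by fun_prop)
  continuousOn_symm := by fun_prop

/-- The structure of the polar modification. -/
def polarAnalytic : polarPlane.IsAnalytic where
  act c p := (‖c‖₊ * (p : ℝ≥0 × Circle).1, Circle.exp c.arg * p.2)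
  one := ((1 : ℝ≥0), (1 : Circle))
  val_one := by simp [polarPlane]
  val_act c hc p := by
    have := coe_exp_arg hc
    simp only [polarPlane, NNReal.coe_mul, coe_nnnorm, Circle.coe_mul, this]
    push_cast
    have : (‖c‖ : ℂ) ≠ 0 := by simpa using hc
    field_simp
  dir_act _ _ _ := rfl
  dirOf_mul c d hc hd := exp_arg_mul hc hd
  dir_eq := by
    rintro ⟨r, w⟩ hp
    simp only [polarPlane] at hp ⊢
    have hr : ((r : ℝ) : ℂ) ≠ 0 := left_ne_zero_of_mul hp
    ext
    rw [coe_exp_arg hp]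
    simp only [norm_mul, Complex.norm_real, NNReal.norm_eq, Circle.norm_coe, mul_one]
    field_simp
  ext := by
    rintro ⟨r, w⟩ ⟨r', w'⟩ h1 h2
    simp only [polarPlane] at h1 h2 ⊢
    subst h2
    ext1
    · have := mul_right_cancel₀ (Circle.coe_ne_zero w) h1
      exact_mod_cast this
    · rfl
  continuous_val := by
    change Continuous fun p : ℝ≥0 × Circle => ((p.1 : ℝ) : ℂ) * (p.2 : ℂ)
    fun_prop
  continuousAt_act := by
    intro c p hc
    change ContinuousAt (fun x : ℂ × (ℝ≥0 × Circle) =>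
      (‖x.1‖₊ * x.2.1, Circle.exp x.1.arg * x.2.2)) (c, p)
    refine ContinuousAt.prodMk (by fun_prop) (ContinuousAt.mul ?_ (by fun_prop))
    have hi : Topology.IsInducing (fun w : Circle => (w : ℂ)) := ⟨rfl⟩
    refine hi.continuousAt_iff.2 ?_
    have : (fun x : ℂ × (ℝ≥0 × Circle) => x.1 / (‖x.1‖ : ℂ)) =ᶠ[𝓝 (c, p)]
        (fun w : Circle => (w : ℂ)) ∘ fun x : ℂ × (ℝ≥0 × Circle) => Circle.exp x.1.arg := by
      have : ∀ᶠ x : ℂ × (ℝ≥0 × Circle) in 𝓝 (c, p), x.1 ≠ 0 :=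
        continuousAt_fst.eventually_ne hc
      filter_upwards [this] with x hx
      exact (coe_exp_arg hx).symm
    refine ContinuousAt.congr ?_ this
    refine ContinuousAt.div (by fun_prop) (by fun_prop) ?_
    simpa using hc
  dense := by
    have h : {p : ℝ≥0 × Circle | polarPlane.val p ≠ 0} = Prod.fst ⁻¹' {0}ᶜ := by
      ext p
      simp [polarPlane]
    have hd : Dense ({0}ᶜ : Set ℝ≥0) := by
      intro x
      by_cases hx : x = 0
      · subst hx
        refine mem_closure_of_tendsto (f := fun k : ℕ => ((k : ℝ≥0) + 1)⁻¹) (b := Filter.atTop) ?_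
          (Filter.Eventually.of_forall fun k => ?_)
        · have := tendsto_one_div_add_atTop_nhds_zero_nat (𝕜 := ℝ≥0)
          simpa using this
        · simp
      · exact subset_closure hx
    exact h ▸ hd.preimage isOpenMap_fst
  t2 := inferInstanceAs (T2Space (ℝ≥0 × Circle))
  secondCountable := inferInstanceAs (SecondCountableTopology (ℝ≥0 × Circle))
  exists_param := by
    rintro ⟨r, w⟩
    refine ⟨_, rfl, (r, (w : ℂ).arg), r.2, ?_⟩
    refine Prod.ext ?_ (Circle.exp_arg w)
    simp
  patch := by
    rintro p rfl a -
    exact ⟨_, _, _, by simp [Real.pi_pos], isPatch_polar a.2⟩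
  analytic_val := by
    rintro p rfl
    refine ⟨fun a => (a.1 : ℂ) * Complex.exp (a.2 * Complex.I), ?_, fun a ha => ?_⟩
    · have h1 : ContDiff ℝ ω fun a : ℝ × ℝ => (a.1 : ℂ) := Complex.ofRealCLM.contDiff.comp contDiff_fst
      have h2 : ContDiff ℝ ω fun a : ℝ × ℝ => (a.2 : ℂ) := Complex.ofRealCLM.contDiff.comp contDiff_snd
      exact h1.mul (h2.mul contDiff_const).cexp
    · simp only [polarPlane, Circle.coe_exp]
      rw [Real.coe_toNNReal _ ha]
  analytic_act := by
    rintro p rfl q rfl c₀ hc a₀ ha b₀ hb h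
    have h1 := congrArg (fun x : ℝ≥0 × Circle => (x.1 : ℝ)) h
    have h2 : Circle.exp c₀.arg * Circle.exp a₀.2 = Circle.exp b₀.2 :=
      congrArg (fun x : ℝ≥0 × Circle => x.2) h
    have ha' : 0 ≤ a₀.1 := ha
    have hb' : 0 ≤ b₀.1 := hb
    simp only [NNReal.coe_mul, coe_nnnorm, Real.coe_toNNReal _ ha', Real.coe_toNNReal _ hb'] at h1
    have hs : c₀ / c₀ ∈ Complex.slitPlane := by rw [div_self hc]; exact Complex.one_mem_slitPlane
    refine ⟨fun x => (‖c₀‖ * Real.exp (Complex.log (x.1 / c₀)).re * x.2.1,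
      x.2.2 + (b₀.2 - a₀.2) + (Complex.log (x.1 / c₀)).im), ?_, ?_, ?_⟩
    · have hl : ContDiffAt ℝ ω (fun x : ℂ × (ℝ × ℝ) => Complex.log (x.1 / c₀)) (c₀, a₀) :=
        ContDiffAt.comp (c₀, a₀) (contDiffAt_log_div hs) contDiffAt_fst
      have hre : ContDiffAt ℝ ω (fun x : ℂ × (ℝ × ℝ) => (Complex.log (x.1 / c₀)).re) (c₀, a₀) :=
        (Complex.reCLM.contDiff.contDiffAt).comp (c₀, a₀) hl
      have him : ContDiffAt ℝ ω (fun x : ℂ × (ℝ × ℝ) => (Complex.log (x.1 / c₀)).im) (c₀, a₀) :=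
        (Complex.imCLM.contDiff.contDiffAt).comp (c₀, a₀) hl
      exact ((contDiffAt_const.mul hre.exp).mul (contDiffAt_fst.comp _ contDiffAt_snd)).prodMk
        (((contDiffAt_snd.comp _ contDiffAt_snd).add contDiffAt_const).add him)
    · ext
      · simp [div_self hc, h1]
      · simp [div_self hc]
    · have hev : ∀ᶠ x : ℂ × (ℝ × ℝ) in 𝓝 (c₀, a₀), x.1 / c₀ ∈ Complex.slitPlane :=
        (continuousAt_fst.div_const c₀).eventually (Complex.isOpen_slitPlane.mem_nhds hs)
      filter_upwards [hev] with x hx hx2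
      have hx0 : x.1 / c₀ ≠ 0 := Complex.slitPlane_ne_zero hx
      have hre : ‖c₀‖ * Real.exp (Complex.log (x.1 / c₀)).re = ‖x.1‖ := by
        rw [Complex.log_re, Real.exp_log (norm_pos_iff.2 hx0), norm_div,
          mul_div_cancel₀ _ (norm_ne_zero_iff.2 hc)]
      have hx2' : 0 ≤ x.2.1 := hx2
      simp only [hre]
      refine ⟨mul_nonneg (norm_nonneg _) hx2', ?_⟩
      refine Prod.ext ?_ ?_
      · ext
        simp only [NNReal.coe_mul, coe_nnnorm, Real.coe_toNNReal _ hx2',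
          Real.coe_toNNReal _ (mul_nonneg (norm_nonneg x.1) hx2')]
      · have h3 : Circle.exp x.1.arg = Circle.exp (x.1 / c₀).arg * Circle.exp c₀.arg := by
          rw [← exp_arg_mul hx0 hc, div_mul_cancel₀ _ hc]
        simp only [Complex.log_im, Circle.exp_add, Circle.exp_sub, ← h2, h3]
        rw [mul_div_cancel_right, mul_comm (Circle.exp (x.1 / c₀).arg), mul_comm (Circle.exp x.2.2),
          mul_assoc, mul_assoc, mul_comm (Circle.exp x.2.2)]

/-! #### The real modification -/

theorem lineOf_eq_iff {w w' : ℂˣ} : lineOf w = lineOf w' ↔ ∃ r : ℝ, r ≠ 0 ∧ (w' : ℂ) = r * w := by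
  rw [lineOf, lineOf, QuotientGroup.eq]
  constructor
  · rintro ⟨r, hr⟩
    refine ⟨r, r.ne_zero, ?_⟩
    have := congrArg (fun u : ℂˣ => ((w * u : ℂˣ) : ℂ)) hr
    simp only [Units.val_mul, Units.coe_map, MonoidHom.coe_coe, mul_inv_cancel_left] at this
    rw [← this, mul_comm]
    simp
  · rintro ⟨r, hr, h⟩
    refine ⟨Units.mk0 r hr, ?_⟩
    ext
    have := w.ne_zero
    simp only [Units.coe_map, MonoidHom.coe_coe, Units.val_mk0, Units.val_mul,
      Units.val_inv_eq_inv_val, h, Complex.coe_algebraMap]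
    field_simp

theorem isOpenQuotientMap_lineOf : IsOpenQuotientMap lineOf := QuotientGroup.isOpenQuotientMap_mk

instance : SecondCountableTopology ℂˣ :=
  Units.isEmbedding_embedProduct.isInducing.secondCountableTopology

instance : SecondCountableTopology RealProjLine :=
  isOpenQuotientMap_lineOf.isQuotientMap.secondCountableTopology isOpenQuotientMap_lineOf.isOpenMap

/-- The equation of the real blowing up: `z` is a real multiple of `w`. -/
theorem isClosed_incidence : IsClosed {p : ℂ × RealProjLine | ∃ w : ℂˣ, p.2 = lineOf w ∧
    (p.1 / w).im = 0} := by
  have hq : IsOpenQuotientMap (Prod.map (id : ℂ → ℂ) lineOf) :=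
    IsOpenQuotientMap.id.prodMap isOpenQuotientMap_lineOf
  rw [← hq.isQuotientMap.isClosed_preimage]
  have : Prod.map (id : ℂ → ℂ) lineOf ⁻¹' {p : ℂ × RealProjLine | ∃ w : ℂˣ, p.2 = lineOf w ∧
      (p.1 / w).im = 0} = {p : ℂ × ℂˣ | (p.1 * (p.2⁻¹ : ℂˣ)).im = 0} := by
    ext ⟨z, w⟩
    simp only [Set.mem_preimage, Set.mem_ofPred_eq, Prod.map_apply, id, Units.val_inv_eq_inv_val,
      ← div_eq_mul_inv]
    constructor
    · rintro ⟨w', h, h'⟩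
      obtain ⟨r, hr, hw⟩ := lineOf_eq_iff.1 h
      have : z / w = r * (z / w') := by
        rw [hw]
        have : (w : ℂ) ≠ 0 := w.ne_zero
        have : (r : ℂ) ≠ 0 := by exact_mod_cast hr
        field_simp
      simp [this, h']
    · exact fun h => ⟨w, rfl, h⟩
  rw [this]
  refine isClosed_eq ?_ continuous_const
  exact Complex.continuous_im.comp
    (continuous_fst.mul (Units.continuous_val.comp (continuous_inv.comp continuous_snd)))

theorem RealPlane.exists_mk (p : RealPlane) : ∃ t w, p = RealPlane.mk t w := by
  have h := closure_minimal (t := {p : ℂ × RealProjLine | ∃ w : ℂˣ, p.2 = lineOf w ∧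
    (p.1 / w).im = 0}) (by
      rintro _ ⟨z, rfl⟩
      exact ⟨z, rfl, by simp⟩) isClosed_incidence p.2
  obtain ⟨w, h1, h2⟩ := h
  refine ⟨(p.1.1 / w).re, w, Subtype.ext (Prod.ext ?_ h1)⟩
  have : (((p.1.1 / w).re : ℝ) : ℂ) = p.1.1 / w := Complex.ext (by simp) (by simp [h2])
  change p.1.1 = _
  simp only [RealPlane.mk, this]
  rw [div_mul_cancel₀ _ w.ne_zero]

theorem RealPlane.mk_eq_iff {t t' : ℝ} {w w' : ℂˣ} : RealPlane.mk t w = RealPlane.mk t' w' ↔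
    ∃ r : ℝ, r ≠ 0 ∧ (w' : ℂ) = r * w ∧ t = t' * r := by
  have hw := w.ne_zero
  have h0 : RealPlane.mk t w = RealPlane.mk t' w' ↔
      (t : ℂ) * w = (t' : ℂ) * w' ∧ lineOf w = lineOf w' :=
    ⟨fun h => ⟨congrArg (fun p : RealPlane => p.1.1) h, congrArg (fun p : RealPlane => p.1.2) h⟩,
      fun h => Subtype.ext (Prod.ext h.1 h.2)⟩
  rw [h0, lineOf_eq_iff]
  constructor
  · rintro ⟨h, r, hr, h'⟩
    refine ⟨r, hr, h', ?_⟩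
    rw [h', ← mul_assoc] at h
    exact_mod_cast mul_right_cancel₀ hw h
  · rintro ⟨r, hr, h, h'⟩
    refine ⟨?_, r, hr, h⟩
    rw [h, h']
    push_cast
    ring

theorem RealPlane.continuous_mk : Continuous fun x : ℝ × ℂˣ => RealPlane.mk x.1 x.2 := by
  refine Continuous.subtype_mk (Continuous.prodMk ?_ ?_) _
  · exact (Complex.continuous_ofReal.comp continuous_fst).mul
      (Units.continuous_val.comp continuous_snd)
  · exact isOpenQuotientMap_lineOf.continuous.comp continuous_snd

theorem continuous_unitOf {X : Type*} [TopologicalSpace X] {f g : X → ℝ} (hf : Continuous f)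
    (hg : Continuous g) (h : ∀ x, f x ≠ 0 ∨ g x ≠ 0) :
    Continuous fun x => unitOf (f x) (g x) (h x) := by
  have hc : Continuous fun x => (⟨f x, g x⟩ : ℂ) :=
    Complex.equivRealProdCLM.symm.continuous.comp (hf.prodMk hg)
  rw [Units.continuous_iff]
  refine ⟨hc, ?_⟩
  have : (Units.val ∘ fun x => (unitOf (f x) (g x) (h x))⁻¹) = fun x => (⟨f x, g x⟩ : ℂ)⁻¹ := by
    funext x
    simp [unitOf]
  exact this ▸ hc.inv₀ fun x => (unitOf (f x) (g x) (h x)).ne_zero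

/-- The value at the line `[w]` of a function of `w` that is invariant under real homotheties. -/
def lineLift (k : ℂ → ℝ) (hk : ∀ (r : ℝ) (w : ℂ), r ≠ 0 → k (r * w) = k w) (l : RealProjLine) : ℝ :=
  Quotient.lift (fun w : ℂˣ => k w) (by
    intro w w' h
    obtain ⟨r, hr, h⟩ := lineOf_eq_iff.1 (Quotient.sound h)
    rw [h, hk r w hr]) l

/-- The coordinates `(x, t)` on the part of the real modification over the lines other than the
vertical one, and `(s, y)` over the lines other than the horizontal one. They are obtained from
one another by exchanging the two coordinates of the plane; `ρ` stands for the real part or for the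
imaginary part, `λ` for the other one and `e` for the order of the coordinates. -/
theorem isPatch_real (ρ l : ℂ →L[ℝ] ℝ) (e : ℝ × ℝ ≃ₜ ℝ × ℝ) (v : ℝ → ℂˣ) (hv : Continuous v)
    (hρ : ∀ t, ρ (v t) = 1) (hl : ∀ t, l (v t) = t)
    (hz : ∀ z : ℂ, ∀ t, z = ρ z * v t ↔ l z = t * ρ z) :
    ∃ U u, IsPatch Set.univ U u
      (fun a => RealPlane.mk (e a).1 (v (e a).2)) Set.univ := by
  set k : ℂ → ℝ := fun w => l w / ρ w
  have hreal : ∀ (f : ℂ →L[ℝ] ℝ) (r : ℝ) (w : ℂ), f (r * w) = r * f w := by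
    intro f r w
    have : (r : ℂ) * w = r • w := by simp
    rw [this, map_smul, smul_eq_mul]
  have hk : ∀ (r : ℝ) (w : ℂ), r ≠ 0 → k (r * w) = k w := by
    intro r w hr
    simp only [k, hreal]
    exact mul_div_mul_left _ _ hr
  have hkl : ∀ w : ℂˣ, lineLift k hk (lineOf w) = k w := fun w => rfl
  set S : Set RealProjLine := lineOf '' {w | ρ w ≠ 0} with hS
  have hSo : IsOpen S := by
    refine isOpenQuotientMap_lineOf.isOpenMap _ ?_
    exact isOpen_ne_fun (ρ.continuous.comp Units.continuous_val) continuous_const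
  have hmem : ∀ w : ℂˣ, lineOf w ∈ S → ρ w ≠ 0 := by
    rintro w ⟨w', hw', h⟩
    obtain ⟨r, hr, h⟩ := lineOf_eq_iff.1 h
    rw [h, hreal]
    exact mul_ne_zero hr hw'
  have hcont : ∀ x ∈ S, ContinuousAt (lineLift k hk) x := by
    rintro _ ⟨w, hw, rfl⟩
    rw [← isOpenQuotientMap_lineOf.continuousAt_comp_iff]
    change ContinuousAt (fun w : ℂˣ => l w / ρ w) w
    exact ((l.continuous.comp Units.continuous_val).continuousAt).div
      ((ρ.continuous.comp Units.continuous_val).continuousAt) hw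
  refine ⟨{p | p.1.2 ∈ S}, fun p => e.symm (ρ p.1.1, lineLift k hk p.1.2),
    { isOpen_source := hSo.preimage (continuous_snd.comp continuous_subtype_val)
      isOpen_target := isOpen_univ
      image := ?_
      left_inv := ?_
      continuousOn := ?_
      continuousOn_symm := ?_ }⟩
  · rw [Set.univ_inter]
    refine Set.eq_univ_of_forall fun a => ?_
    refine ⟨RealPlane.mk (e a).1 (v (e a).2), ⟨_, ?_, rfl⟩, ?_⟩
    · simp [hρ]
    · simp only [RealPlane.mk, hkl, k, hρ, hl, hreal]
      simp
  · intro p hp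
    obtain ⟨t, w, rfl⟩ := p.exists_mk
    have hw : ρ w ≠ 0 := hmem w hp
    simp only [Homeomorph.apply_symm_apply]
    rw [RealPlane.mk_eq_iff]
    refine ⟨ρ w, hw, ?_, ?_⟩
    · rw [hz]
      simp only [RealPlane.mk, hkl, k]
      field_simp
    · simp only [RealPlane.mk, hreal]
  · intro p hp
    refine ContinuousAt.continuousWithinAt ?_
    refine e.symm.continuous.continuousAt.comp (ContinuousAt.prodMk ?_ ?_)
    · exact (ρ.continuous.comp (continuous_fst.comp continuous_subtype_val)).continuousAt
    · exact ContinuousAt.comp (f := fun p : RealPlane => p.1.2) (hcont _ hp)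
        (continuous_snd.comp continuous_subtype_val).continuousAt
  · exact (RealPlane.continuous_mk.comp
      (((continuous_fst.comp e.continuous)).prodMk (hv.comp (continuous_snd.comp e.continuous)))).continuousOn

/-- The point `t w` of the line spanned by `w` in an arbitrary coordinate system `q` of the real
modification: its coordinates are `κ (t, w)`, for `w` in an open set `O`. -/
theorem realPlane_coord : ∀ q ∈ realPlane.params, ∃ (O : Set ℂ) (κ : ℝ × ℂ → ℝ × ℝ), IsOpen O ∧
    (∀ t, ∀ w ∈ O, ContDiffAt ℝ ω κ (t, w)) ∧
    (∀ t (w : ℂˣ), (w : ℂ) ∈ O → q (κ (t, w)) = RealPlane.mk t w) ∧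
    ∀ b t (w : ℂˣ), q b = RealPlane.mk t w → (w : ℂ) ∈ O ∧ κ (t, w) = b := by
  have hre : ∀ (t : ℝ) (w : ℂ), ContDiffAt ℝ ω (fun x : ℝ × ℂ => x.2.re) (t, w) := fun t w =>
    (Complex.reCLM.contDiff.comp contDiff_snd).contDiffAt
  have him : ∀ (t : ℝ) (w : ℂ), ContDiffAt ℝ ω (fun x : ℝ × ℂ => x.2.im) (t, w) := fun t w =>
    (Complex.imCLM.contDiff.comp contDiff_snd).contDiffAt
  intro q hq
  rcases hq with rfl | rfl
  · refine ⟨{w | w.re ≠ 0}, fun x => (x.1 * x.2.re, x.2.im / x.2.re),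
      isOpen_ne_fun Complex.continuous_re continuous_const, ?_, ?_, ?_⟩
    · intro t w hw
      exact (contDiffAt_fst.mul (hre t w)).prodMk ((him t w).div (hre t w) hw)
    · intro t w hw
      have hw' : (w : ℂ).re ≠ 0 := hw
      change RealPlane.mk _ _ = _
      rw [RealPlane.mk_eq_iff]
      refine ⟨(w : ℂ).re, hw', ?_, rfl⟩
      apply Complex.ext
      · simp [unitOf]
      · simp [unitOf]; field_simp
    · intro b t w h
      obtain ⟨r, hr, h1, h2⟩ := RealPlane.mk_eq_iff.1 h
      have h3 : (w : ℂ).re = r := by rw [h1]; simp [unitOf]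
      have h4 : (w : ℂ).im = r * b.2 := by rw [h1]; simp [unitOf]
      refine ⟨by simpa [h3] using hr, ?_⟩
      simp only [h3, h4, ← h2]
      rw [mul_div_cancel_left₀ _ hr]
  · refine ⟨{w | w.im ≠ 0}, fun x => (x.2.re / x.2.im, x.1 * x.2.im),
      isOpen_ne_fun Complex.continuous_im continuous_const, ?_, ?_, ?_⟩
    · intro t w hw
      exact ((hre t w).div (him t w) hw).prodMk (contDiffAt_fst.mul (him t w))
    · intro t w hw
      have hw' : (w : ℂ).im ≠ 0 := hw
      change RealPlane.mk _ _ = _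
      rw [RealPlane.mk_eq_iff]
      refine ⟨(w : ℂ).im, hw', ?_, rfl⟩
      apply Complex.ext
      · simp [unitOf]; field_simp
      · simp [unitOf]
    · intro b t w h
      obtain ⟨r, hr, h1, h2⟩ := RealPlane.mk_eq_iff.1 h
      have h3 : (w : ℂ).im = r := by rw [h1]; simp [unitOf]
      have h4 : (w : ℂ).re = r * b.1 := by rw [h1]; simp [unitOf]
      refine ⟨by simpa [h3] using hr, ?_⟩
      simp only [h3, h4, ← h2]
      rw [mul_div_cancel_left₀ _ hr]

theorem realPlane_param : ∀ p ∈ realPlane.params, ∃ (τ : ℝ × ℝ → ℝ) (w : ℝ × ℝ → ℂˣ),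
    ContDiff ℝ ω τ ∧ ContDiff ℝ ω (fun a => (w a : ℂ)) ∧ ∀ a, p a = RealPlane.mk (τ a) (w a) := by
  intro p hp
  have key : ∀ f g : ℝ × ℝ → ℝ, ContDiff ℝ ω f → ContDiff ℝ ω g →
      ContDiff ℝ ω fun a => (⟨f a, g a⟩ : ℂ) := fun f g hf hg =>
    Complex.equivRealProdCLM.symm.contDiff.comp (hf.prodMk hg)
  rcases hp with rfl | rfl
  · exact ⟨fun a => a.1, fun a => unitOf 1 a.2 (Or.inl one_ne_zero), contDiff_fst,
      key _ _ contDiff_const contDiff_snd, fun _ => rfl⟩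
  · exact ⟨fun a => a.2, fun a => unitOf a.1 1 (Or.inr one_ne_zero), contDiff_snd,
      key _ _ contDiff_fst contDiff_const, fun _ => rfl⟩

open Classical in
/-- Multiplication by a complex number on the real modification. -/
def realAct (c : ℂ) (p : RealPlane) : RealPlane :=
  if h : c = 0 then p else ⟨(c * p.1.1, lineOf (Units.mk0 c h) * p.1.2), by
    obtain ⟨t, w, rfl⟩ := p.exists_mk
    have := (RealPlane.mk t (Units.mk0 c h * w)).2
    convert! this using 2
    simp only [RealPlane.mk, Units.val_mul, Units.val_mk0]
    ring⟩

theorem realAct_val {c : ℂ} (hc : c ≠ 0) (p : RealPlane) :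
    (realAct c p).1 = (c * p.1.1, lineOf (Units.mk0 c hc) * p.1.2) :=
  congrArg Subtype.val (dif_neg hc)

theorem realAct_mk {c : ℂ} (hc : c ≠ 0) (t : ℝ) (w : ℂˣ) :
    realAct c (RealPlane.mk t w) = RealPlane.mk t (Units.mk0 c hc * w) := by
  refine Subtype.ext ((realAct_val hc _).trans (Prod.ext ?_ rfl))
  simp only [RealPlane.mk, Units.val_mul, Units.val_mk0]
  ring

theorem continuousOn_mk0 : ContinuousOn (fun c : ℂ => if h : c = 0 then (1 : ℂˣ) else Units.mk0 c h)
    {c | c ≠ 0} := by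
  rw [continuousOn_iff_continuous_domRestrict]
  have : Set.domRestrict {c : ℂ | c ≠ 0}
      (fun c : ℂ => if h : c = 0 then (1 : ℂˣ) else Units.mk0 c h) =
      fun c => unitsHomeomorphNeZero.symm ⟨c.1, c.2⟩ := by
    funext c
    refine (dif_neg c.2).trans ?_
    ext
    exact (congrArg Subtype.val (unitsHomeomorphNeZero.apply_symm_apply ⟨c.1, c.2⟩)).symm
  rw [this]
  fun_prop

/-- The structure of the real modification. -/
def realAnalytic : realPlane.IsAnalytic where
  act := realAct
  one := RealPlane.mk 1 1
  val_one := by simp [realPlane, RealPlane.mk]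
  val_act c hc p := by
    exact congrArg Prod.fst (realAct_val hc p)
  dir_act c hc p := by
    refine (congrArg Prod.snd (realAct_val hc p)).trans ?_
    simp only [realPlane, dif_neg hc]
    rfl
  dirOf_mul c d hc hd := by
    simp only [realPlane, dif_neg hc, dif_neg hd, dif_neg (mul_ne_zero hc hd), Units.mk0_mul]
    rfl
  dir_eq p hp := by
    obtain ⟨t, w, rfl⟩ := RealPlane.exists_mk p
    simp only [realPlane] at hp ⊢
    rw [dif_neg hp]
    simp only [RealPlane.mk] at hp ⊢
    rw [lineOf_eq_iff]
    exact ⟨t, by simpa using left_ne_zero_of_mul hp, rfl⟩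
  ext p q h1 h2 := Subtype.ext (Prod.ext h1 h2)
  continuous_val := continuous_fst.comp continuous_subtype_val
  continuousAt_act c p hc := by
    change ContinuousAt (fun x : ℂ × RealPlane => realAct x.1 x.2) (c, p)
    have hi : Topology.IsInducing (fun p : RealPlane => p.1) := ⟨rfl⟩
    refine hi.continuousAt_iff.2 ?_
    have hev : (fun x : ℂ × RealPlane => (x.1 * x.2.1.1,
        lineOf (if h : x.1 = 0 then (1 : ℂˣ) else Units.mk0 x.1 h) * x.2.1.2)) =ᶠ[𝓝 (c, p)]
        ((fun p : RealPlane => p.1) ∘ fun x : ℂ × RealPlane => realAct x.1 x.2) := by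
      have : ∀ᶠ x : ℂ × RealPlane in 𝓝 (c, p), x.1 ≠ 0 := continuousAt_fst.eventually_ne hc
      filter_upwards [this] with x hx
      simp only [Function.comp, realAct_val hx, dif_neg hx]
    refine ContinuousAt.congr ?_ hev
    have h1 : ContinuousAt (fun x : ℂ × RealPlane => x.2.1.1) (c, p) :=
      (continuous_fst.comp (continuous_subtype_val.comp continuous_snd)).continuousAt
    have h2 : ContinuousAt (fun x : ℂ × RealPlane => x.2.1.2) (c, p) :=
      (continuous_snd.comp (continuous_subtype_val.comp continuous_snd)).continuousAt
    have h3 : ContinuousAt (fun x : ℂ × RealPlane =>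
        lineOf (if h : x.1 = 0 then (1 : ℂˣ) else Units.mk0 x.1 h)) (c, p) := by
      refine isOpenQuotientMap_lineOf.continuous.continuousAt.comp ?_
      exact ContinuousAt.comp (f := Prod.fst) (x := (c, p))
        (continuousOn_mk0.continuousAt ((isOpen_ne_fun continuous_id continuous_const).mem_nhds hc)) continuousAt_fst
    exact (continuousAt_fst.mul h1).prodMk (h3.mul h2)
  dense := by
    intro p
    obtain ⟨t, w, rfl⟩ := RealPlane.exists_mk p
    have hd : t ∈ closure {r : ℝ | r ≠ 0} := (dense_compl_singleton (0 : ℝ)) t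
    have hc : Continuous fun r : ℝ => RealPlane.mk r w :=
      RealPlane.continuous_mk.comp (continuous_id.prodMk continuous_const)
    refine closure_mono ?_ (image_closure_subset_closure_image hc ⟨t, hd, rfl⟩)
    rintro _ ⟨r, hr, rfl⟩
    have hr' : r ≠ 0 := hr
    exact mul_ne_zero (by exact_mod_cast hr') w.ne_zero
  t2 := by
    have : T2Space RealProjLine := by
      rw [t2Space_iff_of_isOpenQuotientMap isOpenQuotientMap_lineOf]
      have : {q : ℂˣ × ℂˣ | lineOf q.1 = lineOf q.2} =
          {q : ℂˣ × ℂˣ | (((q.2 * q.1⁻¹ : ℂˣ) : ℂ)).im = 0} := by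
        ext ⟨w, w'⟩
        simp only [Set.mem_ofPred_eq, lineOf_eq_iff]
        constructor
        · rintro ⟨r, -, h⟩
          simp [h]
        · intro h
          have h1 : ((((w' * w⁻¹ : ℂˣ) : ℂ).re : ℝ) : ℂ) = ((w' * w⁻¹ : ℂˣ) : ℂ) :=
            Complex.ext (by simp) (by simpa using h.symm)
          refine ⟨((w' * w⁻¹ : ℂˣ) : ℂ).re, ?_, ?_⟩
          · intro h0
            rw [h0] at h1
            exact (w' * w⁻¹).ne_zero h1.symm
          · rw [h1, ← Units.val_mul, inv_mul_cancel_right]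
      rw [this]
      refine isClosed_eq (Complex.continuous_im.comp (Units.continuous_val.comp ?_)) continuous_const
      fun_prop
    exact inferInstanceAs (T2Space {p : ℂ × RealProjLine // _})
  secondCountable := inferInstanceAs (SecondCountableTopology {p : ℂ × RealProjLine // _})
  exists_param p := by
    obtain ⟨t, w, rfl⟩ := RealPlane.exists_mk p
    have hw : (w : ℂ).re ≠ 0 ∨ (w : ℂ).im ≠ 0 := by
      by_contra! h
      exact w.ne_zero (Complex.ext h.1 h.2)
    rcases hw with hw | hw
    · refine ⟨_, Or.inl rfl, (t * (w : ℂ).re, (w : ℂ).im / (w : ℂ).re), trivial, RealPlane.mk_eq_iff.2 ?_⟩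
      refine ⟨(w : ℂ).re, hw, ?_, rfl⟩
      apply Complex.ext
      · simp [unitOf]
      · simp [unitOf]; field_simp
    · refine ⟨_, Or.inr rfl, ((w : ℂ).re / (w : ℂ).im, t * (w : ℂ).im), trivial, RealPlane.mk_eq_iff.2 ?_⟩
      refine ⟨(w : ℂ).im, hw, ?_, rfl⟩
      apply Complex.ext
      · simp [unitOf]; field_simp
      · simp [unitOf]
  patch := by
    rintro p (rfl | rfl) a -
    · obtain ⟨U, u, h⟩ := isPatch_real Complex.reCLM Complex.imCLM (Homeomorph.refl _)
        (fun t => unitOf 1 t (Or.inl one_ne_zero)) (continuous_unitOf (by fun_prop) (by fun_prop) _)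
        (by simp [unitOf]) (by simp [unitOf]) (by
          intro z t
          rw [Complex.ext_iff]
          simp [unitOf, mul_comm])
      exact ⟨U, u, _, Set.mem_univ _, h⟩
    · obtain ⟨U, u, h⟩ := isPatch_real Complex.imCLM Complex.reCLM (Homeomorph.prodComm _ _)
        (fun t => unitOf t 1 (Or.inr one_ne_zero)) (continuous_unitOf (by fun_prop) (by fun_prop) _)
        (by simp [unitOf]) (by simp [unitOf]) (by
          intro z t
          rw [Complex.ext_iff]
          simp [unitOf, mul_comm])
      exact ⟨U, u, _, Set.mem_univ _, h⟩
  analytic_val p hp := by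
    obtain ⟨τ, w, hτ, hw, h⟩ := realPlane_param p hp
    refine ⟨fun a => τ a * w a, (Complex.ofRealCLM.contDiff.comp hτ).mul hw, fun a _ => ?_⟩
    rw [h]
    rfl
  analytic_act p hp q hq c hc a _ b _ hab := by
    obtain ⟨τ, w, hτ, hw, h⟩ := realPlane_param p hp
    obtain ⟨O, κ, hO, hκ, hκ1, hκ2⟩ := realPlane_coord q hq
    have h0 := hab
    rw [h, realAct_mk hc] at h0
    obtain ⟨hmem, hb⟩ := hκ2 b _ _ h0.symm
    have hcw : ContDiff ℝ ω fun x : ℂ × (ℝ × ℝ) => x.1 * (w x.2 : ℂ) :=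
      contDiff_fst.mul (hw.comp contDiff_snd)
    refine ⟨fun x => κ (τ x.2, x.1 * w x.2), ?_, hb, ?_⟩
    · exact ContDiffAt.comp (c, a) (g := κ) (hκ _ _ hmem)
        ((hτ.comp contDiff_snd).contDiffAt.prodMk hcw.contDiffAt)
    · have h1 : ∀ᶠ x : ℂ × (ℝ × ℝ) in 𝓝 (c, a), x.1 * (w x.2 : ℂ) ∈ O :=
        hcw.continuous.continuousAt.eventually (hO.mem_nhds hmem)
      have h2 : ∀ᶠ x : ℂ × (ℝ × ℝ) in 𝓝 (c, a), x.1 ≠ 0 := continuousAt_fst.eventually_ne hc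
      filter_upwards [h1, h2] with x hx hx' _
      refine ⟨trivial, ?_⟩
      rw [h, realAct_mk hx']
      exact (hκ1 (τ x.2) (Units.mk0 x.1 hx' * w x.2) hx).symm

/-- In coordinates the canonical map from the polar to the real modification is analytic. -/
theorem polarToReal_analytic {q : ℝ × ℝ → RealPlane} (hq : q ∈ realPlane.params) {a b : ℝ × ℝ}
    (ha : 0 ≤ a.1) (h : polarToReal (a.1.toNNReal, Circle.exp a.2) = q b) :
    ∃ ψ : ℝ × ℝ → ℝ × ℝ, ContDiffAt ℝ ω ψ a ∧ ψ a = b ∧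
      ∀ᶠ x in 𝓝 a, 0 ≤ x.1 → polarToReal (x.1.toNNReal, Circle.exp x.2) = q (ψ x) := by
  obtain ⟨O, κ, hO, hκ, hκ1, hκ2⟩ := realPlane_coord q hq
  have hexp : ContDiff ℝ ω fun x : ℝ × ℝ => Complex.exp (x.2 * Complex.I) :=
    ((Complex.ofRealCLM.contDiff.comp contDiff_snd).mul contDiff_const).cexp
  have hcoe : ∀ x : ℝ × ℝ, ((Circle.toUnits (Circle.exp x.2) : ℂˣ) : ℂ) =
      Complex.exp (x.2 * Complex.I) := fun x => by simp [Circle.coe_exp]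
  obtain ⟨hmem, hb⟩ := hκ2 b _ _ h.symm
  simp only [Real.coe_toNNReal _ ha] at hb
  rw [hcoe] at hmem hb
  refine ⟨fun x => κ (x.1, Complex.exp (x.2 * Complex.I)), ?_, hb, ?_⟩
  · exact ContDiffAt.comp a (g := κ) (hκ _ _ hmem) (contDiffAt_fst.prodMk hexp.contDiffAt)
  · filter_upwards [hexp.continuous.continuousAt.eventually (hO.mem_nhds hmem)] with x hx hx0
    rw [← hcoe] at hx ⊢
    rw [hκ1 _ _ hx, polarToReal]
    simp only [Real.coe_toNNReal _ hx0]

theorem val_polarToReal (p : ℝ≥0 × Circle) : realPlane.val (polarToReal p) = polarPlane.val p := by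
  simp [realPlane, polarPlane, polarToReal, RealPlane.mk]

/-! ### The gluing relation of the blowing up -/

theorem prod_zpow_eq_zpow_sum {ι : Type*} (S : Finset ι) {z : ℂ} {c : ι → ℤ}
    (h : z = 0 → ∀ i ∈ S, 0 ≤ c i) : ∏ i ∈ S, z ^ c i = z ^ ∑ i ∈ S, c i := by
  classical
  induction S using Finset.induction_on with
  | empty => simp
  | insert i S hi ih =>
    rw [Finset.prod_insert hi, Finset.sum_insert hi,
      ih fun hz j hj => h hz j (Finset.mem_insert_of_mem hj)]
    by_cases hz : z = 0
    · have h1 := h hz i (Finset.mem_insert_self _ _)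
      have h2 : 0 ≤ ∑ j ∈ S, c j :=
        Finset.sum_nonneg fun j hj => h hz j (Finset.mem_insert_of_mem hj)
      obtain ⟨a, ha⟩ := Int.eq_ofNat_of_zero_le h1
      obtain ⟨b, hb⟩ := Int.eq_ofNat_of_zero_le h2
      rw [ha, hb, ← Nat.cast_add, zpow_natCast, zpow_natCast, zpow_natCast, pow_add]
    · rw [zpow_add₀ hz]

theorem group_prod_zpow_eq_zpow_sum {G ι : Type*} [CommGroup G] (S : Finset ι) (g : G) (c : ι → ℤ) :
    ∏ i ∈ S, g ^ c i = g ^ ∑ i ∈ S, c i := by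
  classical
  induction S using Finset.induction_on with
  | empty => simp
  | insert i S hi ih => rw [Finset.prod_insert hi, Finset.sum_insert hi, ih, zpow_add]

namespace RegularFan

variable {n : ℕ} (F : RegularFan n)

theorem prod_transMat {G : Type*} [DivisionCommMonoid G] (s t : F.maxCones) (u : s.1 → G)
    (Q : t.1) : ∏ P, u P ^ F.transMat s t P Q =
      (∏ P : s.1, if P.1 ∈ t.1 then 1 else u P ^ F.transMat s t P Q) *
        (if h : Q.1 ∈ s.1 then u ⟨Q.1, h⟩ else 1) := by
  have h1 : ∀ P : s.1, u P ^ F.transMat s t P Q =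
      (if P.1 ∈ t.1 then 1 else u P ^ F.transMat s t P Q) * (if P.1 = Q.1 then u P else 1) := by
    intro P
    by_cases hP : P.1 ∈ t.1
    · rw [F.transMat_of_mem P hP]
      split_ifs <;> simp
    · have : P.1 ≠ Q.1 := fun h => hP (h ▸ Q.2)
      simp [hP, this]
  rw [Finset.prod_congr rfl fun P _ => h1 P, Finset.prod_mul_distrib]
  congr 1
  split_ifs with h
  · rw [Finset.prod_eq_single (⟨Q.1, h⟩ : s.1)]
    · simp
    · rintro P - hP
      rw [if_neg]
      intro h'
      exact hP (Subtype.ext h')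
    · simp
  · refine Finset.prod_eq_one fun P _ => if_neg ?_
    rintro h'
    exact h (h' ▸ P.2)

/-- The unit by which the coordinate of a common vertex is multiplied in a change of charts. -/
def scale (s t : F.maxCones) (u : s.1 → ℂ) (Q : t.1) : ℂ :=
  ∏ P : s.1, if P.1 ∈ t.1 then 1 else u P ^ F.transMat s t P Q

theorem scale_ne_zero {s t : F.maxCones} {u : s.1 → ℂ} (h : ∀ P : s.1, P.1 ∉ t.1 → u P ≠ 0)
    (Q : t.1) : F.scale s t u Q ≠ 0 := by
  refine Finset.prod_ne_zero_iff.2 fun P _ => ?_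
  split_ifs with hP
  · exact one_ne_zero
  · exact zpow_ne_zero _ (h P hP)

theorem prod_transMat_eq_zero_iff {s t : F.maxCones} {u : s.1 → ℂ}
    (h : ∀ P : s.1, P.1 ∉ t.1 → u P ≠ 0) (Q : t.1) :
    ∏ P, u P ^ F.transMat s t P Q = 0 ↔ ∃ hQ : Q.1 ∈ s.1, u ⟨Q.1, hQ⟩ = 0 := by
  rw [F.prod_transMat]
  change F.scale s t u Q * _ = 0 ↔ _
  rw [mul_eq_zero, or_iff_right (F.scale_ne_zero h Q)]
  split_ifs with hQ
  · exact ⟨fun h => ⟨hQ, h⟩, fun ⟨_, h⟩ => h⟩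
  · simp [hQ]

theorem prod_transMat_comp {s t r : F.maxCones} {u : s.1 → ℂ} {v : t.1 → ℂ}
    (hs : ∀ P : s.1, P.1 ∉ t.1 → u P ≠ 0) (hv : ∀ Q, v Q = ∏ P, u P ^ F.transMat s t P Q)
    (hr : ∀ Q : t.1, Q.1 ∉ r.1 → v Q ≠ 0) (R : r.1) :
    ∏ Q, v Q ^ F.transMat t r Q R = ∏ P, u P ^ F.transMat s r P R := by
  have h1 : ∀ Q, v Q ^ F.transMat t r Q R =
      ∏ P, u P ^ (F.transMat s t P Q * F.transMat t r Q R) := by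
    intro Q
    rw [hv, ← Finset.prod_zpow]
    exact Finset.prod_congr rfl fun P _ => (zpow_mul _ _ _).symm
  simp only [h1]
  rw [Finset.prod_comm]
  refine Finset.prod_congr rfl fun P _ => ?_
  rw [prod_zpow_eq_zpow_sum, F.transMat_mul]
  intro hP Q _
  have hPt : P.1 ∈ t.1 := by
    by_contra h
    exact hs P h hP
  have hPr : P.1 ∈ r.1 := by
    by_contra h
    refine hr ⟨P.1, hPt⟩ h ?_
    rw [hv, F.prod_transMat_eq_zero_iff hs]
    exact ⟨P.2, hP⟩
  rw [F.transMat_of_mem P hPt]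
  split_ifs with h
  · rw [one_mul]
    exact (F.transMat_nonneg_iff Q).2 (h ▸ hPr) R
  · simp

/-- The vertices whose coordinate vanishes. -/
def zeros {s : F.maxCones} (u : s.1 → ℂ) : Set (Fin n → ℕ) := {P | ∃ h : P ∈ s.1, u ⟨P, h⟩ = 0}

theorem toricRel_iff {s t : F.maxCones} {u : s.1 → ℂ} {v : t.1 → ℂ} :
    F.toricRel ⟨s, u⟩ ⟨t, v⟩ ↔ (∀ P : s.1, P.1 ∉ t.1 → u P ≠ 0) ∧
      ∀ Q, v Q = ∏ P, u P ^ F.transMat s t P Q := by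
  constructor
  · rintro ⟨a, ha, h1, h2⟩
    obtain rfl := F.eq_transMat ha
    exact ⟨(F.isDefinedAt_iff u).1 h1, h2⟩
  · rintro ⟨h1, h2⟩
    exact ⟨_, F.isTransition_transMat s t, (F.isDefinedAt_iff u).2 h1, h2⟩

theorem zeros_eq_of_toricRel {s t : F.maxCones} {u : s.1 → ℂ} {v : t.1 → ℂ}
    (h : F.toricRel ⟨s, u⟩ ⟨t, v⟩) : F.zeros u = F.zeros v := by
  obtain ⟨h1, h2⟩ := F.toricRel_iff.1 h
  ext P
  constructor
  · rintro ⟨hP, h0⟩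
    have hPt : P ∈ t.1 := by
      by_contra hPt
      exact h1 ⟨P, hP⟩ hPt h0
    exact ⟨hPt, by rw [h2, F.prod_transMat_eq_zero_iff h1]; exact ⟨hP, h0⟩⟩
  · rintro ⟨hP, h0⟩
    rw [h2, F.prod_transMat_eq_zero_iff h1] at h0
    exact h0

theorem ne_zero_of_zeros_subset {s t : F.maxCones} {u : s.1 → ℂ} (h : F.zeros u ⊆ t.1) :
    ∀ P : s.1, P.1 ∉ t.1 → u P ≠ 0 := fun P hP h0 => hP (h ⟨P.2, h0⟩)

theorem zeros_subset_of_ne_zero {s t : F.maxCones} {u : s.1 → ℂ}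
    (h : ∀ P : s.1, P.1 ∉ t.1 → u P ≠ 0) : F.zeros u ⊆ t.1 := by
  rintro P ⟨hP, h0⟩
  by_contra hPt
  exact h ⟨P, hP⟩ hPt h0

/-- The vertices whose divisor contains a point of the toric manifold. -/
def toricZeros : F.Toric → Set (Fin n → ℕ) :=
  Quot.lift (fun x => F.zeros x.2) fun x y h => by
    rcases x with ⟨s, u⟩
    rcases y with ⟨t, v⟩
    exact F.zeros_eq_of_toricRel h

theorem mem_divisor_iff (P : Fin n → ℕ) (x : F.Toric) : x ∈ F.divisor P ↔ P ∈ F.toricZeros x := by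
  constructor
  · rintro ⟨s, u, hP, rfl, h⟩
    exact ⟨hP, h⟩
  · obtain ⟨⟨s, u⟩, rfl⟩ := Quot.exists_rep x
    rintro ⟨hP, h⟩
    exact ⟨s, u, hP, rfl, h⟩

end RegularFan

namespace PlaneModification.IsAnalytic

variable {M : PlaneModification} (hM : M.IsAnalytic)
include hM

theorem dirOf_one : M.dirOf 1 = 1 := by
  have := hM.dirOf_mul 1 1 one_ne_zero one_ne_zero
  rw [mul_one] at this
  exact (mul_eq_left (a := M.dirOf 1)).1 this.symm

theorem dir_one : M.dir hM.one = 1 := by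
  rw [hM.dir_eq _ (by rw [hM.val_one]; exact one_ne_zero), hM.val_one, hM.dirOf_one]

/-- The direction as a homomorphism. -/
def dirHom : ℂˣ →* M.Dir where
  toFun c := M.dirOf c
  map_one' := hM.dirOf_one
  map_mul' c d := hM.dirOf_mul c d c.ne_zero d.ne_zero

theorem dirOf_zpow {c : ℂ} (hc : c ≠ 0) (k : ℤ) : M.dirOf (c ^ k) = M.dirOf c ^ k := by
  have := map_zpow hM.dirHom (Units.mk0 c hc) k
  simpa [dirHom] using this

theorem dirOf_prod {ι : Type*} (S : Finset ι) (c : ι → ℂ) (hc : ∀ i ∈ S, c i ≠ 0) :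
    M.dirOf (∏ i ∈ S, c i) = ∏ i ∈ S, M.dirOf (c i) := by
  classical
  induction S using Finset.induction_on with
  | empty => simp [hM.dirOf_one]
  | insert i S hi ih =>
    rw [Finset.prod_insert hi, Finset.prod_insert hi, hM.dirOf_mul, ih]
    · exact fun j hj => hc j (Finset.mem_insert_of_mem hj)
    · exact hc i (Finset.mem_insert_self _ _)
    · exact Finset.prod_ne_zero_iff.2 fun j hj => hc j (Finset.mem_insert_of_mem hj)

end PlaneModification.IsAnalytic

namespace BlowupChart

variable {n : ℕ} {M : PlaneModification} {s : Finset (Fin n → ℕ)}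

theorem coord_pos (x : BlowupChart M s) (P : PosIdx s) : x.coord P.1 = M.val (x.1 P) :=
  dif_pos P.2

theorem coord_nonpos (x : BlowupChart M s) (P : NonposIdx s) : x.coord P.1 = x.2 P :=
  dif_neg P.2

theorem dir_pos (x : BlowupChart M s) (P : PosIdx s) : x.dir P.1 = M.dir (x.1 P) :=
  dif_pos P.2

theorem dir_eq (hM : M.IsAnalytic) (x : BlowupChart M s) (P : s) (h : x.coord P ≠ 0) :
    x.dir P = M.dirOf (x.coord P) := by
  unfold coord at h ⊢
  unfold dir
  split_ifs with hP
  · rw [dif_pos hP] at h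
    exact hM.dir_eq _ h
  · rfl

theorem ext (hM : M.IsAnalytic) {x y : BlowupChart M s} (h1 : ∀ P, x.coord P = y.coord P)
    (h2 : ∀ P : s, StrictlyPos P.1 → x.dir P = y.dir P) : x = y := by
  refine Prod.ext (funext fun P => ?_) (funext fun P => ?_)
  · have h3 := h1 P.1
    have h4 := h2 P.1 P.2
    rw [coord_pos, coord_pos] at h3
    rw [dir_pos, dir_pos] at h4
    exact hM.ext _ _ h3 h4
  · have h3 := h1 P.1
    rwa [coord_nonpos, coord_nonpos] at h3

theorem continuous_coord (hM : M.IsAnalytic) (P : s) :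
    Continuous fun x : BlowupChart M s => x.coord P := by
  unfold coord
  split_ifs
  · exact hM.continuous_val.comp ((continuous_apply _).comp continuous_fst)
  · exact (continuous_apply _).comp continuous_snd

/-- The points with nonzero coordinates are dense. -/
theorem dense_torus (hM : M.IsAnalytic) : Dense {x : BlowupChart M s | ∀ P, x.coord P ≠ 0} := by
  have h1 : Dense (Set.pi Set.univ fun _ : PosIdx s => {p | M.val p ≠ 0}) :=
    dense_pi _ fun _ _ => hM.dense
  have h2 : Dense (Set.pi Set.univ fun _ : NonposIdx s => ({0}ᶜ : Set ℂ)) :=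
    dense_pi _ fun _ _ => dense_compl_singleton 0
  refine (h1.prod h2).mono ?_
  rintro ⟨x, z⟩ ⟨hx, hz⟩ P
  by_cases hP : StrictlyPos P.1
  · rw [coord_pos _ ⟨P, hP⟩]
    exact hx ⟨P, hP⟩ trivial
  · rw [coord_nonpos _ ⟨P, hP⟩]
    exact hz ⟨P, hP⟩ trivial

end BlowupChart

namespace RegularFan

variable {n : ℕ} (F : RegularFan n) {M : PlaneModification} (hM : M.IsAnalytic)

open Classical in
/-- The change of charts of the blowing up. -/
def trans (s t : F.maxCones) (x : BlowupChart M s.1) : BlowupChart M t.1 :=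
  (fun Q => hM.act (F.scale s t x.coord Q.1)
      (if h : Q.1.1 ∈ s.1 then x.1 ⟨⟨Q.1.1, h⟩, Q.2⟩ else hM.one),
    fun Q => F.scale s t x.coord Q.1 * (if h : Q.1.1 ∈ s.1 then x.2 ⟨⟨Q.1.1, h⟩, Q.2⟩ else 1))

theorem coord_trans {s t : F.maxCones} {x : BlowupChart M s.1}
    (h : ∀ P : s.1, P.1 ∉ t.1 → x.coord P ≠ 0) (Q : t.1) :
    (F.trans hM s t x).coord Q = ∏ P, x.coord P ^ F.transMat s t P Q := by
  rw [F.prod_transMat]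
  change _ = F.scale s t x.coord Q * _
  by_cases hQ : StrictlyPos Q.1
  · rw [BlowupChart.coord_pos _ ⟨Q, hQ⟩]
    simp only [trans]
    rw [hM.val_act _ (F.scale_ne_zero h Q)]
    congr 1
    split_ifs with hs
    · exact (BlowupChart.coord_pos x ⟨⟨Q.1, hs⟩, hQ⟩).symm
    · exact hM.val_one
  · rw [BlowupChart.coord_nonpos _ ⟨Q, hQ⟩]
    simp only [trans]
    congr 1
    split_ifs with hs
    · exact (BlowupChart.coord_nonpos x ⟨⟨Q.1, hs⟩, hQ⟩).symm
    · rfl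

include hM in
theorem dirOf_scale {s t : F.maxCones} {x : BlowupChart M s.1}
    (h : ∀ P : s.1, P.1 ∉ t.1 → x.coord P ≠ 0) (Q : t.1) :
    M.dirOf (F.scale s t x.coord Q) =
      ∏ P : s.1, if P.1 ∈ t.1 then 1 else x.dir P ^ F.transMat s t P Q := by
  unfold scale
  rw [hM.dirOf_prod]
  · refine Finset.prod_congr rfl fun P _ => ?_
    split_ifs with hP
    · exact hM.dirOf_one
    · rw [hM.dirOf_zpow (h P hP), x.dir_eq hM P (h P hP)]
  · intro P _
    split_ifs with hP
    · exact one_ne_zero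
    · exact zpow_ne_zero _ (h P hP)

theorem dir_trans {s t : F.maxCones} {x : BlowupChart M s.1}
    (h : ∀ P : s.1, P.1 ∉ t.1 → x.coord P ≠ 0) (Q : t.1)
    (hQ : StrictlyPos Q.1 ∨ (F.trans hM s t x).coord Q ≠ 0) :
    (F.trans hM s t x).dir Q = ∏ P, x.dir P ^ F.transMat s t P Q := by
  rw [F.prod_transMat, ← F.dirOf_scale hM h]
  by_cases hQ' : StrictlyPos Q.1
  · rw [BlowupChart.dir_pos _ ⟨Q, hQ'⟩]
    simp only [trans]
    rw [hM.dir_act _ (F.scale_ne_zero h Q)]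
    congr 1
    split_ifs with hs
    · exact (BlowupChart.dir_pos x ⟨⟨Q.1, hs⟩, hQ'⟩).symm
    · exact hM.dir_one
  · have h0 := hQ.resolve_left hQ'
    rw [BlowupChart.dir_eq hM _ _ h0]
    rw [F.coord_trans hM h, F.prod_transMat] at h0 ⊢
    change F.scale s t x.coord Q * _ ≠ 0 at h0
    change M.dirOf (F.scale s t x.coord Q * _) = _
    rw [hM.dirOf_mul _ _ (left_ne_zero_of_mul h0) (right_ne_zero_of_mul h0)]
    congr 1
    have h1 := right_ne_zero_of_mul h0
    split_ifs with hs
    · rw [dif_pos hs] at h1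
      exact (x.dir_eq hM _ h1).symm
    · exact hM.dirOf_one

theorem blowupRel_iff {s t : F.maxCones} {x : BlowupChart M s.1} {y : BlowupChart M t.1} :
    F.blowupRel M ⟨s, x⟩ ⟨t, y⟩ ↔ (∀ P : s.1, P.1 ∉ t.1 → x.coord P ≠ 0) ∧
      y = F.trans hM s t x := by
  constructor
  · rintro ⟨a, ha, h1, h2, h3⟩
    obtain rfl := F.eq_transMat ha
    have h := (F.isDefinedAt_iff _).1 h1
    refine ⟨h, BlowupChart.ext hM (fun Q => ?_) fun Q hQ => ?_⟩
    · rw [F.coord_trans hM h]; exact h2 Q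
    · rw [F.dir_trans hM h Q (Or.inl hQ)]; exact h3 Q hQ
  · rintro ⟨h, rfl⟩
    exact ⟨_, F.isTransition_transMat s t, (F.isDefinedAt_iff _).2 h, F.coord_trans hM h,
      fun Q hQ => F.dir_trans hM h Q (Or.inl hQ)⟩

theorem zeros_trans {s t : F.maxCones} {x : BlowupChart M s.1}
    (h : ∀ P : s.1, P.1 ∉ t.1 → x.coord P ≠ 0) :
    F.zeros (F.trans hM s t x).coord = F.zeros x.coord :=
  (F.zeros_eq_of_toricRel (F.toricRel_iff.2 ⟨h, F.coord_trans hM h⟩)).symm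

theorem trans_self (s : F.maxCones) (x : BlowupChart M s.1) : F.trans hM s s x = x := by
  have h : ∀ P : s.1, P.1 ∉ s.1 → x.coord P ≠ 0 := fun P hP => absurd P.2 hP
  refine BlowupChart.ext hM (fun Q => ?_) fun Q hQ => ?_
  · rw [F.coord_trans hM h, F.prod_transMat]
    simp
  · rw [F.dir_trans hM h Q (Or.inl hQ), F.prod_transMat]
    simp

theorem trans_trans {s t r : F.maxCones} {x : BlowupChart M s.1}
    (hs : ∀ P : s.1, P.1 ∉ t.1 → x.coord P ≠ 0)
    (hr : ∀ Q : t.1, Q.1 ∉ r.1 → (F.trans hM s t x).coord Q ≠ 0) :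
    (∀ P : s.1, P.1 ∉ r.1 → x.coord P ≠ 0) ∧
      F.trans hM t r (F.trans hM s t x) = F.trans hM s r x := by
  have h : ∀ P : s.1, P.1 ∉ r.1 → x.coord P ≠ 0 := by
    apply F.ne_zero_of_zeros_subset
    rw [← F.zeros_trans hM hs]
    exact F.zeros_subset_of_ne_zero hr
  refine ⟨h, BlowupChart.ext hM (fun R => ?_) fun R hR => ?_⟩
  · rw [F.coord_trans hM hr, F.coord_trans hM h]
    exact F.prod_transMat_comp hs (F.coord_trans hM hs) hr R
  · rw [F.dir_trans hM hr R (Or.inl hR), F.dir_trans hM h R (Or.inl hR)]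
    have h1 : ∀ Q, (F.trans hM s t x).dir Q ^ F.transMat t r Q R =
        ∏ P, x.dir P ^ (F.transMat s t P Q * F.transMat t r Q R) := by
      intro Q
      by_cases hQ : StrictlyPos Q.1 ∨ (F.trans hM s t x).coord Q ≠ 0
      · rw [F.dir_trans hM hs Q hQ, ← Finset.prod_zpow]
        exact Finset.prod_congr rfl fun P _ => (zpow_mul _ _ _).symm
      -- the direction of a vanishing coordinate transverse to no divisor does not matter
      · push Not at hQ
        have hQr : Q.1 ∈ r.1 := by
          by_contra h'
          exact hr Q h' hQ.2
        have : F.transMat t r Q R = 0 := by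
          rw [F.transMat_of_mem Q hQr, if_neg]
          rintro hQR
          obtain ⟨k, hk⟩ := not_forall.1 hQ.1
          exact absurd (hR k) (by rw [← hQR]; omega)
        simp [this]
    simp only [h1]
    rw [Finset.prod_comm]
    refine Finset.prod_congr rfl fun P _ => ?_
    rw [← F.transMat_mul s t r]
    exact group_prod_zpow_eq_zpow_sum _ _ _

theorem blowupMk_eq_iff {s t : F.maxCones} {x : BlowupChart M s.1} {y : BlowupChart M t.1} :
    F.blowupMk M s x = F.blowupMk M t y ↔ (∀ P : s.1, P.1 ∉ t.1 → x.coord P ≠ 0) ∧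
      y = F.trans hM s t x := by
  have heq : Equivalence (F.blowupRel M) := by
    refine ⟨?_, ?_, ?_⟩
    · rintro ⟨s, x⟩
      exact (F.blowupRel_iff hM).2 ⟨fun P hP => absurd P.2 hP, (F.trans_self hM s x).symm⟩
    · rintro ⟨s, x⟩ ⟨t, y⟩ h₀
      obtain ⟨h, rfl⟩ := (F.blowupRel_iff hM).1 h₀
      have hr : ∀ Q : t.1, Q.1 ∉ s.1 → (F.trans hM s t x).coord Q ≠ 0 := by
        apply F.ne_zero_of_zeros_subset
        rw [F.zeros_trans hM h]
        exact F.zeros_subset_of_ne_zero fun P hP => absurd P.2 hP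
      refine (F.blowupRel_iff hM).2 ⟨hr, ?_⟩
      rw [(F.trans_trans hM h hr).2, F.trans_self]
    · rintro ⟨s, x⟩ ⟨t, y⟩ ⟨r, z⟩ h₀ h₀'
      obtain ⟨h, rfl⟩ := (F.blowupRel_iff hM).1 h₀
      obtain ⟨h', rfl⟩ := (F.blowupRel_iff hM).1 h₀'
      have := F.trans_trans hM h h'
      exact (F.blowupRel_iff hM).2 ⟨this.1, this.2⟩
  rw [← F.blowupRel_iff hM]
  constructor
  · intro h
    exact (heq.eqvGen_iff).1 (Quot.eqvGen_exact h)
  · exact fun h => Quot.sound h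

theorem blowupMk_trans {s t : F.maxCones} {x : BlowupChart M s.1}
    (h : ∀ P : s.1, P.1 ∉ t.1 → x.coord P ≠ 0) :
    F.blowupMk M t (F.trans hM s t x) = F.blowupMk M s x :=
  ((F.blowupMk_eq_iff hM).2 ⟨h, rfl⟩).symm

theorem exists_blowupMk (y : F.Blowup M) : ∃ s x, F.blowupMk M s x = y := by
  obtain ⟨⟨s, x⟩, rfl⟩ := Quot.exists_rep y
  exact ⟨s, x, rfl⟩

theorem blowupMap_mk (s : F.maxCones) (x : BlowupChart M s.1) :
    F.blowupMap M (F.blowupMk M s x) = chartProj s.1 x.coord := rfl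

theorem mk_mem_blowupDivisor_iff (P : Fin n → ℕ) (s : F.maxCones) (x : BlowupChart M s.1) :
    F.blowupMk M s x ∈ F.blowupDivisor M P ↔ ∃ h : P ∈ s.1, x.coord ⟨P, h⟩ = 0 :=
  F.mem_divisor_iff P _

/-! ### The topology of the blowing up -/

theorem continuousAt_scale {s t : F.maxCones} {u : s.1 → ℂ}
    (h : ∀ P : s.1, P.1 ∉ t.1 → u P ≠ 0) (Q : t.1) :
    ContinuousAt (fun u => F.scale s t u Q) u := by
  unfold scale
  refine tendsto_finsetProd _ fun P _ => ?_
  split_ifs with hP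
  · exact tendsto_const_nhds
  · exact ((continuous_apply P).continuousAt (x := u)).zpow₀ _ (Or.inl (h P hP))

theorem continuousAt_trans {s t : F.maxCones} {x : BlowupChart M s.1}
    (h : ∀ P : s.1, P.1 ∉ t.1 → x.coord P ≠ 0) : ContinuousAt (F.trans hM s t) x := by
  have hsc : ∀ Q, ContinuousAt (fun x : BlowupChart M s.1 => F.scale s t x.coord Q) x := fun Q =>
    ContinuousAt.comp (g := fun u => F.scale s t u Q) (f := fun x : BlowupChart M s.1 => x.coord)
      (F.continuousAt_scale h Q)
      (continuous_pi fun P => BlowupChart.continuous_coord hM P).continuousAt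
  refine ContinuousAt.prodMk (continuousAt_pi.2 fun Q => ?_) (continuousAt_pi.2 fun Q => ?_)
  · split_ifs with hQ
    · exact ContinuousAt.comp (g := fun x : ℂ × M.Pt => hM.act x.1 x.2)
        (f := fun x : BlowupChart M s.1 => (F.scale s t x.coord Q.1, x.1 ⟨⟨Q.1.1, hQ⟩, Q.2⟩))
        (hM.continuousAt_act _ _ (F.scale_ne_zero h _))
        ((hsc Q.1).prodMk ((continuous_apply _).comp continuous_fst).continuousAt)
    · exact ContinuousAt.comp (g := fun x : ℂ × M.Pt => hM.act x.1 x.2)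
        (f := fun x : BlowupChart M s.1 => (F.scale s t x.coord Q.1, hM.one))
        (hM.continuousAt_act _ _ (F.scale_ne_zero h _)) ((hsc Q.1).prodMk continuousAt_const)
  · refine (hsc Q.1).mul ?_
    split_ifs with hQ
    · exact ((continuous_apply _).comp continuous_snd).continuousAt
    · exact continuousAt_const

include hM in
theorem isOpen_transDomain (s t : F.maxCones) :
    IsOpen {x : BlowupChart M s.1 | ∀ P : s.1, P.1 ∉ t.1 → x.coord P ≠ 0} := by
  have : {x : BlowupChart M s.1 | ∀ P : s.1, P.1 ∉ t.1 → x.coord P ≠ 0} =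
      ⋂ P : s.1, ⋂ _ : P.1 ∉ t.1, {x | x.coord P ≠ 0} := by
    ext; simp
  rw [this]
  exact isOpen_iInter_of_finite fun P => isOpen_iInter_of_finite fun _ =>
    isOpen_ne_fun (BlowupChart.continuous_coord hM P) continuous_const

theorem continuous_blowupMk (s : F.maxCones) : Continuous (F.blowupMk M s) :=
  continuous_quot_mk.comp continuous_sigmaMk

include hM in
theorem isOpenEmbedding_blowupMk (s : F.maxCones) :
    Topology.IsOpenEmbedding (F.blowupMk M s) := by
  refine .of_continuous_injective_isOpenMap (F.continuous_blowupMk s) ?_ ?_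
  · intro x y h
    have := ((F.blowupMk_eq_iff hM).1 h).2
    rw [this, F.trans_self]
  · intro V hV
    have hq : Topology.IsQuotientMap (Quot.mk (F.blowupRel M)) := isQuotientMap_quot_mk
    refine hq.isOpen_preimage.1 (isOpen_sigma_iff.2 ?_)
    intro t
    have : Sigma.mk t ⁻¹' (Quot.mk (F.blowupRel M) ⁻¹' (F.blowupMk M s '' V)) =
        {y : BlowupChart M t.1 | ∀ P : t.1, P.1 ∉ s.1 → y.coord P ≠ 0} ∩ F.trans hM t s ⁻¹' V := by
      ext y
      constructor
      · rintro ⟨x, hx, h⟩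
        obtain ⟨h1, rfl⟩ := (F.blowupMk_eq_iff hM).1 (h.symm : F.blowupMk M t y = _)
        exact ⟨h1, hx⟩
      · rintro ⟨h1, h2⟩
        exact ⟨_, h2, F.blowupMk_trans hM h1⟩
    refine (congrArg IsOpen this).mpr ?_
    exact ContinuousOn.isOpen_inter_preimage
      (fun y hy => (F.continuousAt_trans hM hy).continuousWithinAt) (F.isOpen_transDomain hM t s) hV

include hM in
theorem secondCountable_blowup : SecondCountableTopology (F.Blowup M) := by
  have h0 := hM.secondCountable
  have hcov : ⋃ s : F.maxCones, Set.range (F.blowupMk M s) = Set.univ := by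
    refine Set.eq_univ_of_forall fun y => ?_
    obtain ⟨s, x, rfl⟩ := F.exists_blowupMk y
    exact Set.mem_iUnion.2 ⟨s, x, rfl⟩
  have : ∀ s : F.maxCones, SecondCountableTopology (Set.range (F.blowupMk M s)) := fun s =>
    (F.isOpenEmbedding_blowupMk hM s).isEmbedding.toHomeomorph.symm.secondCountableTopology
  exact TopologicalSpace.secondCountableTopology_of_countable_cover
    (fun s => (F.isOpenEmbedding_blowupMk hM s).isOpen_range) hcov

/-- The points of the blowing up lying over the torus. -/
def torus (M : PlaneModification) : Set (F.Blowup M) :=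
  {y | F.toricZeros (F.blowupProj M y) = ∅}

theorem mk_mem_torus_iff {s : F.maxCones} {x : BlowupChart M s.1} :
    F.blowupMk M s x ∈ F.torus M ↔ ∀ P, x.coord P ≠ 0 := by
  change F.zeros x.coord = ∅ ↔ _
  rw [Set.eq_empty_iff_forall_notMem]
  constructor
  · exact fun h P hP => h P.1 ⟨P.2, hP⟩
  · rintro h P ⟨hP, h0⟩
    exact h _ h0

include hM in
theorem dense_blowup_torus : Dense (F.torus M) := by
  intro y
  obtain ⟨s, x, rfl⟩ := F.exists_blowupMk y
  have := image_closure_subset_closure_image (F.continuous_blowupMk s)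
    ⟨x, BlowupChart.dense_torus hM x, rfl⟩
  refine closure_mono ?_ this
  rintro _ ⟨x, hx, rfl⟩
  exact F.mk_mem_torus_iff.2 hx

/-- Coordinates of vertices that are not common to two cones are bounded away from zero on the
intersection of the corresponding charts, as long as all coordinates are bounded. -/
theorem exists_lower_bound (s t : F.maxCones) (R : ℝ) : ∃ c > 0,
    ∀ (u : s.1 → ℂ) (v : t.1 → ℂ), (∀ P, u P ≠ 0) → (∀ Q, v Q = ∏ P, u P ^ F.transMat s t P Q) →
      (∀ P, ‖u P‖ ≤ R) → (∀ Q, ‖v Q‖ ≤ R) → ∀ P : s.1, P.1 ∉ t.1 → c ≤ ‖u P‖ := by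
  obtain ⟨L, hL, hlip⟩ := F.exists_coef_lipschitz
  set D : Fin n → ℝ := fun k => ∑ P : s.1, (P.1 k : ℝ) - ∑ Q : t.1, (Q.1 k : ℝ) with hD
  refine ⟨Real.exp (Real.log R - L * ‖Real.log R • D‖), Real.exp_pos _, ?_⟩
  intro u v hu hv huR hvR P hP
  have hv0 : ∀ Q, v Q ≠ 0 := fun Q => by
    rw [hv]
    exact Finset.prod_ne_zero_iff.2 fun P _ => zpow_ne_zero _ (hu P)
  classical
  -- the vectors `∑ (log R - log |u_P|) P` and `∑ (log R - log |v_Q|) Q` lie in the two cones, and their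
  -- difference is the constant `log R • D`; by the Lipschitz property the coefficient of `P` in the
  -- first one is bounded, since it is `0` in the second one
  set α : (Fin n → ℕ) → ℝ := fun P => if h : P ∈ s.1 then Real.log R - Real.log ‖u ⟨P, h⟩‖ else 0
  set β : (Fin n → ℕ) → ℝ := fun P => if h : P ∈ t.1 then Real.log R - Real.log ‖v ⟨P, h⟩‖ else 0
  have hα : ∀ P : s.1, α P = Real.log R - Real.log ‖u P‖ := fun P => dif_pos P.2
  have hβ : ∀ P : t.1, β P = Real.log R - Real.log ‖v P‖ := fun P => dif_pos P.2
  set w : Fin n → ℝ := fun k => ∑ P ∈ s.1, α P * (P k : ℝ) with hw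
  set w' : Fin n → ℝ := fun k => ∑ P ∈ t.1, β P * (P k : ℝ) with hw'
  have hws : w ∈ cone s.1 := ⟨α, fun P hP => by
    rw [hα ⟨P, hP⟩, sub_nonneg]
    exact Real.log_le_log (norm_pos_iff.2 (hu _)) (huR _), fun k => rfl⟩
  have hwt : w' ∈ cone t.1 := ⟨β, fun P hP => by
    rw [hβ ⟨P, hP⟩, sub_nonneg]
    exact Real.log_le_log (norm_pos_iff.2 (hv0 _)) (hvR _), fun k => rfl⟩
  have hlog : ∀ Q, Real.log ‖v Q‖ = ∑ P, (F.transMat s t P Q : ℝ) * Real.log ‖u P‖ := by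
    intro Q
    rw [hv, norm_prod, Real.log_prod]
    · exact Finset.sum_congr rfl fun P _ => by rw [norm_zpow, Real.log_zpow]
    · intro P _
      rw [norm_zpow]
      exact zpow_ne_zero _ (norm_ne_zero_iff.2 (hu P))
  have hdiff : w - w' = Real.log R • D := by
    funext k
    have h1 : ∑ Q : t.1, Real.log ‖v Q‖ * (Q.1 k : ℝ) = ∑ P : s.1, Real.log ‖u P‖ * (P.1 k : ℝ) := by
      simp only [hlog, Finset.sum_mul]
      rw [Finset.sum_comm]
      refine Finset.sum_congr rfl fun P _ => ?_
      have := F.isTransition_transMat s t P k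
      have h2 : (P.1 k : ℝ) = ∑ Q : t.1, (F.transMat s t P Q : ℝ) * (Q.1 k : ℝ) := by
        exact_mod_cast this
      rw [h2, Finset.mul_sum]
      exact Finset.sum_congr rfl fun Q _ => by ring
    simp only [hw, hw', hD, Pi.sub_apply, Pi.smul_apply, smul_eq_mul]
    rw [← Finset.sum_coe_sort s.1, ← Finset.sum_coe_sort t.1]
    simp only [hα, hβ, sub_mul, Finset.sum_sub_distrib, h1, ← Finset.mul_sum]
    ring
  have h := hlip s t w w' hws hwt P.1
  rw [F.coef_of_sum s subset_rfl (c := α) (fun k => rfl), if_pos P.2,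
    F.coef_of_sum t subset_rfl (c := β) (fun k => rfl), if_neg hP, hα, hdiff, sub_zero] at h
  rw [← Real.le_log_iff_exp_le (norm_pos_iff.2 (hu P))]
  linarith

include hM in
theorem t2Space_blowup : T2Space (F.Blowup M) := by
  have := hM.t2
  rw [t2Space_iff_disjoint_nhds]
  intro p q hpq
  obtain ⟨s, x, rfl⟩ := F.exists_blowupMk p
  obtain ⟨t, y, rfl⟩ := F.exists_blowupMk q
  by_contra hdis
  apply hpq
  -- if the points are not separated, they are limits of common points of the torus
  set T : Set (BlowupChart M s.1 × BlowupChart M t.1) :=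
    {z | (∀ P, z.1.coord P ≠ 0) ∧ F.blowupMk M s z.1 = F.blowupMk M t z.2} with hT
  have hcl : (x, y) ∈ closure T := by
    rw [mem_closure_iff_nhds]
    intro N hN
    obtain ⟨U, hU, V, hV, hUV⟩ := mem_nhds_prod_iff.1 hN
    obtain ⟨U', hU', hU'o, hxU⟩ := mem_nhds_iff.1 hU
    obtain ⟨V', hV', hV'o, hyV⟩ := mem_nhds_iff.1 hV
    have hO1 := (F.isOpenEmbedding_blowupMk hM s).isOpenMap _ hU'o
    have hO2 := (F.isOpenEmbedding_blowupMk hM t).isOpenMap _ hV'o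
    have hne : (F.blowupMk M s '' U' ∩ F.blowupMk M t '' V').Nonempty := by
      rw [← Set.not_disjoint_iff_nonempty_inter]
      intro hd
      exact hdis (Filter.disjoint_iff.2 ⟨_, hO1.mem_nhds ⟨x, hxU, rfl⟩, _,
        hO2.mem_nhds ⟨y, hyV, rfl⟩, hd⟩)
    obtain ⟨z, ⟨⟨x', hx', h1⟩, y', hy', h2⟩, hz⟩ :=
      (F.dense_blowup_torus hM).inter_open_nonempty _ (hO1.inter hO2) hne
    refine ⟨(x', y'), hUV ⟨hU' hx', hV' hy'⟩, ?_, h1.trans h2.symm⟩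
    rw [← h1] at hz
    exact F.mk_mem_torus_iff.1 hz
  obtain ⟨R, hR⟩ : ∃ R : ℝ, (∀ P, ‖x.coord P‖ < R) ∧ ∀ Q, ‖y.coord Q‖ < R := by
    refine ⟨∑ P, ‖x.coord P‖ + ∑ Q, ‖y.coord Q‖ + 1, fun P => ?_, fun Q => ?_⟩
    · have := Finset.single_le_sum (f := fun P => ‖x.coord P‖) (fun _ _ => norm_nonneg _)
        (Finset.mem_univ P)
      have h2 : 0 ≤ ∑ Q, ‖y.coord Q‖ := by positivity
      linarith
    · have := Finset.single_le_sum (f := fun P => ‖y.coord P‖) (fun _ _ => norm_nonneg _)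
        (Finset.mem_univ Q)
      have h2 : 0 ≤ ∑ Q, ‖x.coord Q‖ := by positivity
      linarith
  obtain ⟨c, hc, hbound⟩ := F.exists_lower_bound s t R
  have hev : ∀ᶠ z : BlowupChart M s.1 × BlowupChart M t.1 in 𝓝 (x, y),
      (∀ P, ‖z.1.coord P‖ < R) ∧ ∀ Q, ‖z.2.coord Q‖ < R := by
    refine (Filter.eventually_all.2 fun P => ?_).and (Filter.eventually_all.2 fun Q => ?_)
    · exact (((BlowupChart.continuous_coord hM P).comp continuous_fst).norm.continuousAt).eventually_lt
        continuousAt_const (hR.1 P)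
    · exact (((BlowupChart.continuous_coord hM Q).comp continuous_snd).norm.continuousAt).eventually_lt
        continuousAt_const (hR.2 Q)
  -- by the lower bound the change of charts is defined at the limit `x`
  have hxne : ∀ P : s.1, P.1 ∉ t.1 → x.coord P ≠ 0 := by
    intro P hP
    have : c ≤ ‖x.coord P‖ := by
      refine ge_of_tendsto_of_frequently (f := fun z : BlowupChart M s.1 × BlowupChart M t.1 =>
        ‖z.1.coord P‖) (x := 𝓝 (x, y)) ?_ ?_
      · exact ((BlowupChart.continuous_coord hM P).comp continuous_fst).norm.continuousAt
      · refine ((mem_closure_iff_frequently.1 hcl).and_eventually hev).mono ?_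
        rintro ⟨x', y'⟩ ⟨⟨h1, h2⟩, h3, h4⟩
        obtain ⟨h5, h6⟩ := (F.blowupMk_eq_iff hM).1 h2
        simp only at h6
        subst h6
        exact hbound _ _ h1 (F.coord_trans hM h5) (fun P => (h3 P).le) (fun Q => (h4 Q).le) P hP
    intro h0
    rw [h0, norm_zero] at this
    linarith
  refine (F.blowupMk_eq_iff hM).2 ⟨hxne, ?_⟩
  have : (𝓝 (x, y) ⊓ Filter.principal T).NeBot := mem_closure_iff_clusterPt.1 hcl
  have h1 : Filter.Tendsto (fun z : BlowupChart M s.1 × BlowupChart M t.1 => z.2)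
      (𝓝 (x, y) ⊓ Filter.principal T) (𝓝 y) :=
    (continuous_snd.continuousAt (x := (x, y))).tendsto.mono_left inf_le_left
  have h2 : Filter.Tendsto (fun z : BlowupChart M s.1 × BlowupChart M t.1 => F.trans hM s t z.1)
      (𝓝 (x, y) ⊓ Filter.principal T) (𝓝 (F.trans hM s t x)) :=
    (ContinuousAt.comp (f := Prod.fst) (x := (x, y)) (F.continuousAt_trans hM hxne)
      continuousAt_fst).tendsto.mono_left inf_le_left
  refine tendsto_nhds_unique_of_eventuallyEq h1 h2 ?_
  refine Filter.eventually_inf_principal.2 (Filter.Eventually.of_forall ?_)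
  rintro ⟨x', y'⟩ ⟨-, h⟩
  exact ((F.blowupMk_eq_iff hM).1 h).2

end RegularFan

/-! ### Manifolds defined by analytic parametrizations -/

/-- The maps `g i`, defined on the regions `C i` of normed spaces, are local homeomorphisms onto
open subsets that cover `Y`, and are related to one another by analytic maps. -/
structure IsParamSystem {ι : Type*} {V : ι → Type*} [∀ i, NormedAddCommGroup (V i)]
    [∀ i, NormedSpace ℝ (V i)] {Y : Type*} [TopologicalSpace Y] (C : ∀ i, Set (V i))
    (g : ∀ i, V i → Y) : Prop where
  cover : ∀ y, ∃ i, ∃ a ∈ C i, g i a = y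
  patch : ∀ i, ∀ a ∈ C i, ∃ U u W, a ∈ W ∧ IsPatch (C i) U u (g i) W
  compat : ∀ i j, ∀ a ∈ C i, ∀ b ∈ C j, g i a = g j b → ∃ ψ : V i → V j, ContDiffAt ℝ ω ψ a ∧
    ψ a = b ∧ ∀ᶠ x in 𝓝 a, x ∈ C i → ψ x ∈ C j ∧ g j (ψ x) = g i x

/-- A patch together with an affine map which identifies it with an open part of the model with
corners `I`. -/
structure ModelPatch {E H V Y : Type*} [NormedAddCommGroup E] [NormedSpace ℝ E]
    [TopologicalSpace H] (I : ModelWithCorners ℝ E H) [NormedAddCommGroup V] [NormedSpace ℝ V]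
    [TopologicalSpace Y] (C : Set V) (g : V → Y) where
  /-- the source -/
  U : Set Y
  /-- the coordinates -/
  u : Y → V
  /-- an open set that cuts the image of the coordinates out of `C` -/
  W : Set V
  isPatch : IsPatch C U u g W
  /-- the linear part of the affine map -/
  L : V ≃L[ℝ] E
  /-- the translation part of the affine map -/
  c : E
  mem_iff : ∀ v ∈ W, v ∈ C ↔ L v + c ∈ Set.range I

namespace ModelPatch

variable {E H V Y : Type*} [NormedAddCommGroup E] [NormedSpace ℝ E]
    [TopologicalSpace H] {I : ModelWithCorners ℝ E H} [NormedAddCommGroup V] [NormedSpace ℝ V]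
    [TopologicalSpace Y] {C : Set V} {g : V → Y} (p : ModelPatch I C g)

theorem mem_of_mem {h : H} (hh : p.L.symm (I h - p.c) ∈ p.W) : p.L.symm (I h - p.c) ∈ p.W ∩ C :=
  ⟨hh, (p.mem_iff _ hh).2 (by simp)⟩

theorem model_apply {y : Y} (hy : y ∈ p.U) : I (I.symm (p.L (p.u y) + p.c)) = p.L (p.u y) + p.c := by
  have := p.isPatch.mapsTo hy
  exact I.right_inv ((p.mem_iff _ this.1).1 this.2)

/-- The chart given by a patch. -/
def chart : OpenPartialHomeomorph Y H where
  toFun y := I.symm (p.L (p.u y) + p.c)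
  invFun h := g (p.L.symm (I h - p.c))
  source := p.U
  target := {h | p.L.symm (I h - p.c) ∈ p.W}
  map_source' y hy := by
    have := p.isPatch.mapsTo hy
    simp only [Set.mem_ofPred_eq, p.model_apply hy, add_sub_cancel_right,
      ContinuousLinearEquiv.symm_apply_apply]
    exact this.1
  map_target' h hh := p.isPatch.symm_mapsTo (p.mem_of_mem hh)
  left_inv' y hy := by
    simp only [p.model_apply hy, add_sub_cancel_right, ContinuousLinearEquiv.symm_apply_apply]
    exact p.isPatch.left_inv y hy
  right_inv' h hh := by
    rw [p.isPatch.right_inv (p.mem_of_mem hh)]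
    simp
  open_source := p.isPatch.isOpen_source
  open_target := p.isPatch.isOpen_target.preimage
    (p.L.symm.continuous.comp (I.continuous.sub continuous_const))
  continuousOn_toFun := I.continuous_symm.comp_continuousOn
    ((p.L.continuous.comp_continuousOn p.isPatch.continuousOn).add continuousOn_const)
  continuousOn_invFun := p.isPatch.continuousOn_symm.comp
    (p.L.symm.continuous.comp (I.continuous.sub continuous_const)).continuousOn
    fun _ hh => p.mem_of_mem hh

theorem extend_apply {y : Y} (hy : y ∈ p.U) : p.chart.extend I y = p.L (p.u y) + p.c :=
  p.model_apply hy

theorem extend_symm_apply {e : E} (he : e ∈ Set.range I) :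
    (p.chart.extend I).symm e = g (p.L.symm (e - p.c)) := by
  change g (p.L.symm (I (I.symm e) - p.c)) = _
  rw [I.right_inv he]

end ModelPatch

namespace IsParamSystem

variable {ι : Type*} {V : ι → Type*} [∀ i, NormedAddCommGroup (V i)]
  [∀ i, NormedSpace ℝ (V i)] {Y : Type*} [TopologicalSpace Y] {C : ∀ i, Set (V i)}
  {g : ∀ i, V i → Y}

theorem transition (hp : IsParamSystem C g) {i j : ι} {U : Set Y} {u : Y → V i} {W : Set (V i)}
    (h : IsPatch (C i) U u (g i) W) {U' : Set Y} {u' : Y → V j} {W' : Set (V j)}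
    (h' : IsPatch (C j) U' u' (g j) W') {y : Y} (hy : y ∈ U) (hy' : y ∈ U') :
    ContDiffWithinAt ℝ ω (u' ∘ g i) (C i) (u y) := by
  have h1 := h.mapsTo hy
  have h2 := h'.mapsTo hy'
  obtain ⟨ψ, hψ, hψ1, hψ2⟩ := hp.compat i j (u y) h1.2 (u' y) h2.2
    (by rw [h.left_inv y hy, h'.left_inv y hy'])
  refine hψ.contDiffWithinAt.congr_of_eventuallyEq ?_ ?_
  · have h3 : ∀ᶠ x in 𝓝[C i] (u y), ψ x ∈ W' :=
      (hψ.continuousAt.eventually (h'.isOpen_target.mem_nhds (by rw [hψ1]; exact h2.1))).filter_mono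
        nhdsWithin_le_nhds
    filter_upwards [h3, hψ2.filter_mono nhdsWithin_le_nhds, self_mem_nhdsWithin] with x hx hx1 hx2
    obtain ⟨h4, h5⟩ := hx1 hx2
    rw [Function.comp, ← h5, h'.right_inv ⟨hx, h4⟩]
  · rw [Function.comp, h.left_inv y hy, hψ1]

variable {E H : Type*} [NormedAddCommGroup E] [NormedSpace ℝ E]
  [TopologicalSpace H] {I : ModelWithCorners ℝ E H}

theorem model_transition (hp : IsParamSystem C g) {i j : ι} (p : ModelPatch I (C i) (g i))
    {U' : Set Y} {u' : Y → V j} {W' : Set (V j)} (h' : IsPatch (C j) U' u' (g j) W') {y : Y}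
    (hy : y ∈ p.U) (hy' : y ∈ U') :
    ContDiffWithinAt ℝ ω (u' ∘ (p.chart.extend I).symm) (Set.range I) (p.chart.extend I y) := by
  have h1 := hp.transition p.isPatch h' hy hy'
  have hA : ContDiff ℝ ω fun e => p.L.symm (e - p.c) :=
    p.L.symm.contDiff.comp (contDiff_id.sub contDiff_const)
  have h2 : p.L.symm (p.chart.extend I y - p.c) = p.u y := by
    rw [p.extend_apply hy]; simp
  rw [← h2] at h1
  have hW : {e | p.L.symm (e - p.c) ∈ p.W} ∈ 𝓝 (p.chart.extend I y) := by
    refine hA.continuous.continuousAt.eventually_mem ?_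
    rw [h2]
    exact p.isPatch.isOpen_target.mem_nhds (p.isPatch.mapsTo hy).1
  have h3 := ContDiffWithinAt.comp (s := Set.range I ∩ {e | p.L.symm (e - p.c) ∈ p.W})
    (p.chart.extend I y) h1 hA.contDiffAt.contDiffWithinAt
    (by
      rintro e ⟨he, he'⟩
      exact (p.mem_iff _ he').2 (by simpa using he))
  have h4 := (contDiffWithinAt_inter hW).1 h3
  refine h4.congr (fun e he => ?_) ?_
  · simp only [Function.comp, p.extend_symm_apply he]
  · rw [Function.comp, p.extend_symm_apply]
    · rfl
    · rw [p.extend_apply hy]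
      have := p.isPatch.mapsTo hy
      exact (p.mem_iff _ this.1).1 this.2

/-- A space with a system of analytic parametrizations by regions which look locally like the model
with corners `I` is an analytic manifold, and the inverses of the parametrizations are analytic
coordinate systems. The preferred charts can be chosen among given affine images of inverses of
parametrizations; the property `B` keeps track of the choice. -/
theorem exists_chartedSpace (hp : IsParamSystem C g) (B : ∀ i, V i → E → Prop)
    (hmodel : ∀ i, ∀ a ∈ C i, ∃ (L : V i ≃L[ℝ] E) (c : E) (W : Set (V i)), IsOpen W ∧ a ∈ W ∧
      (∀ v ∈ W, v ∈ C i ↔ L v + c ∈ Set.range I) ∧ B i a (L a + c)) :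
    ∃ _ : ChartedSpace H Y, IsManifold I ω Y ∧
      (∀ i, ∀ a ∈ C i, ∃ (U : Set Y) (u : Y → V i), g i a ∈ U ∧ u (g i a) = a ∧
        IsLocalCoord I (C i) U u (g i)) ∧
      ∀ y, ∃ i, ∃ a ∈ C i, g i a = y ∧ B i a (extChartAt I y y) := by
  have hex : ∀ y, ∃ (i : ι) (p : ModelPatch I (C i) (g i)) (a : V i), a ∈ C i ∧ g i a = y ∧ y ∈ p.U ∧
      B i a (p.L (p.u y) + p.c) := by
    intro y
    obtain ⟨i, a, ha, rfl⟩ := hp.cover y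
    obtain ⟨U, u, W, haW, h⟩ := hp.patch i a ha
    obtain ⟨L, c, W', hW', haW', hL, hB⟩ := hmodel i a ha
    have hua : u (g i a) = a := h.right_inv ⟨haW, ha⟩
    refine ⟨i, ⟨_, u, _, h.restrict hW', L, c, fun v hv => hL v hv.2⟩, a, ha, rfl,
      ⟨h.symm_mapsTo ⟨haW, ha⟩, ?_⟩, ?_⟩
    · rw [Set.mem_preimage, hua]; exact haW'
    · simp only [hua]; exact hB
  choose i p a ha hga hy hB using hex
  let cs : ChartedSpace H Y :=
    { atlas := Set.range fun y => (p y).chart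
      chartAt := fun y => (p y).chart
      mem_chart_source := hy
      chart_mem_atlas := fun y => ⟨y, rfl⟩ }
  have hext : ∀ y, extChartAt I y = (p y).chart.extend I := fun y => rfl
  refine ⟨cs, ?_, ?_, ?_⟩
  · refine isManifold_of_contDiffOn I ω Y ?_
    rintro _ _ ⟨y, rfl⟩ ⟨y', rfl⟩ e ⟨he, he'⟩
    obtain ⟨h, rfl⟩ := he'
    simp only [Set.mem_preimage, I.left_inv] at he
    rw [OpenPartialHomeomorph.trans_source] at he
    set x := (p y).chart.symm h with hx
    have hxU : x ∈ (p y).U := (p y).chart.map_target he.1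
    have hxU' : x ∈ (p y').U := he.2
    have hIh : (p y).chart.extend I x = I h := by
      change I ((p y).chart ((p y).chart.symm h)) = I h
      rw [(p y).chart.right_inv he.1]
    have h1 := hp.model_transition (p y) (p y').isPatch hxU hxU'
    rw [hIh] at h1
    have h2 : ContDiffWithinAt ℝ ω (fun e => (p y').L ((p y').u (((p y).chart.extend I).symm e)) +
        (p y').c) (Set.range I) (I h) :=
      ((p y').L.contDiff.contDiffAt.comp_contDiffWithinAt _ h1).add contDiffWithinAt_const
    refine (h2.mono Set.inter_subset_right).congr_of_mem ?_ ⟨by simpa using he, ⟨h, rfl⟩⟩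
    rintro _ ⟨hz, z, rfl⟩
    simp only [Set.mem_preimage, I.left_inv] at hz
    rw [OpenPartialHomeomorph.trans_source] at hz
    change I ((p y').chart ((p y).chart.symm (I.symm (I z)))) =
      (p y').L ((p y').u ((p y).chart.symm (I.symm (I z)))) + (p y').c
    rw [I.left_inv]
    exact (p y').model_apply hz.2
  · intro j b hb
    obtain ⟨U, u, W, hbW, h⟩ := hp.patch j b hb
    refine ⟨U, u, h.symm_mapsTo ⟨hbW, hb⟩, h.right_inv ⟨hbW, hb⟩,
      { isOpen := h.isOpen_source
        analytic := ?_
        image := ⟨W, h.isOpen_target, h.image⟩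
        left_inv := h.left_inv
        analytic_symm := ?_ }⟩
    · intro y hyU
      refine ContMDiffAt.contMDiffWithinAt ?_
      rw [contMDiffAt_iff]
      refine ⟨h.continuousOn.continuousAt (h.isOpen_source.mem_nhds hyU), ?_⟩
      have := hp.model_transition (p y) h (hy y) hyU
      exact this
    · intro v hv
      obtain ⟨y, hyU, rfl⟩ := hv
      rw [contMDiffWithinAt_iff]
      have hcont : ContinuousWithinAt (g j) (u '' U) (u y) := by
        rw [h.image]
        exact h.continuousOn_symm _ (h.mapsTo hyU)
      refine ⟨hcont, ?_⟩
      rw [h.left_inv y hyU]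
      have h1 := hp.transition h (p y).isPatch hyU (hy y)
      have h2 : ContDiffWithinAt ℝ ω (fun v => (p y).L ((p y).u (g j v)) + (p y).c) (u '' U)
          (u y) := by
        refine ((p y).L.contDiff.contDiffAt.comp_contDiffWithinAt _
          (h1.mono ?_)).add contDiffWithinAt_const
        rw [h.image]
        exact Set.inter_subset_right
      have h3 : ContDiffWithinAt ℝ ω (extChartAt I y ∘ g j) (u '' U) (u y) := by
        refine h2.congr_of_eventuallyEq ?_ ?_
        · have : ∀ᶠ v in 𝓝[u '' U] (u y), g j v ∈ (p y).U := by
            refine hcont.eventually ?_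
            rw [h.left_inv y hyU]
            exact (p y).isPatch.isOpen_source.mem_nhds (hy y)
          filter_upwards [this] with v hv
          exact (p y).extend_apply hv
        · rw [Function.comp, h.left_inv y hyU]
          exact (p y).extend_apply (hy y)
      exact h3.mono fun v hv => hv.1
  · intro y
    refine ⟨i y, a y, ha y, hga y, ?_⟩
    rw [hext, (p y).extend_apply (hy y)]
    exact hB y

end IsParamSystem

/-! ### The analytic structure of the blowing up -/

theorem IsPatch.pushforward {V Y Z : Type*} [TopologicalSpace V] [TopologicalSpace Y]
    [TopologicalSpace Z] [Nonempty Y] {C : Set V} {U : Set Y} {u : Y → V} {g : V → Y} {W : Set V}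
    (h : IsPatch C U u g W) {e : Y → Z} (he : Topology.IsOpenEmbedding e) :
    ∃ U' u', IsPatch C U' u' (e ∘ g) W := by
  set e' := he.toOpenPartialHomeomorph e
  have hinv : ∀ y, e'.symm (e y) = y := fun y => e'.left_inv (by simp [e'])
  refine ⟨e '' U, u ∘ e'.symm,
    { isOpen_source := he.isOpenMap _ h.isOpen_source
      isOpen_target := h.isOpen_target
      image := ?_
      left_inv := ?_
      continuousOn := ?_
      continuousOn_symm := he.continuous.comp_continuousOn h.continuousOn_symm }⟩
  · rw [Set.image_image]
    simp only [Function.comp, hinv]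
    exact h.image
  · rintro _ ⟨y, hy, rfl⟩
    simp only [Function.comp, hinv, h.left_inv y hy]
  · refine h.continuousOn.comp (e'.continuousOn_symm.mono ?_) ?_
    · rintro _ ⟨y, -, rfl⟩
      simp [e']
    · rintro _ ⟨y, hy, rfl⟩
      rwa [hinv]

/-- The space of real coordinates of the chart of a cone. -/
abbrev ParamSpace {n : ℕ} (s : Finset (Fin n → ℕ)) : Type := (PosIdx s → ℝ × ℝ) × (NonposIdx s → ℂ)

namespace RegularFan

variable {n : ℕ} (F : RegularFan n) {M : PlaneModification} (hM : M.IsAnalytic)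

/-- The parametrization of a chart of the blowing up before the gluing. -/
def chartParam {s : Finset (Fin n → ℕ)} (p : PosIdx s → ℝ × ℝ → M.Pt) (b : ParamSpace s) :
    BlowupChart M s := (fun P => p P (b.1 P), b.2)

include hM in
theorem exists_coordFun {s : Finset (Fin n → ℕ)} (p : PosIdx s → ℝ × ℝ → M.Pt)
    (hp : ∀ P, p P ∈ M.params) : ∃ G : ParamSpace s → s → ℂ, ContDiff ℝ ω G ∧
      ∀ b ∈ coordRegion M s, G b = (chartParam p b).coord := by
  choose K hK hK' using fun P : PosIdx s => hM.analytic_val (p P) (hp P)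
  refine ⟨fun b P => if h : StrictlyPos P.1 then K ⟨P, h⟩ (b.1 ⟨P, h⟩) else b.2 ⟨P, h⟩, ?_, ?_⟩
  · refine contDiff_pi.2 fun P => ?_
    split_ifs with h
    · exact (hK ⟨P, h⟩).comp ((contDiff_apply ℝ (ℝ × ℝ) _).comp contDiff_fst)
    · exact (contDiff_apply ℝ ℂ _).comp contDiff_snd
  · intro b hb
    funext P
    by_cases h : StrictlyPos P.1
    · rw [BlowupChart.coord_pos _ ⟨P, h⟩]
      exact (dif_pos h).trans (hK' _ _ (hb _)).symm
    · rw [BlowupChart.coord_nonpos _ ⟨P, h⟩]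
      exact dif_neg h

theorem _root_.ContDiffAt.zpow_complex {X : Type*} [NormedAddCommGroup X] [NormedSpace ℝ X]
    {f : X → ℂ} {x : X} (hf : ContDiffAt ℝ ω f x) (h : f x ≠ 0) (k : ℤ) :
    ContDiffAt ℝ ω (fun y => f y ^ k) x := by
  obtain ⟨m, rfl | rfl⟩ := k.eq_nat_or_neg
  · simpa using hf.pow m
  · simp only [zpow_neg, zpow_natCast]
    exact (contDiffAt_inv ℝ (pow_ne_zero m h)).comp x (hf.pow m)

theorem contDiffAt_scale {X : Type*} [NormedAddCommGroup X] [NormedSpace ℝ X] {s t : F.maxCones}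
    {G : X → s.1 → ℂ} {x : X} (hG : ContDiffAt ℝ ω G x)
    (h : ∀ P : s.1, P.1 ∉ t.1 → G x P ≠ 0) (Q : t.1) :
    ContDiffAt ℝ ω (fun y => F.scale s t (G y) Q) x := by
  unfold scale
  refine contDiffAt_prod fun P _ => ?_
  split_ifs with hP
  · exact contDiffAt_const
  · exact (contDiffAt_pi.1 hG P).zpow_complex (h P hP) _

include hM in
theorem isPatch_chartParam {s : Finset (Fin n → ℕ)} (p : PosIdx s → ℝ × ℝ → M.Pt)
    (hp : ∀ P, p P ∈ M.params) (a : ParamSpace s) (ha : a ∈ coordRegion M s) :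
    ∃ U u W, a ∈ W ∧ IsPatch (coordRegion M s) U u (chartParam p) W := by
  choose U u W haW h using fun P : PosIdx s => hM.patch (p P) (hp P) (a.1 P) (ha P)
  refine ⟨{x | ∀ P, x.1 P ∈ U P}, fun x => (fun P => u P (x.1 P), x.2), {b | ∀ P, b.1 P ∈ W P},
    haW,
    { isOpen_source := ?_
      isOpen_target := ?_
      image := ?_
      left_inv := fun x hx => Prod.ext (funext fun P => (h P).left_inv _ (hx P)) rfl
      continuousOn := ?_
      continuousOn_symm := ?_ }⟩
  · simp only [Set.ofPred_forall]
    exact isOpen_iInter_of_finite fun P =>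
      (h P).isOpen_source.preimage ((continuous_apply P).comp continuous_fst)
  · simp only [Set.ofPred_forall]
    exact isOpen_iInter_of_finite fun P =>
      (h P).isOpen_target.preimage ((continuous_apply P).comp continuous_fst)
  · ext b
    constructor
    · rintro ⟨x, hx, rfl⟩
      exact ⟨fun P => ((h P).mapsTo (hx P)).1, fun P => ((h P).mapsTo (hx P)).2⟩
    · rintro ⟨h1, h2⟩
      exact ⟨chartParam p b, fun P => (h P).symm_mapsTo ⟨h1 P, h2 P⟩,
        Prod.ext (funext fun P => (h P).right_inv ⟨h1 P, h2 P⟩) rfl⟩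
  · refine ContinuousOn.prodMk (continuousOn_pi.2 fun P => ?_) continuous_snd.continuousOn
    exact (h P).continuousOn.comp ((continuous_apply P).comp continuous_fst).continuousOn
      fun x hx => hx P
  · refine ContinuousOn.prodMk (continuousOn_pi.2 fun P => ?_) continuous_snd.continuousOn
    exact (h P).continuousOn_symm.comp ((continuous_apply P).comp continuous_fst).continuousOn
      fun x hx => ⟨hx.1 P, hx.2 P⟩

include hM in
theorem chartParam_compat {s t : F.maxCones} {p : PosIdx s.1 → ℝ × ℝ → M.Pt}
    (hp : ∀ P, p P ∈ M.params) {q : PosIdx t.1 → ℝ × ℝ → M.Pt} (hq : ∀ P, q P ∈ M.params)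
    {a : ParamSpace s.1} (ha : a ∈ coordRegion M s.1) {b : ParamSpace t.1}
    (hb : b ∈ coordRegion M t.1) (hab : F.blowupParam M s p a = F.blowupParam M t q b) :
    ∃ ψ : ParamSpace s.1 → ParamSpace t.1, ContDiffAt ℝ ω ψ a ∧ ψ a = b ∧ ∀ᶠ x in 𝓝 a,
      x ∈ coordRegion M s.1 → ψ x ∈ coordRegion M t.1 ∧
        F.blowupParam M t q (ψ x) = F.blowupParam M s p x := by
  obtain ⟨G, hG, hG'⟩ := exists_coordFun hM p hp
  obtain ⟨hne, heq⟩ := (F.blowupMk_eq_iff hM).1 hab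
  have hne' : ∀ P : s.1, P.1 ∉ t.1 → G a P ≠ 0 := by rw [hG' a ha]; exact hne
  have hsc : ∀ Q, ContDiffAt ℝ ω (fun x => F.scale s t (G x) Q) a := fun Q =>
    F.contDiffAt_scale hG.contDiffAt hne' Q
  obtain ⟨p₁, hp₁, a₁, ha₁, hone⟩ := hM.exists_param hM.one
  -- the point whose multiple is the `Q`-coordinate, in coordinates
  have hbase : ∀ Q : PosIdx t.1, ∃ p' ∈ M.params, ∃ α : ParamSpace s.1 → ℝ × ℝ, ContDiff ℝ ω α ∧
      ∀ x ∈ coordRegion M s.1, α x ∈ M.region ∧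
        (if h : Q.1.1 ∈ s.1 then (chartParam p x).1 ⟨⟨Q.1.1, h⟩, Q.2⟩ else hM.one) = p' (α x) := by
    intro Q
    by_cases h : Q.1.1 ∈ s.1
    · refine ⟨p ⟨⟨Q.1.1, h⟩, Q.2⟩, hp _, fun x => x.1 ⟨⟨Q.1.1, h⟩, Q.2⟩,
        (contDiff_apply ℝ (ℝ × ℝ) _).comp contDiff_fst, fun x hx => ⟨hx _, ?_⟩⟩
      rw [dif_pos h]
      rfl
    · exact ⟨p₁, hp₁, fun _ => a₁, contDiff_const, fun x _ => ⟨ha₁, by rw [dif_neg h, hone]⟩⟩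
  choose p' hp' α hα hα' using hbase
  have hact : ∀ Q : PosIdx t.1, ∃ ψ : ℂ × (ℝ × ℝ) → ℝ × ℝ,
      ContDiffAt ℝ ω ψ (F.scale s t (G a) Q.1, α Q a) ∧ ψ (F.scale s t (G a) Q.1, α Q a) = b.1 Q ∧
      ∀ᶠ x in 𝓝 (F.scale s t (G a) Q.1, α Q a), x.2 ∈ M.region →
        ψ x ∈ M.region ∧ hM.act x.1 (p' Q x.2) = q Q (ψ x) := by
    intro Q
    refine hM.analytic_act (p' Q) (hp' Q) (q Q) (hq Q) _ (F.scale_ne_zero hne' _) _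
      (hα' Q a ha).1 _ (hb Q) ?_
    rw [← (hα' Q a ha).2, hG' a ha]
    exact (congrFun (congrArg Prod.fst heq) Q).symm
  choose ψ hψ hψ1 hψ2 using hact
  refine ⟨fun x => (fun Q => ψ Q (F.scale s t (G x) Q.1, α Q x), fun Q => F.scale s t (G x) Q.1 *
    (if h : Q.1.1 ∈ s.1 then x.2 ⟨⟨Q.1.1, h⟩, Q.2⟩ else 1)), ?_, ?_, ?_⟩
  · refine ContDiffAt.prodMk (contDiffAt_pi.2 fun Q => ?_) (contDiffAt_pi.2 fun Q => ?_)
    · exact ContDiffAt.comp a (hψ Q) ((hsc Q.1).prodMk (hα Q).contDiffAt)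
    · refine (hsc Q.1).mul ?_
      split_ifs
      · exact ((contDiff_apply ℝ ℂ _).comp contDiff_snd).contDiffAt
      · exact contDiffAt_const
  · refine Prod.ext (funext fun Q => hψ1 Q) (funext fun Q => ?_)
    have := congrFun (congrArg Prod.snd heq) Q
    have hGa := hG' a ha
    simp only [chartParam] at hGa
    simp only [trans, ← hGa] at this
    exact this.symm
  · have h1 : ∀ Q, ∀ᶠ x in 𝓝 a, α Q x ∈ M.region →
        ψ Q (F.scale s t (G x) Q.1, α Q x) ∈ M.region ∧
        hM.act (F.scale s t (G x) Q.1) (p' Q (α Q x)) =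
          q Q (ψ Q (F.scale s t (G x) Q.1, α Q x)) := fun Q =>
      ((hsc Q.1).prodMk (hα Q).contDiffAt).continuousAt.eventually (hψ2 Q)
    have h2 : ∀ᶠ x in 𝓝 a, ∀ P : s.1, P.1 ∉ t.1 → G x P ≠ 0 := by
      refine Filter.eventually_all.2 fun P => ?_
      by_cases hP : P.1 ∈ t.1
      · exact Filter.Eventually.of_forall fun _ h => absurd hP h
      · exact ((((continuous_apply P).comp hG.continuous).continuousAt (x := a)).eventually_ne
          (hne' P hP)).mono fun _ h _ => h
    filter_upwards [Filter.eventually_all.2 h1, h2] with x hx1 hx2 hx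
    refine ⟨fun Q => (hx1 Q (hα' Q x hx).1).1, ?_⟩
    rw [hG' x hx] at hx2
    have := F.blowupMk_trans hM (t := t) hx2
    refine Eq.trans ?_ this
    refine congrArg (F.blowupMk M t) (Prod.ext (funext fun Q => ?_) (funext fun Q => ?_))
    · simp only [trans]
      rw [(hα' Q x hx).2, ← hG' x hx]
      exact ((hx1 Q (hα' Q x hx).1).2).symm
    · simp only [trans, ← hG' x hx]
      rfl

/-- The parametrizations of the blowing up. -/
abbrev ParamIdx (M : PlaneModification) : Type :=
  Σ s : F.maxCones, {p : PosIdx s.1 → ℝ × ℝ → M.Pt // ∀ P, p P ∈ M.params}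

include hM in
theorem isParamSystem : IsParamSystem (ι := F.ParamIdx M) (V := fun i => ParamSpace i.1.1)
    (fun i => coordRegion M i.1.1) (fun i => F.blowupParam M i.1 i.2.1) where
  cover y := by
    obtain ⟨s, x, rfl⟩ := F.exists_blowupMk y
    choose p hp a ha h using fun P => hM.exists_param (x.1 P)
    refine ⟨⟨s, p, hp⟩, (a, x.2), ha, ?_⟩
    exact congrArg (F.blowupMk M s) (Prod.ext (funext h) rfl)
  patch i a ha := by
    obtain ⟨U, u, W, haW, h⟩ := isPatch_chartParam hM i.2.1 i.2.2 a ha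
    have : Nonempty (BlowupChart M i.1.1) := ⟨(fun _ => hM.one, 0)⟩
    obtain ⟨U', u', h'⟩ := h.pushforward (F.isOpenEmbedding_blowupMk hM i.1)
    exact ⟨U', u', W, haW, h'⟩
  compat i j a ha b hb hab := F.chartParam_compat hM i.2.2 j.2.2 ha hb hab

/-- The index set of the real coordinates of the chart of a cone. -/
abbrev CoordIdx (s : Finset (Fin n → ℕ)) : Type := (PosIdx s × Fin 2) ⊕ (NonposIdx s × Fin 2)

/-- The real coordinates of the chart of a cone: `(r, θ)` for a strictly positive vertex, and the
real and imaginary parts for the other ones. -/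
def realCoord (s : Finset (Fin n → ℕ)) : ParamSpace s ≃L[ℝ] (CoordIdx s → ℝ) :=
  LinearEquiv.toContinuousLinearEquiv
    { toFun := fun b => Sum.elim (fun i => if i.2 = 0 then (b.1 i.1).1 else (b.1 i.1).2)
        (fun i => if i.2 = 0 then (b.2 i.1).re else (b.2 i.1).im)
      invFun := fun v => (fun P => (v (Sum.inl (P, 0)), v (Sum.inl (P, 1))),
        fun P => ⟨v (Sum.inr (P, 0)), v (Sum.inr (P, 1))⟩)
      map_add' := by
        intro b b'
        funext i
        rcases i with ⟨P, k⟩ | ⟨P, k⟩ <;> fin_cases k <;> simp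
      map_smul' := by
        intro c b
        funext i
        rcases i with ⟨P, k⟩ | ⟨P, k⟩ <;> fin_cases k <;> simp
      left_inv := fun b => by simp
      right_inv := fun v => by
        funext i
        rcases i with ⟨P, k⟩ | ⟨P, k⟩ <;> fin_cases k <;> simp }

theorem realCoord_radius {s : Finset (Fin n → ℕ)} (b : ParamSpace s) (P : PosIdx s) :
    realCoord s b (Sum.inl (P, 0)) = (b.1 P).1 := rfl

theorem card_coordIdx (s : F.maxCones) : Fintype.card (CoordIdx s.1) = 2 * n := by
  have h : Fintype.card (PosIdx s.1) + Fintype.card (NonposIdx s.1) = n := by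
    rw [← Fintype.card_sum, Fintype.card_congr (Equiv.sumCompl fun P : s.1 => StrictlyPos P.1),
      Fintype.card_coe, F.card_eq s]
  rw [Fintype.card_sum, Fintype.card_prod, Fintype.card_prod, Fintype.card_fin]
  omega

/-- A numbering of the real coordinates. -/
def coordNum (s : F.maxCones) : CoordIdx s.1 ≃ Fin (2 * n) :=
  Fintype.equivFinOfCardEq (F.card_coordIdx s)

theorem exists_real_structure :
    ∃ _ : ChartedSpace (EuclideanSpace ℝ (Fin (2 * n))) F.RealBlowup,
      IsManifold 𝓘(ℝ, EuclideanSpace ℝ (Fin (2 * n))) ω F.RealBlowup ∧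
      F.IsBlowupStructure realPlane 𝓘(ℝ, EuclideanSpace ℝ (Fin (2 * n))) := by
  obtain ⟨cs, h1, h2, -⟩ := (F.isParamSystem realAnalytic).exists_chartedSpace
    (I := 𝓘(ℝ, EuclideanSpace ℝ (Fin (2 * n)))) (fun _ _ _ => True) (by
      intro i a _
      have hfin : Module.finrank ℝ (ParamSpace i.1.1) =
          Module.finrank ℝ (EuclideanSpace ℝ (Fin (2 * n))) := by
        rw [(realCoord i.1.1).toLinearEquiv.finrank_eq, Module.finrank_pi, F.card_coordIdx]
        simp
      refine ⟨ContinuousLinearEquiv.ofFinrankEq hfin, 0, Set.univ, isOpen_univ, trivial, ?_, trivial⟩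
      intro v _
      simp [coordRegion, realPlane])
  refine ⟨cs, h1, ?_⟩
  intro s p hp b hb
  obtain ⟨U, u, h⟩ := h2 ⟨s, p, hp⟩ b hb
  exact ⟨U, u, h⟩

/-- The polar coordinates `(r, θ) ↦ (r, exp (i θ))`, the only coordinate system of the polar
modification. -/
def polarParam : ℝ × ℝ → polarPlane.Pt := fun a => (a.1.toNNReal, Circle.exp a.2)

theorem exists_polar_structure :
    ∃ _ : ChartedSpace (EuclideanQuadrant (2 * n)) F.PolarBlowup,
      IsManifold (cornerModel n) ω F.PolarBlowup ∧
      F.IsBlowupStructure polarPlane (cornerModel n) ∧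
      ∀ y : F.PolarBlowup, ∃ (s : F.maxCones) (a : ParamSpace s.1), (∀ P, 0 ≤ (a.1 P).1) ∧
        F.blowupParam polarPlane s (fun _ => polarParam) a = y ∧
        (y ∈ (cornerModel n).boundary F.PolarBlowup ↔ ∃ P, (a.1 P).1 = 0) := by
  have hrange : Set.range (cornerModel n) = {y | ∀ i, 0 ≤ y i} := range_euclideanQuadrant (2 * n)
  have hfront : ∀ e : EuclideanSpace ℝ (Fin (2 * n)), (∀ i, 0 ≤ e i) →
      (e ∈ frontier (Set.range (cornerModel n)) ↔ ∃ i, e i = 0) := by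
    intro e he
    have hcl : IsClosed (Set.range (cornerModel n)) := (cornerModel n).isClosed_range
    rw [hcl.frontier_eq, hrange, interior_euclideanQuadrant]
    simp only [Set.mem_sdiff, Set.mem_ofPred_eq, not_forall, not_lt]
    constructor
    · rintro ⟨_, i, hi⟩
      exact ⟨i, le_antisymm hi (he i)⟩
    · rintro ⟨i, hi⟩
      exact ⟨he, i, hi.le⟩
  obtain ⟨cs, h1, h2, h3⟩ := (F.isParamSystem polarAnalytic).exists_chartedSpace
    (I := cornerModel n) (fun i a e => e ∈ frontier (Set.range (cornerModel n)) ↔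
      ∃ P, (a.1 P).1 = 0) (by
      intro i a ha
      set L : ParamSpace i.1.1 ≃L[ℝ] EuclideanSpace ℝ (Fin (2 * n)) :=
        ((realCoord i.1.1).trans (ContinuousLinearEquiv.piCongrLeft ℝ (fun _ => ℝ)
          (F.coordNum i.1))).trans (EuclideanSpace.equiv (Fin (2 * n)) ℝ).symm with hL
      have hLv : ∀ v k, L v (F.coordNum i.1 k) = realCoord i.1.1 v k := by
        intro v k
        change (Equiv.piCongrLeft (fun _ => ℝ) (F.coordNum i.1)) (realCoord i.1.1 v)
          (F.coordNum i.1 k) = _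
        rw [Equiv.piCongrLeft_apply_apply]
      classical
      -- the radial coordinates are kept, the others are translated into the interior
      set c : EuclideanSpace ℝ (Fin (2 * n)) := WithLp.toLp 2 fun j =>
        if ∃ P, (F.coordNum i.1).symm j = Sum.inl (P, 0) then 0 else 1 - L a j with hc
      have hc1 : ∀ v P, (L v + c) (F.coordNum i.1 (Sum.inl (P, 0))) = (v.1 P).1 := by
        intro v P
        have h : ∃ P', (F.coordNum i.1).symm (F.coordNum i.1 (Sum.inl (P, 0))) = Sum.inl (P', 0) :=
          ⟨P, Equiv.symm_apply_apply _ _⟩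
        rw [PiLp.add_apply, hLv, realCoord_radius]
        simp only [hc, if_pos h, add_zero]
      have hc2 : ∀ j, (¬ ∃ P, (F.coordNum i.1).symm j = Sum.inl (P, 0)) → (L a + c) j = 1 := by
        intro j hj
        rw [PiLp.add_apply]
        simp only [hc, if_neg hj]
        ring
      have hcases : ∀ j, (∃ P, j = F.coordNum i.1 (Sum.inl (P, 0))) ∨
          ¬ ∃ P, (F.coordNum i.1).symm j = Sum.inl (P, 0) := by
        intro j
        by_cases h : ∃ P, (F.coordNum i.1).symm j = Sum.inl (P, 0)
        · obtain ⟨P, hP⟩ := h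
          exact Or.inl ⟨P, by rw [← hP, Equiv.apply_symm_apply]⟩
        · exact Or.inr h
      refine ⟨L, c, {v | ∀ j, (¬ ∃ P, (F.coordNum i.1).symm j = Sum.inl (P, 0)) → 0 < (L v + c) j},
        ?_, ?_, ?_, ?_⟩
      · simp only [Set.ofPred_forall]
        refine isOpen_iInter_of_finite fun j => isOpen_iInter_of_finite fun _ =>
          isOpen_lt continuous_const ?_
        exact (PiLp.continuous_apply 2 _ j).comp (L.continuous.add continuous_const)
      · intro j hj
        rw [hc2 j hj]
        exact one_pos
      · intro v hv
        rw [hrange]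
        constructor
        · intro h j
          rcases hcases j with ⟨P, rfl⟩ | hj
          · rw [hc1]; exact h P
          · exact (hv j hj).le
        · intro h P
          have := h (F.coordNum i.1 (Sum.inl (P, 0)))
          rwa [hc1] at this
      · have hpos : ∀ j, 0 ≤ (L a + c) j := by
          intro j
          rcases hcases j with ⟨P, rfl⟩ | hj
          · rw [hc1]; exact ha P
          · rw [hc2 j hj]; exact zero_le_one
        rw [hfront _ hpos]
        constructor
        · rintro ⟨j, hj⟩
          rcases hcases j with ⟨P, rfl⟩ | hj'
          · exact ⟨P, by rw [← hc1]; exact hj⟩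
          · rw [hc2 j hj'] at hj
            exact absurd hj one_ne_zero
        · rintro ⟨P, hP⟩
          exact ⟨_, (hc1 a P).trans hP⟩)
  refine ⟨cs, h1, ?_, ?_⟩
  · intro s p hp b hb
    obtain ⟨U, u, h⟩ := h2 ⟨s, p, hp⟩ b hb
    exact ⟨U, u, h⟩
  · intro y
    obtain ⟨⟨s, p, hp⟩, a, ha, hy, h⟩ := h3 y
    have hpp : p = fun _ => polarParam := funext fun P => hp P
    subst hpp
    exact ⟨s, a, ha, hy, h⟩

end RegularFan

/-! ### Weights, faces and convenience -/

/-- The radial degree of the monomial with exponents `e` for the weight `P`. -/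
def wdeg {n : ℕ} (P : Fin n → ℕ) (e : (Fin n → ℕ) × (Fin n → ℕ)) : ℕ := ∑ j, P j * (e.1 j + e.2 j)

namespace MixedFunction

variable {n : ℕ} (f : MixedFunction n)

/-- The set of exponents of the monomials of `f`. -/
def exps : Set ((Fin n → ℕ) × (Fin n → ℕ)) := {e | f.coeff e.1 e.2 ≠ 0}

theorem minDegree_le {P : Fin n → ℕ} {e : (Fin n → ℕ) × (Fin n → ℕ)} (he : e ∈ f.exps) :
    f.minDegree P ≤ wdeg P e := Nat.sInf_le ⟨e.1, e.2, he, rfl⟩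

theorem exists_minDegree (hne : f.exps.Nonempty) (P : Fin n → ℕ) :
    ∃ e ∈ f.exps, wdeg P e = f.minDegree P := by
  obtain ⟨e, he⟩ := hne
  have : {d | ∃ ν μ : Fin n → ℕ, f.coeff ν μ ≠ 0 ∧ d = ∑ j, P j * (ν j + μ j)}.Nonempty :=
    ⟨_, e.1, e.2, he, rfl⟩
  obtain ⟨ν, μ, h, h'⟩ := Nat.sInf_mem this
  exact ⟨(ν, μ), h, h'.symm⟩

theorem mem_face_iff {Q : Fin n → ℝ} (hQ : ∀ j, 0 ≤ Q j) {e : (Fin n → ℕ) × (Fin n → ℕ)}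
    (he : e ∈ f.exps) : (fun j => ((e.1 j + e.2 j : ℕ) : ℝ)) ∈ f.face Q ↔
      ∀ e' ∈ f.exps, ∑ j, Q j * ((e.1 j + e.2 j : ℕ) : ℝ) ≤ ∑ j, Q j * ((e'.1 j + e'.2 j : ℕ) : ℝ) := by
  have hmem : ∀ e' ∈ f.exps, (fun j => ((e'.1 j + e'.2 j : ℕ) : ℝ)) ∈ f.newtonPolygon :=
    fun e' he' => subset_convexHull ℝ _ ⟨e'.1, e'.2, he', fun j => le_rfl⟩
  constructor
  · rintro ⟨-, h⟩ e' he'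
    exact h _ (hmem e' he')
  · intro h
    refine ⟨hmem e he, fun y hy => ?_⟩
    have hconv : Convex ℝ {y : Fin n → ℝ |
        ∑ j, Q j * ((e.1 j + e.2 j : ℕ) : ℝ) ≤ ∑ j, Q j * y j} := by
      refine convex_halfSpace_ge (f := fun y : Fin n → ℝ => ∑ j, Q j * y j) ⟨fun x y => ?_, fun c x => ?_⟩ _
      · simp only [Pi.add_apply, mul_add, Finset.sum_add_distrib]
      · simp only [Pi.smul_apply, smul_eq_mul, Finset.mul_sum]
        exact Finset.sum_congr rfl fun j _ => by ring
    refine convexHull_min ?_ hconv hy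
    rintro x ⟨ν, μ, hc, hx⟩
    exact (h (ν, μ) hc).trans
      (Finset.sum_le_sum fun j _ => mul_le_mul_of_nonneg_left (hx j) (hQ j))

theorem wdeg_sum (K : Finset (Fin n → ℕ)) (e : (Fin n → ℕ) × (Fin n → ℕ)) :
    wdeg (∑ P ∈ K, P) e = ∑ P ∈ K, wdeg P e := by
  simp only [wdeg, Finset.sum_apply, Finset.sum_mul]
  exact Finset.sum_comm

/-- For an admissible fan the minimal degrees for the vertices of a cone are attained
simultaneously. -/
theorem exists_common_minDegree {F : RegularFan n} (hadm : F.IsAdmissible f)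
    (hne : f.exps.Nonempty) (s : F.maxCones) {K : Finset (Fin n → ℕ)} (hK : K ⊆ s.1) :
    ∃ e ∈ f.exps, ∀ P ∈ K, wdeg P e = f.minDegree P := by
  classical
  obtain ⟨e, he, hmin⟩ := f.exists_minDegree hne (∑ P ∈ K, P)
  refine ⟨e, he, fun P₀ hP₀ => le_antisymm ?_ (f.minDegree_le he)⟩
  obtain ⟨e', he', hmin'⟩ := f.exists_minDegree hne P₀
  rw [← hmin']
  have hcast : ∀ (Q : Fin n → ℕ) (e : (Fin n → ℕ) × (Fin n → ℕ)),
      ∑ j, (Q j : ℝ) * ((e.1 j + e.2 j : ℕ) : ℝ) = (wdeg Q e : ℝ) := by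
    intro Q e
    simp [wdeg]
  -- the face of `∑ P + N P₀` does not depend on `N`; for large `N` this forces its points to be
  -- minimal for `P₀`
  have hint : ∀ N : ℕ, (fun k => (((∑ P ∈ K, P) + N • P₀ : Fin n → ℕ) k : ℝ)) ∈ intCone K := by
    intro N
    refine ⟨fun P => 1 + if P = P₀ then (N : ℝ) else 0, fun P _ => by positivity, fun k => ?_⟩
    simp only [Pi.add_apply, Finset.sum_apply, Pi.smul_apply, smul_eq_mul, add_mul, one_mul,
      Finset.sum_add_distrib, ite_mul, zero_mul, Finset.sum_ite_eq', if_pos hP₀]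
    push_cast
    ring
  have h0 : (fun j => ((e.1 j + e.2 j : ℕ) : ℝ)) ∈
      f.face (fun k => (((∑ P ∈ K, P) + 0 • P₀ : Fin n → ℕ) k : ℝ)) := by
    rw [f.mem_face_iff (fun j => Nat.cast_nonneg _) he]
    intro e' he'
    rw [hcast, hcast, zero_smul, add_zero, hmin]
    exact_mod_cast f.minDegree_le he'
  by_contra hlt
  push Not at hlt
  obtain ⟨N, hN⟩ : ∃ N : ℕ, wdeg (∑ P ∈ K, P) e' < N := ⟨_, Nat.lt_succ_self _⟩
  rw [hadm s.1 s.2 K hK _ (hint 0) _ (hint N), f.mem_face_iff (fun j => Nat.cast_nonneg _) he] at h0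
  have h1 := h0 e' he'
  rw [hcast, hcast] at h1
  have h2 : wdeg ((∑ P ∈ K, P) + N • P₀) e ≤ wdeg ((∑ P ∈ K, P) + N • P₀) e' := by exact_mod_cast h1
  have h3 : ∀ e : (Fin n → ℕ) × (Fin n → ℕ), wdeg ((∑ P ∈ K, P) + N • P₀) e =
      wdeg (∑ P ∈ K, P) e + N * wdeg P₀ e := by
    intro e
    simp only [wdeg, Pi.add_apply, Pi.smul_apply, smul_eq_mul, add_mul, Finset.sum_add_distrib,
      Finset.mul_sum, mul_assoc]
  rw [h3, h3] at h2
  nlinarith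

/-- The exponents on the face of the sum of some vertices of a cone. -/
theorem mem_faceExponents_iff {F : RegularFan n} (hadm : F.IsAdmissible f)
    (hne : f.exps.Nonempty) (s : F.maxCones) {K : Finset (Fin n → ℕ)} (hK : K ⊆ s.1)
    (e : (Fin n → ℕ) × (Fin n → ℕ)) :
    e ∈ f.faceExponents (∑ P ∈ K, P) ↔ e ∈ f.exps ∧ ∀ P ∈ K, wdeg P e = f.minDegree P := by
  obtain ⟨e₀, he₀, hmin⟩ := f.exists_common_minDegree hadm hne s hK
  have hcast : ∀ (Q : Fin n → ℕ) (e : (Fin n → ℕ) × (Fin n → ℕ)),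
      ∑ j, (Q j : ℝ) * ((e.1 j + e.2 j : ℕ) : ℝ) = (wdeg Q e : ℝ) := by
    intro Q e
    simp [wdeg]
  change (e ∈ f.exps ∧ _) ↔ _
  refine and_congr_right fun he => ?_
  rw [f.mem_face_iff (fun j => Nat.cast_nonneg _) he]
  simp only [hcast, Nat.cast_le, wdeg_sum]
  constructor
  · intro h P hP
    have h1 := h e₀ he₀
    rw [Finset.sum_congr rfl hmin] at h1
    have h2 := (Finset.sum_eq_sum_iff_of_le fun P _ => f.minDegree_le (P := P) he).1
      (le_antisymm (Finset.sum_le_sum fun P _ => f.minDegree_le (P := P) he) h1)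
    exact (h2 P hP).symm
  · intro h e' he'
    rw [Finset.sum_congr rfl h]
    exact Finset.sum_le_sum fun P _ => f.minDegree_le he'

theorem exists_axis_exponent (hn : 1 ≤ n) (hconv : f.IsConvenient) (j : Fin n) :
    ∃ e ∈ f.exps, ∀ k, k ≠ j → e.1 k = 0 ∧ e.2 k = 0 := by
  obtain ⟨z, hz, hz0, hfz⟩ := hconv {j} (by rw [Finset.card_singleton]; omega)
  have : ∃ e : (Fin n → ℕ) × (Fin n → ℕ), f.coeff e.1 e.2 * mixedMonomial z e.1 e.2 ≠ 0 := by
    by_contra! h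
    apply hfz
    have h1 := f.hasSum z hz
    simp only [h] at h1
    exact h1.unique hasSum_zero
  obtain ⟨e, he⟩ := this
  refine ⟨e, left_ne_zero_of_mul he, fun k hk => ?_⟩
  have hk0 : z k = 0 := hz0 k (by simpa using hk)
  have h1 := Finset.prod_ne_zero_iff.1 (right_ne_zero_of_mul he) k (Finset.mem_univ k)
  constructor
  · by_contra h
    exact h1 (by rw [hk0, zero_pow h, zero_mul])
  · by_contra h
    exact h1 (by rw [hk0, map_zero, zero_pow h, mul_zero])

theorem wdeg_single (k : Fin n) (e : (Fin n → ℕ) × (Fin n → ℕ)) :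
    wdeg (Pi.single k 1) e = e.1 k + e.2 k := by
  simp only [wdeg]
  rw [Finset.sum_eq_single k]
  · simp
  · intro j _ hj
    simp [Pi.single_eq_of_ne hj]
  · simp

theorem minDegree_single (hn : 2 ≤ n) (hconv : f.IsConvenient) (k : Fin n) :
    f.minDegree (Pi.single k 1) = 0 := by
  have : Nontrivial (Fin n) := Fin.nontrivial_iff_two_le.2 hn
  obtain ⟨j, hj⟩ := exists_ne k
  obtain ⟨e, he, h⟩ := f.exists_axis_exponent (by omega) hconv j
  have := f.minDegree_le (P := Pi.single k 1) he
  rw [wdeg_single, (h k hj.symm).1, (h k hj.symm).2] at this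
  omega

theorem exps_nonempty (hn : 1 ≤ n) (hconv : f.IsConvenient) : f.exps.Nonempty := by
  obtain ⟨e, he, -⟩ := f.exists_axis_exponent hn hconv ⟨0, hn⟩
  exact ⟨e, he⟩

end MixedFunction

/-! ### The exceptional set and its complement -/

namespace RegularFan

variable {n : ℕ} (F : RegularFan n)

/-- No cone of an admissible fan of a convenient function is generated by the standard basis,
except in dimension one. -/
theorem not_std_cone {f : MixedFunction n} (hn : 2 ≤ n) (hconv : f.IsConvenient)
    (hadm : F.IsAdmissible f) (s : F.maxCones) : ¬ ∀ k : Fin n, Pi.single k 1 ∈ s.1 := by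
  intro h
  classical
  -- otherwise one monomial would be minimal, hence of degree `0`, in each variable
  obtain ⟨e, he, h1⟩ := f.exists_common_minDegree hadm (f.exps_nonempty (by omega) hconv) s
    (K := Finset.univ.image fun k : Fin n => (Pi.single k 1 : Fin n → ℕ)) (by
      intro P hP
      obtain ⟨k, -, rfl⟩ := Finset.mem_image.1 hP
      exact h k)
  have h2 : ∀ k, e.1 k = 0 ∧ e.2 k = 0 := by
    intro k
    have := h1 _ (Finset.mem_image.2 ⟨k, Finset.mem_univ k, rfl⟩)
    rw [MixedFunction.wdeg_single, f.minDegree_single hn hconv] at this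
    omega
  have h3 : e = (0, 0) := Prod.ext (funext fun k => (h2 k).1) (funext fun k => (h2 k).2)
  rw [h3] at he
  exact he f.coeff_zero

/-- The property of an admissible fan of a convenient function on which the geometry of the
modification depends: it has only standard vertices on the boundary of the positive quadrant, and
it really subdivides the quadrant. -/
structure IsGood : Prop where
  vertex : ∀ s : F.maxCones, ∀ P ∈ s.1, StrictlyPos P ∨ ∃ i, P = Pi.single i 1
  exists_pos : ∀ s : F.maxCones, ∃ k, Pi.single k 1 ∉ s.1 ∨ StrictlyPos (Pi.single k 1 : Fin n → ℕ)

theorem isGood {f : MixedFunction n} (hn : 1 ≤ n) (hconv : f.IsConvenient)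
    (hadm : F.IsAdmissible f)
    (hvert : ∀ P ∈ F.vertices, StrictlyPos P ∨ ∃ i, P = Pi.single i 1) : F.IsGood where
  vertex s P hP := hvert P (Finset.mem_biUnion.2 ⟨s.1, s.2, hP⟩)
  exists_pos s := by
    rcases hn.lt_or_eq with h | rfl
    · obtain ⟨k, hk⟩ := not_forall.1 (F.not_std_cone h hconv hadm s)
      exact ⟨k, Or.inl hk⟩
    · exact ⟨0, Or.inr fun k => by rw [Subsingleton.elim k 0]; simp⟩

variable {F} {M : PlaneModification}

theorem chartProj_eq_zero_iff {s : Finset (Fin n → ℕ)} (u : s → ℂ) (k : Fin n) :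
    chartProj s u k = 0 ↔ ∃ P : s, u P = 0 ∧ P.1 k ≠ 0 := by
  simp [chartProj, Finset.prod_eq_zero_iff]

theorem chartProj_eq_zero (hF : F.IsGood) {s : F.maxCones} {u : s.1 → ℂ} :
    chartProj s.1 u = 0 ↔ ∃ P : s.1, StrictlyPos P.1 ∧ u P = 0 := by
  constructor
  · intro h
    by_contra! hcon
    obtain ⟨k, hk⟩ := hF.exists_pos s
    obtain ⟨P, hP, hPk⟩ := (chartProj_eq_zero_iff u k).1 (congrFun h k)
    obtain ⟨i, hi⟩ := (hF.vertex s P.1 P.2).resolve_left fun h' => hcon P h' hP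
    have hik : i = k := by
      by_contra hne
      rw [hi, Pi.single_eq_of_ne (Ne.symm hne)] at hPk
      exact hPk rfl
    subst hik
    rcases hk with hk | hk
    · exact hk (hi ▸ P.2)
    · exact hcon P (hi ▸ hk) hP
  · rintro ⟨P, hP, h0⟩
    funext k
    exact (chartProj_eq_zero_iff u k).2 ⟨P, h0, (hP k).ne'⟩

theorem mem_posVertices_iff {P : Fin n → ℕ} :
    P ∈ F.posVertices ↔ (∃ s : F.maxCones, P ∈ s.1) ∧ StrictlyPos P := by
  simp only [posVertices, vertices, Finset.mem_filter, Finset.mem_biUnion, id]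
  constructor
  · rintro ⟨⟨s, hs, hP⟩, h⟩
    exact ⟨⟨⟨s, hs⟩, hP⟩, h⟩
  · rintro ⟨⟨s, hP⟩, h⟩
    exact ⟨⟨s.1, s.2, hP⟩, h⟩

/-- The exceptional set is the union of the divisors of the strictly positive vertices. -/
theorem blowupMap_eq_zero_iff (hF : F.IsGood) (y : F.Blowup M) :
    F.blowupMap M y = 0 ↔ ∃ P ∈ F.posVertices, y ∈ F.blowupDivisor M P := by
  obtain ⟨s, x, rfl⟩ := F.exists_blowupMk y
  rw [blowupMap_mk, chartProj_eq_zero hF]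
  simp only [mk_mem_blowupDivisor_iff]
  constructor
  · rintro ⟨P, h, h0⟩
    exact ⟨P.1, mem_posVertices_iff.2 ⟨⟨s, P.2⟩, h⟩, P.2, h0⟩
  · rintro ⟨P, hP, hs, h0⟩
    exact ⟨⟨P, hs⟩, (mem_posVertices_iff.1 hP).2, h0⟩

theorem zeros_eq_of_ne_zero (hF : F.IsGood) {s : F.maxCones} {u : s.1 → ℂ}
    (h : chartProj s.1 u ≠ 0) :
    F.zeros u = {P | ∃ i, chartProj s.1 u i = 0 ∧ P = Pi.single i 1} := by
  have hnp : ∀ P : s.1, u P = 0 → ∃ i, P.1 = Pi.single i 1 := fun P hP =>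
    (hF.vertex s P.1 P.2).resolve_left fun h' => h ((chartProj_eq_zero hF).2 ⟨P, h', hP⟩)
  ext P
  constructor
  · rintro ⟨hP, h0⟩
    obtain ⟨i, hi⟩ := hnp _ h0
    refine ⟨i, (chartProj_eq_zero_iff u i).2 ⟨_, h0, ?_⟩, hi⟩
    simp only at hi
    simp [hi]
  · rintro ⟨i, hi, rfl⟩
    obtain ⟨P, hP, hPi⟩ := (chartProj_eq_zero_iff u i).1 hi
    obtain ⟨j, hj⟩ := hnp P hP
    have hij : j = i := by
      by_contra hne
      rw [hj, Pi.single_eq_of_ne (Ne.symm hne)] at hPi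
      exact hPi rfl
    subst hij
    have hmem : Pi.single j 1 ∈ s.1 := hj ▸ P.2
    refine ⟨hmem, ?_⟩
    have : P = ⟨Pi.single j 1, hmem⟩ := Subtype.ext hj
    rw [← this]; exact hP

/-- The coordinates in the chart of a cone as monomials in the coordinates of `ℂⁿ`. -/
def invCoord (s : F.maxCones) (z : Fin n → ℂ) (P : s.1) : ℂ := ∏ k, z k ^ F.dual s k P

theorem dual_single {s : F.maxCones} {i : Fin n} (h : Pi.single i 1 ∈ s.1) (P : s.1) :
    F.dual s i P = if Pi.single i 1 = P.1 then 1 else 0 := by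
  have := F.mul_dual s ⟨_, h⟩ P
  rw [Finset.sum_eq_single i] at this
  · simpa [Subtype.ext_iff] using this
  · intro k _ hk
    simp [Pi.single_eq_of_ne hk]
  · simp

theorem dual_single_nonneg {s : F.maxCones} {i : Fin n} (h : Pi.single i 1 ∈ s.1) (P : s.1) :
    0 ≤ F.dual s i P := by
  rw [dual_single h]
  split_ifs <;> norm_num

theorem chartProj_invCoord {s : F.maxCones} {z : Fin n → ℂ}
    (h : ∀ i, z i = 0 → Pi.single i 1 ∈ s.1) : chartProj s.1 (invCoord s z) = z := by
  funext j
  have h1 : ∀ P : s.1, invCoord s z P ^ P.1 j = ∏ k, z k ^ (F.dual s k P * (P.1 j : ℤ)) := by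
    intro P
    rw [invCoord, ← Finset.prod_pow]
    exact Finset.prod_congr rfl fun k _ => by rw [zpow_mul, zpow_natCast]
  simp only [chartProj, h1]
  rw [Finset.prod_comm]
  have h2 : ∀ k, ∏ P : s.1, z k ^ (F.dual s k P * (P.1 j : ℤ)) = z k ^ (if k = j then 1 else 0 : ℤ) := by
    intro k
    rw [prod_zpow_eq_zpow_sum, dual_mul]
    exact fun hz P _ => mul_nonneg (dual_single_nonneg (h k hz) P) (by positivity)
  simp only [h2]
  rw [Finset.prod_eq_single j]
  · simp
  · intro k _ hk
    simp [hk]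
  · simp

theorem invCoord_chartProj (hF : F.IsGood) {s : F.maxCones} {u : s.1 → ℂ}
    (h : chartProj s.1 u ≠ 0) : invCoord s (chartProj s.1 u) = u := by
  funext P
  have h1 : ∀ k, chartProj s.1 u k ^ F.dual s k P = ∏ Q : s.1, u Q ^ ((Q.1 k : ℤ) * F.dual s k P) := by
    intro k
    rw [chartProj, ← Finset.prod_zpow]
    exact Finset.prod_congr rfl fun Q _ => by rw [zpow_mul, zpow_natCast]
  simp only [invCoord, h1]
  rw [Finset.prod_comm]
  have h2 : ∀ Q : s.1, ∏ k, u Q ^ ((Q.1 k : ℤ) * F.dual s k P) =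
      u Q ^ (if Q = P then 1 else 0 : ℤ) := by
    intro Q
    rw [prod_zpow_eq_zpow_sum, mul_dual]
    intro hQ k _
    have hz : Q.1 ∈ F.zeros u := ⟨Q.2, hQ⟩
    rw [zeros_eq_of_ne_zero hF h] at hz
    obtain ⟨i, hi, hQi⟩ := hz
    by_cases hk : k = i
    · subst hk
      exact mul_nonneg (by positivity) (dual_single_nonneg (hQi ▸ Q.2) P)
    · rw [hQi, Pi.single_eq_of_ne hk]
      simp
  simp only [h2]
  rw [Finset.prod_eq_single P]
  · simp
  · intro Q _ hQ
    simp [hQ]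
  · simp

/-- Off the exceptional set the modification is injective. -/
theorem blowupMap_injOn (hF : F.IsGood) (hM : M.IsAnalytic) {y y' : F.Blowup M}
    (h : F.blowupMap M y = F.blowupMap M y') (h0 : F.blowupMap M y ≠ 0) : y = y' := by
  obtain ⟨s, x, rfl⟩ := F.exists_blowupMk y
  obtain ⟨t, x', rfl⟩ := F.exists_blowupMk y'
  have h0' : F.blowupMap M (F.blowupMk M t x') ≠ 0 := h ▸ h0
  simp only [blowupMap_mk] at h h0 h0'
  have hz : F.zeros x.coord = F.zeros x'.coord := by
    rw [zeros_eq_of_ne_zero hF h0, zeros_eq_of_ne_zero hF h0', h]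
  have hD : ∀ P : s.1, P.1 ∉ t.1 → x.coord P ≠ 0 := by
    apply F.ne_zero_of_zeros_subset
    rw [hz]
    exact F.zeros_subset_of_ne_zero fun P hP => absurd P.2 hP
  refine (F.blowupMk_eq_iff hM).2 ⟨hD, ?_⟩
  have hproj : chartProj t.1 (F.trans hM s t x).coord = chartProj s.1 x.coord :=
    congrArg (F.blowupMap M) (F.blowupMk_trans hM hD)
  have hcoord : x'.coord = (F.trans hM s t x).coord := by
    rw [← invCoord_chartProj hF h0', ← h, ← hproj, invCoord_chartProj hF (hproj ▸ h0)]
  refine BlowupChart.ext hM (fun Q => congrFun hcoord Q) fun Q hQ => ?_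
  have hQ0 : x'.coord Q ≠ 0 := fun h' => h0' ((chartProj_eq_zero hF).2 ⟨Q, hQ, h'⟩)
  rw [BlowupChart.dir_eq hM _ _ hQ0, BlowupChart.dir_eq hM _ _ (hcoord ▸ hQ0), hcoord]

/-- For every proper subset of the coordinates, the corresponding part of the standard basis spans
a cone of the fan. -/
theorem exists_std_face (hF : F.IsGood) {z : Fin n → ℂ} (hz : z ≠ 0) :
    ∃ s : F.maxCones, ∀ i, z i = 0 → Pi.single i 1 ∈ s.1 := by
  classical
  obtain ⟨k₀, hk₀⟩ := Function.ne_iff.1 hz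
  -- the cone is chosen to contain the characteristic vector of the set of zeros of `z`; the vertices
  -- that enter are supported in this set, so they are not strictly positive
  set x : Fin n → ℝ := fun k => if z k = 0 then 1 else 0 with hx
  obtain ⟨s, t, ht, hs⟩ := F.exists_mem_cone (x := x) (fun k => by
    simp only [hx]; split_ifs <;> norm_num)
  refine ⟨s, fun i hi => ?_⟩
  have h1 : ∑ P ∈ s.1, t P * (P i : ℝ) ≠ 0 := by
    rw [← hs]
    simp [hx, hi]
  obtain ⟨P, hP, hne⟩ := Finset.exists_ne_zero_of_sum_ne_zero h1
  have htP : 0 < t P := lt_of_le_of_ne (ht P hP) (left_ne_zero_of_mul hne).symm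
  have hsupp : ∀ k, P k ≠ 0 → z k = 0 := by
    intro k hk
    by_contra hzk
    have h2 : ∑ P ∈ s.1, t P * (P k : ℝ) = 0 := by
      rw [← hs]
      simp [hx, hzk]
    have h3 := (Finset.sum_eq_zero_iff_of_nonneg fun Q hQ =>
      mul_nonneg (ht Q hQ) (Nat.cast_nonneg _)).1 h2 P hP
    exact (mul_ne_zero htP.ne' (by exact_mod_cast hk)) h3
  obtain ⟨j, hj⟩ := (hF.vertex s P hP).resolve_left fun h => hk₀ (hsupp k₀ (h k₀).ne')
  have hij : i = j := by
    by_contra hne'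
    apply right_ne_zero_of_mul hne
    rw [hj, Pi.single_eq_of_ne hne']
    simp
  rw [hij, ← hj]
  exact hP

/-- The point of the chart with given coordinates, nonzero for the strictly positive vertices. -/
def liftPoint (hM : M.IsAnalytic) {s : Finset (Fin n → ℕ)} (u : s → ℂ) : BlowupChart M s :=
  (fun P => hM.act (u P.1) hM.one, fun P => u P.1)

theorem coord_liftPoint (hM : M.IsAnalytic) {s : Finset (Fin n → ℕ)} {u : s → ℂ}
    (hu : ∀ P : s, StrictlyPos P.1 → u P ≠ 0) : (liftPoint hM u).coord = u := by
  funext P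
  by_cases h : StrictlyPos P.1
  · rw [BlowupChart.coord_pos _ ⟨P, h⟩]
    change M.val (hM.act (u P) hM.one) = _
    rw [hM.val_act _ (hu P h), hM.val_one, mul_one]
  · exact BlowupChart.coord_nonpos _ ⟨P, h⟩

theorem blowupMap_liftPoint (hF : F.IsGood) (hM : M.IsAnalytic) {s : F.maxCones} {z : Fin n → ℂ}
    (hz : z ≠ 0) (h : ∀ i, z i = 0 → Pi.single i 1 ∈ s.1) :
    F.blowupMap M (F.blowupMk M s (liftPoint hM (invCoord s z))) = z := by
  have h1 := chartProj_invCoord h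
  have h2 : ∀ P : s.1, StrictlyPos P.1 → invCoord s z P ≠ 0 := by
    intro P hP h0
    apply hz
    rw [← h1]
    exact (chartProj_eq_zero hF).2 ⟨P, hP, h0⟩
  rw [blowupMap_mk, coord_liftPoint hM h2, h1]

theorem contDiffAt_invCoord {s : F.maxCones} {z : Fin n → ℂ}
    (h : ∀ i, z i = 0 → Pi.single i 1 ∈ s.1) : ContDiffAt ℝ ω (invCoord s) z := by
  refine contDiffAt_pi.2 fun P => contDiffAt_prod fun k _ => ?_
  have hk : ContDiffAt ℝ ω (fun z : Fin n → ℂ => z k) z := (contDiff_apply ℝ ℂ k).contDiffAt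
  by_cases hz : z k = 0
  · rw [dual_single (h k hz)]
    split_ifs
    · simpa using hk
    · simpa using contDiffAt_const
  · exact hk.zpow_complex hz _

end RegularFan

/-! ### Analytic maps in local coordinates -/

namespace IsLocalCoord

variable {E H Y V : Type*} [NormedAddCommGroup E] [NormedSpace ℝ E] [TopologicalSpace H]
  {I : ModelWithCorners ℝ E H} [TopologicalSpace Y] [ChartedSpace H Y] [NormedAddCommGroup V]
  [NormedSpace ℝ V] {C : Set V} {U : Set Y} {u : Y → V} {g : V → Y} (h : IsLocalCoord I C U u g)
include h

theorem mem {y : Y} (hy : y ∈ U) : u y ∈ C := by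
  obtain ⟨W, -, hW⟩ := h.image
  have : u y ∈ W ∩ C := hW ▸ Set.mem_image_of_mem u hy
  exact this.2

theorem symm_mem {v : V} (hv : v ∈ u '' U) : g v ∈ U := by
  obtain ⟨y, hy, rfl⟩ := hv
  rwa [h.left_inv y hy]

theorem right_inv {v : V} (hv : v ∈ u '' U) : u (g v) = v := by
  obtain ⟨y, hy, rfl⟩ := hv
  rw [h.left_inv y hy]

theorem contMDiffAt {y : Y} (hy : y ∈ U) : ContMDiffAt I 𝓘(ℝ, V) ω u y :=
  (h.analytic y hy).contMDiffAt (h.isOpen.mem_nhds hy)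

theorem eventually_mem_image {y : Y} (hy : y ∈ U) : ∀ᶠ v in 𝓝 (u y), v ∈ C → v ∈ u '' U := by
  obtain ⟨W, hW, hWU⟩ := h.image
  have : u y ∈ W ∩ C := hWU ▸ Set.mem_image_of_mem u hy
  filter_upwards [hW.mem_nhds this.1] with v hv hC
  rw [hWU]
  exact ⟨hv, hC⟩

theorem contMDiffWithinAt_symm {y : Y} (hy : y ∈ U) : ContMDiffWithinAt 𝓘(ℝ, V) I ω g C (u y) := by
  refine (h.analytic_symm _ ⟨y, hy, rfl⟩).mono_of_mem_nhdsWithin ?_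
  filter_upwards [(h.eventually_mem_image hy).filter_mono nhdsWithin_le_nhds, self_mem_nhdsWithin]
    with v hv hC using hv hC

/-- A map is analytic if it is given by an analytic map in terms of the coordinates. -/
theorem contMDiffAt_of_eventuallyEq {V' : Type*} [NormedAddCommGroup V'] [NormedSpace ℝ V']
    {y : Y} (hy : y ∈ U) {φ : Y → V'} {G : V → V'} (hG : ContDiffAt ℝ ω G (u y))
    (hφ : ∀ᶠ v in 𝓝 (u y), v ∈ C → φ (g v) = G v) : ContMDiffAt I 𝓘(ℝ, V') ω φ y := by
  have hu := h.contMDiffAt hy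
  refine (hG.contMDiffAt.comp y hu).congr_of_eventuallyEq ?_
  filter_upwards [hu.continuousAt.eventually hφ, h.isOpen.mem_nhds hy] with x hx hxU
  rw [Function.comp, ← hx (h.mem hxU), h.left_inv x hxU]

end IsLocalCoord

namespace RegularFan

variable {n : ℕ} {F : RegularFan n} {M : PlaneModification} (hM : M.IsAnalytic)

section Structure

variable {E H : Type*} [NormedAddCommGroup E] [NormedSpace ℝ E] [TopologicalSpace H]
    {I : ModelWithCorners ℝ E H} [ChartedSpace H (F.Blowup M)] (hI : F.IsBlowupStructure M I)
include hI

/-- A map to the blowing up is analytic if it is given by an analytic map to a parameter space. -/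
theorem contMDiffAt_to_blowup {E' H' N : Type*} [NormedAddCommGroup E'] [NormedSpace ℝ E']
    [TopologicalSpace H'] {J : ModelWithCorners ℝ E' H'} [TopologicalSpace N] [ChartedSpace H' N]
    {s : F.maxCones} {p : PosIdx s.1 → ℝ × ℝ → M.Pt} (hp : ∀ P, p P ∈ M.params)
    {x : N} {φ : N → F.Blowup M} {ρ : N → ParamSpace s.1}
    (hρ : ContMDiffAt J 𝓘(ℝ, ParamSpace s.1) ω ρ x)
    (h : ∀ᶠ y in 𝓝 x, ρ y ∈ coordRegion M s.1 ∧ φ y = F.blowupParam M s p (ρ y)) :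
    ContMDiffAt J I ω φ x := by
  obtain ⟨U, u, hU, hu, hloc⟩ := hI s p hp (ρ x) h.self_of_nhds.1
  have h1 := hloc.contMDiffWithinAt_symm hU
  rw [hu] at h1
  have h2 : ContMDiffWithinAt J I ω (F.blowupParam M s p ∘ ρ) (ρ ⁻¹' coordRegion M s.1) x :=
    ContMDiffWithinAt.comp x h1 hρ.contMDiffWithinAt fun _ hy => hy
  refine (h2.contMDiffAt (h.mono fun y hy => hy.1)).congr_of_eventuallyEq (h.mono fun y hy => hy.2)

include hM in
theorem exists_localCoord (y : F.Blowup M) : ∃ (s : F.maxCones) (p : PosIdx s.1 → ℝ × ℝ → M.Pt)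
    (U : Set (F.Blowup M)) (u : F.Blowup M → ParamSpace s.1), (∀ P, p P ∈ M.params) ∧ y ∈ U ∧
      IsLocalCoord I (coordRegion M s.1) U u (F.blowupParam M s p) := by
  obtain ⟨⟨s, p, hp⟩, a, ha, rfl⟩ := (F.isParamSystem hM).cover y
  obtain ⟨U, u, h1, -, h2⟩ := hI s p hp a ha
  exact ⟨s, p, U, u, hp, h1, h2⟩

include hM in
theorem contMDiff_blowupMap : ContMDiff I 𝓘(ℝ, Fin n → ℂ) ω (F.blowupMap M) := by
  intro y
  obtain ⟨s, p, U, u, hp, hy, h⟩ := exists_localCoord hM hI y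
  obtain ⟨G, hG, hG'⟩ := exists_coordFun hM p hp
  refine h.contMDiffAt_of_eventuallyEq hy (G := fun v => chartProj s.1 (G v)) ?_
    (Filter.Eventually.of_forall fun v hv => ?_)
  · exact contDiffAt_pi.2 fun k => contDiffAt_prod fun P _ =>
      (contDiffAt_pi.1 hG.contDiffAt P).pow _
  · rw [hG' v hv]
    rfl

end Structure

theorem nonempty_blowup (hM : M.IsAnalytic) : Nonempty (F.Blowup M) := by
  obtain ⟨s, -⟩ := F.exists_mem_cone (x := 0) fun _ => le_rfl
  exact ⟨F.blowupMk M s (fun _ => hM.one, 0)⟩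

/-- Off the exceptional set the modification is an analytic diffeomorphism. -/
theorem exists_inverse_blowupMap (hF : F.IsGood) (hM : M.IsAnalytic) {E H : Type*} [NormedAddCommGroup E]
    [NormedSpace ℝ E] [TopologicalSpace H] {I : ModelWithCorners ℝ E H}
    [ChartedSpace H (F.Blowup M)] (hI : F.IsBlowupStructure M I) :
    ∃ g : (Fin n → ℂ) → F.Blowup M, Set.MapsTo (F.blowupMap M) (F.blowupMap M ⁻¹' {0})ᶜ {0}ᶜ ∧
      Set.MapsTo g {0}ᶜ (F.blowupMap M ⁻¹' {0})ᶜ ∧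
      Set.InvOn g (F.blowupMap M) (F.blowupMap M ⁻¹' {0})ᶜ {0}ᶜ ∧
      ContMDiffOn 𝓘(ℝ, Fin n → ℂ) I ω g {0}ᶜ := by
  have := nonempty_blowup (F := F) hM
  have hg : ∀ z : Fin n → ℂ, z ≠ 0 → F.blowupMap M (Function.invFun (F.blowupMap M) z) = z := by
    intro z hz
    obtain ⟨s, hs⟩ := exists_std_face hF hz
    exact Function.invFun_eq ⟨_, blowupMap_liftPoint hF hM hz hs⟩
  refine ⟨Function.invFun (F.blowupMap M), fun y hy => hy, fun z hz => ?_, ⟨fun y hy => ?_,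
    fun z hz => hg z hz⟩, fun z₀ hz₀ => ContMDiffAt.contMDiffWithinAt ?_⟩
  · change ¬ F.blowupMap M _ = 0
    rw [hg z hz]
    exact hz
  · exact blowupMap_injOn hF hM (hg _ hy) ((hg _ hy).trans_ne hy)
  · obtain ⟨s, hs⟩ := exists_std_face hF hz₀
    have hs' : ∀ᶠ z in 𝓝 z₀, ∀ i, z i = 0 → Pi.single i 1 ∈ s.1 := by
      refine Filter.eventually_all.2 fun i => ?_
      by_cases hi : z₀ i = 0
      · exact Filter.Eventually.of_forall fun _ _ => hs i hi
      · exact ((continuous_apply i).continuousAt.eventually_ne hi).mono fun z hz h => absurd h hz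
    obtain ⟨p₁, hp₁, a₁, ha₁, hone⟩ := hM.exists_param hM.one
    have hne : ∀ P : s.1, StrictlyPos P.1 → invCoord s z₀ P ≠ 0 := by
      intro P hP h0
      apply hz₀
      rw [Set.mem_singleton_iff, ← chartProj_invCoord hs]
      exact (chartProj_eq_zero hF).2 ⟨P, hP, h0⟩
    choose q hq b hb hqb using fun P : PosIdx s.1 => hM.exists_param
      (hM.act (invCoord s z₀ P.1) hM.one)
    choose ψ hψ hψ1 hψ2 using fun P : PosIdx s.1 => hM.analytic_act p₁ hp₁ (q P) (hq P)
      (invCoord s z₀ P.1) (hne P.1 P.2) a₁ ha₁ (b P) (hb P) (by rw [hone, hqb])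
    have hinv : ∀ P, ContDiffAt ℝ ω (fun z => invCoord s z P) z₀ :=
      contDiffAt_pi.1 (contDiffAt_invCoord hs)
    refine contMDiffAt_to_blowup hI hq (ρ := fun z =>
      (fun P => ψ P (invCoord s z P.1, a₁), fun P => invCoord s z P.1)) ?_ ?_
    · refine ContDiffAt.contMDiffAt (ContDiffAt.prodMk (contDiffAt_pi.2 fun P => ?_)
        (contDiffAt_pi.2 fun P => hinv P.1))
      exact ContDiffAt.comp z₀ (hψ P) ((hinv P.1).prodMk contDiffAt_const)
    · have h1 : ∀ᶠ z in 𝓝 z₀, ∀ P : PosIdx s.1, a₁ ∈ M.region →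
          ψ P (invCoord s z P.1, a₁) ∈ M.region ∧
            hM.act (invCoord s z P.1) (p₁ a₁) = q P (ψ P (invCoord s z P.1, a₁)) :=
        Filter.eventually_all.2 fun P =>
          ((hinv P.1).continuousAt.prodMk continuousAt_const).eventually (hψ2 P)
      filter_upwards [hs', h1, isOpen_compl_singleton.mem_nhds hz₀] with z hz hz1 hz2
      refine ⟨fun P => (hz1 P ha₁).1, ?_⟩
      have h2 := blowupMap_liftPoint hF hM hz2 hz
      have h3 : Function.invFun (F.blowupMap M) z = F.blowupMk M s (liftPoint hM (invCoord s z)) :=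
        blowupMap_injOn hF hM ((hg z hz2).trans h2.symm) ((hg z hz2).trans_ne hz2)
      rw [h3]
      refine congrArg (F.blowupMk M s) (Prod.ext (funext fun P => ?_) rfl)
      change hM.act (invCoord s z P.1) hM.one = _
      rw [← hone]
      exact (hz1 P ha₁).2

/-! ### Properness -/

/-- Over a bounded part of the torus every point has bounded coordinates in some chart. -/
theorem exists_bounded_coord (hM : M.IsAnalytic) {R : ℝ} : ∃ C : ℝ, ∀ y ∈ F.torus M,
    (∀ k, ‖F.blowupMap M y k‖ ≤ R) → ∃ (s : F.maxCones) (x : BlowupChart M s.1),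
      F.blowupMk M s x = y ∧ ∀ P, ‖x.coord P‖ ≤ C := by
  refine ⟨∑ s : F.maxCones, ∑ P : s.1, Real.exp (Real.log R * F.coef s 1 P.1), ?_⟩
  intro y hy hR
  obtain ⟨t, x', rfl⟩ := F.exists_blowupMk y
  have hx' := F.mk_mem_torus_iff.1 hy
  rw [blowupMap_mk] at hR
  set z := chartProj t.1 x'.coord with hz
  have hz0 : ∀ k, z k ≠ 0 := fun k h0 => by
    obtain ⟨P, hP, -⟩ := (chartProj_eq_zero_iff _ _).1 h0
    exact hx' P hP
  -- the chart is that of a cone containing `log R - log |z|`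
  set w : Fin n → ℝ := fun k => Real.log R - Real.log ‖z k‖ with hw
  obtain ⟨s, hws⟩ := F.exists_mem_cone (x := w) fun k =>
    sub_nonneg.2 (Real.log_le_log (norm_pos_iff.2 (hz0 k)) (hR k))
  have hD : ∀ P : t.1, P.1 ∉ s.1 → x'.coord P ≠ 0 := fun P _ => hx' P
  refine ⟨s, F.trans hM t s x', F.blowupMk_trans hM hD, ?_⟩
  set x := F.trans hM t s x' with hxdef
  have hzx : z = chartProj s.1 x.coord := (congrArg (F.blowupMap M) (F.blowupMk_trans hM hD)).symm
  have hx : ∀ P, x.coord P ≠ 0 := by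
    apply F.mk_mem_torus_iff.1
    rw [F.blowupMk_trans hM hD]
    exact hy
  classical
  set β : (Fin n → ℕ) → ℝ := fun P => if h : P ∈ s.1 then Real.log ‖x.coord ⟨P, h⟩‖ else 0
  have hβ : ∀ P : s.1, β P = Real.log ‖x.coord P‖ := fun P => dif_pos P.2
  have hwβ : w = Real.log R • (1 : Fin n → ℝ) - fun k => ∑ P ∈ s.1, β P * (P k : ℝ) := by
    funext k
    simp only [hw, hzx, chartProj, norm_prod, norm_pow, Pi.sub_apply, Pi.smul_apply, Pi.one_apply,
      smul_eq_mul, mul_one]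
    rw [← Finset.sum_coe_sort s.1]
    simp only [hβ]
    rw [Real.log_prod fun P _ => pow_ne_zero _ (norm_ne_zero_iff.2 (hx P))]
    simp only [Real.log_pow, mul_comm]
  intro P
  have h := (F.mem_cone_iff s w).1 hws P.1
  rw [hwβ, F.coef_sub, F.coef_smul, F.coef_of_sum s subset_rfl (c := β) (fun k => rfl),
    if_pos P.2, hβ, sub_nonneg] at h
  rw [Real.log_le_iff_le_exp (norm_pos_iff.2 (hx P))] at h
  refine h.trans ?_
  refine (Finset.single_le_sum (f := fun P : s.1 => Real.exp (Real.log R * F.coef s 1 P.1))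
    (fun _ _ => (Real.exp_pos _).le) (Finset.mem_univ P)).trans ?_
  exact Finset.single_le_sum
    (f := fun s : F.maxCones => ∑ P : s.1, Real.exp (Real.log R * F.coef s 1 P.1))
    (fun _ _ => Finset.sum_nonneg fun _ _ => (Real.exp_pos _).le) (Finset.mem_univ s)

theorem isCompact_polar_coord_le (s : Finset (Fin n → ℕ)) (C : ℝ) :
    IsCompact {x : BlowupChart polarPlane s | ∀ P, ‖x.coord P‖ ≤ C} := by
  have h1 : IsCompact (Set.pi Set.univ fun _ : PosIdx s =>
      (Set.Icc (0 : ℝ≥0) C.toNNReal ×ˢ (Set.univ : Set Circle))) :=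
    isCompact_univ_pi fun _ => isCompact_Icc.prod isCompact_univ
  have h2 : IsCompact (Set.pi Set.univ fun _ : NonposIdx s => Metric.closedBall (0 : ℂ) C) :=
    isCompact_univ_pi fun _ => isCompact_closedBall _ _
  have hcl : IsClosed {x : BlowupChart polarPlane s | ∀ P, ‖x.coord P‖ ≤ C} := by
    simp only [Set.ofPred_forall]
    exact isClosed_iInter fun P => isClosed_le
      (BlowupChart.continuous_coord polarAnalytic P).norm continuous_const
  have h3 : IsCompact ((Set.pi Set.univ fun _ : PosIdx s =>
      (Set.Icc (0 : ℝ≥0) C.toNNReal ×ˢ (Set.univ : Set Circle))) ×ˢ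
      (Set.pi Set.univ fun _ : NonposIdx s => Metric.closedBall (0 : ℂ) C)) := h1.prod h2
  refine IsCompact.of_isClosed_subset (X := BlowupChart polarPlane s) h3 hcl fun x hx => ⟨?_, ?_⟩
  · intro P _
    refine ⟨⟨bot_le, ?_⟩, trivial⟩
    have h := hx P.1
    rw [BlowupChart.coord_pos] at h
    have h4 : ‖polarPlane.val (x.1 P)‖ = ((x.1 P).1 : ℝ) := by
      change ‖(((x.1 P).1 : ℝ) : ℂ) * ((x.1 P).2 : ℂ)‖ = _
      rw [norm_mul, Circle.norm_coe, mul_one]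
      simp
    rw [h4] at h
    exact NNReal.le_toNNReal_of_coe_le h
  · intro P _
    have h := hx P.1
    rw [BlowupChart.coord_nonpos] at h
    exact mem_closedBall_zero_iff.2 h

theorem isProperMap_blowupMap : IsProperMap (F.blowupMap polarPlane) := by
  have := F.t2Space_blowup polarAnalytic
  have hcont : Continuous (F.blowupMap polarPlane) := by
    refine continuous_iff_continuousAt.2 fun y => ?_
    obtain ⟨s, x, rfl⟩ := F.exists_blowupMk y
    rw [← (F.isOpenEmbedding_blowupMk polarAnalytic s).continuousAt_iff]
    have : Continuous fun x : BlowupChart polarPlane s.1 => chartProj s.1 x.coord :=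
      continuous_pi fun k => continuous_finsetProd _ fun P _ =>
        (BlowupChart.continuous_coord polarAnalytic P).pow _
    exact this.continuousAt
  rw [isProperMap_iff_isCompact_preimage]
  refine ⟨hcont, fun K hK => ?_⟩
  obtain ⟨R, hR⟩ := hK.isBounded.exists_norm_le
  obtain ⟨C, hC⟩ := exists_bounded_coord (F := F) polarAnalytic (R := R + 1)
  have hT : IsCompact (⋃ s : F.maxCones, F.blowupMk polarPlane s ''
      {x : BlowupChart polarPlane s.1 | ∀ P, ‖x.coord P‖ ≤ C}) :=
    isCompact_iUnion fun s => (isCompact_polar_coord_le s.1 C).image (F.continuous_blowupMk s)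
  -- the bound in the torus carries over to its closure
  refine hT.of_isClosed_subset (hK.isClosed.preimage hcont) fun y hy => ?_
  have hO : IsOpen (F.blowupMap polarPlane ⁻¹' {z | ‖z‖ < R + 1}) :=
    (isOpen_lt continuous_norm continuous_const).preimage hcont
  have hyO : y ∈ F.blowupMap polarPlane ⁻¹' {z | ‖z‖ < R + 1} := by
    have := hR _ hy
    change ‖F.blowupMap polarPlane y‖ < R + 1
    linarith
  have h1 := (F.dense_blowup_torus polarAnalytic).open_subset_closure_inter hO hyO
  refine hT.isClosed.closure_subset_iff.2 ?_ h1
  rintro y' ⟨hy1, hy2⟩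
  obtain ⟨s, x, h2, h3⟩ := hC y' hy2 fun k => (norm_le_pi_norm _ k).trans (le_of_lt hy1)
  exact Set.mem_iUnion.2 ⟨s, x, h3, h2⟩

/-! ### The canonical map from the polar to the real blowing up -/

theorem coord_polarToReal {s : Finset (Fin n → ℕ)} (x : BlowupChart polarPlane s) :
    BlowupChart.coord (M := realPlane) (s := s) (fun P => polarToReal (x.1 P), x.2) = x.coord := by
  funext P
  by_cases h : StrictlyPos P.1
  · rw [BlowupChart.coord_pos _ ⟨P, h⟩, BlowupChart.coord_pos _ ⟨P, h⟩]
    exact val_polarToReal _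
  · rw [BlowupChart.coord_nonpos _ ⟨P, h⟩, BlowupChart.coord_nonpos _ ⟨P, h⟩]

/-- The line spanned by a point of the circle, as a homomorphism. -/
def circleToLine : Circle →* RealProjLine := (QuotientGroup.mk' _).comp Circle.toUnits

theorem dir_polarToReal {s : Finset (Fin n → ℕ)} (x : BlowupChart polarPlane s) (P : s) :
    BlowupChart.dir (M := realPlane) (s := s) (fun P => polarToReal (x.1 P), x.2) P =
      circleToLine (x.dir P) := by
  by_cases h : StrictlyPos P.1
  · rw [BlowupChart.dir_pos _ ⟨P, h⟩, BlowupChart.dir_pos _ ⟨P, h⟩]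
    rfl
  · have h1 : BlowupChart.dir (M := realPlane) (s := s) (fun P => polarToReal (x.1 P), x.2) P =
        realPlane.dirOf (x.2 ⟨P, h⟩) := dif_neg h
    have h2 : x.dir P = polarPlane.dirOf (x.2 ⟨P, h⟩) := dif_neg h
    rw [h1, h2]
    generalize x.2 ⟨P, h⟩ = z
    by_cases hz : z = 0
    · subst hz
      change (if h : (0 : ℂ) = 0 then _ else _) = circleToLine (Circle.exp (Complex.arg 0))
      rw [dif_pos rfl, Complex.arg_zero, Circle.exp_zero, map_one]
    · change (if h : z = 0 then _ else _) = circleToLine (Circle.exp (Complex.arg z))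
      rw [dif_neg hz]
      refine QuotientGroup.eq.2 ⟨(Units.mk0 ‖z‖ (norm_ne_zero_iff.2 hz))⁻¹, ?_⟩
      ext
      have := coe_exp_arg hz
      simp only [map_inv, Units.val_mul, Units.val_inv_eq_inv_val, Units.val_mk0, Units.coe_map,
        MonoidHom.coe_coe]
      change _ = z⁻¹ * (Circle.exp z.arg : ℂ)
      rw [this]
      have h3 : ((‖z‖ : ℝ) : ℂ) ≠ 0 := by simpa using hz
      simp only [Complex.coe_algebraMap]
      field_simp

variable (F) in
/-- The canonical map from the polar to the real blowing up. -/
def polarToRealMap : F.PolarBlowup → F.RealBlowup :=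
  Quot.map (fun x => ⟨x.1, fun P => polarToReal (x.2.1 P), x.2.2⟩) (by
    rintro ⟨s, x⟩ ⟨t, y⟩ ⟨a, h1, h2, h3, h4⟩
    refine ⟨a, h1, ?_, ?_, fun Q hQ => ?_⟩
    · simp only [coord_polarToReal]
      exact h2
    · simp only [coord_polarToReal]
      exact h3
    · simp only [dir_polarToReal]
      refine (congrArg circleToLine (h4 Q hQ)).trans ?_
      have key : ∀ f : s.1 → Circle, circleToLine (∏ P, f P ^ a P Q) =
          ∏ P, circleToLine (f P) ^ a P Q := by
        intro f
        simp only [map_prod, map_zpow]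
      exact key fun P => x.dir P)

theorem blowupProj_polarToRealMap (y : F.PolarBlowup) :
    F.blowupProj realPlane (F.polarToRealMap y) = F.blowupProj polarPlane y := by
  obtain ⟨s, x, rfl⟩ := F.exists_blowupMk y
  exact congrArg (fun u => (Quot.mk F.toricRel ⟨s, u⟩ : F.Toric)) (coord_polarToReal x)

theorem contMDiff_polarToRealMap {E H E' H' : Type*} [NormedAddCommGroup E] [NormedSpace ℝ E]
    [TopologicalSpace H] {I : ModelWithCorners ℝ E H} [ChartedSpace H F.PolarBlowup]
    (hI : F.IsBlowupStructure polarPlane I) [NormedAddCommGroup E'] [NormedSpace ℝ E']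
    [TopologicalSpace H'] {I' : ModelWithCorners ℝ E' H'} [ChartedSpace H' F.RealBlowup]
    (hI' : F.IsBlowupStructure realPlane I') : ContMDiff I I' ω F.polarToRealMap := by
  intro y
  obtain ⟨s, p, U, u, hp, hy, h⟩ := exists_localCoord polarAnalytic hI y
  obtain rfl : p = fun _ => polarParam := funext fun P => hp P
  choose q hq b hb hqb using fun P : PosIdx s.1 => realAnalytic.exists_param
    (polarToReal (polarParam ((u y).1 P)))
  choose ψ hψ hψ1 hψ2 using fun P : PosIdx s.1 => polarToReal_analytic (hq P)
    (h.mem hy P) (hqb P).symm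
  have hu := h.contMDiffAt hy
  refine contMDiffAt_to_blowup hI' hq (ρ := fun x => (fun P => ψ P ((u x).1 P), (u x).2)) ?_ ?_
  · have : ContDiffAt ℝ ω (fun v : ParamSpace s.1 => ((fun P => ψ P (v.1 P), v.2) : ParamSpace s.1))
        (u y) := by
      refine ContDiffAt.prodMk (contDiffAt_pi.2 fun P => ?_) contDiffAt_snd
      exact ContDiffAt.comp (u y) (hψ P) ((contDiff_apply ℝ (ℝ × ℝ) P).comp contDiff_fst).contDiffAt
    exact this.contMDiffAt.comp y hu
  · have h1 : ∀ᶠ x in 𝓝 y, ∀ P : PosIdx s.1, 0 ≤ ((u x).1 P).1 →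
        polarToReal (polarParam ((u x).1 P)) = q P (ψ P ((u x).1 P)) :=
      Filter.eventually_all.2 fun P => (((continuous_apply P).comp
        continuous_fst).continuousAt.comp hu.continuousAt).eventually (hψ2 P)
    filter_upwards [h1, h.isOpen.mem_nhds hy] with x hx hxU
    refine ⟨fun P => trivial, ?_⟩
    conv_lhs => rw [← h.left_inv x hxU]
    exact congrArg (F.blowupMk realPlane s) (Prod.ext (funext fun P => hx P (h.mem hxU P)) rfl)

/-- The canonical map is the only continuous map over the toric manifold, because over the torus
there is no choice. -/
theorem eq_polarToRealMap (hF : F.IsGood) {η : F.PolarBlowup → F.RealBlowup} (hη : Continuous η)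
    (hc : Continuous F.polarToRealMap)
    (h : F.blowupProj polarPlane = F.blowupProj realPlane ∘ η) : η = F.polarToRealMap := by
  have := F.t2Space_blowup realAnalytic
  refine hη.ext_on (F.dense_blowup_torus polarAnalytic) hc fun y hy => ?_
  have h1 : F.blowupMap realPlane (F.polarToRealMap y) = F.blowupMap polarPlane y :=
    congrArg F.toricMap (blowupProj_polarToRealMap y)
  have h2 : F.blowupMap realPlane (η y) = F.blowupMap polarPlane y :=
    congrArg F.toricMap (congrFun h y).symm
  refine blowupMap_injOn hF realAnalytic (h2.trans h1.symm) ?_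
  rw [h2]
  obtain ⟨s, x, rfl⟩ := F.exists_blowupMk y
  rw [blowupMap_mk]
  intro h0
  obtain ⟨P, -, hP⟩ := (chartProj_eq_zero hF).1 h0
  exact F.mk_mem_torus_iff.1 hy P hP

end RegularFan

/-! ### Changes of coordinates -/

theorem IsLocalCoord.comp {E H Y V V' : Type*} [NormedAddCommGroup E] [NormedSpace ℝ E]
    [TopologicalSpace H] {I : ModelWithCorners ℝ E H} [TopologicalSpace Y] [ChartedSpace H Y]
    [NormedAddCommGroup V] [NormedSpace ℝ V] [NormedAddCommGroup V'] [NormedSpace ℝ V'] {C : Set V}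
    {U : Set Y} {u : Y → V} {g : V → Y} (h : IsLocalCoord I C U u g)
    (φ : OpenPartialHomeomorph V V') (hφ : ContDiffOn ℝ ω φ φ.source)
    (hφ' : ContDiffOn ℝ ω φ.symm φ.target) {C' : Set V'}
    (hC : ∀ v ∈ φ.source, v ∈ C ↔ φ v ∈ C') :
    IsLocalCoord I C' (U ∩ u ⁻¹' φ.source) (φ ∘ u) (g ∘ φ.symm) where
  isOpen := h.analytic.continuousOn.isOpen_inter_preimage h.isOpen φ.open_source
  analytic := hφ.contMDiffOn.comp (h.analytic.mono Set.inter_subset_left) fun y hy => hy.2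
  image := by
    obtain ⟨W, hW, hWU⟩ := h.image
    refine ⟨φ.target ∩ φ.symm ⁻¹' W, φ.isOpen_inter_preimage_symm hW, ?_⟩
    ext v
    constructor
    · rintro ⟨y, ⟨hy, hy'⟩, rfl⟩
      have : u y ∈ W ∩ C := hWU ▸ Set.mem_image_of_mem u hy
      refine ⟨⟨φ.map_source hy', ?_⟩, (hC _ hy').1 this.2⟩
      change φ.symm (φ (u y)) ∈ W
      rw [φ.left_inv hy']
      exact this.1
    · rintro ⟨⟨h1, h2⟩, h3⟩
      have h4 := φ.map_target h1
      have h5 : φ.symm v ∈ u '' U := by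
        rw [hWU]
        exact ⟨h2, (hC _ h4).2 (by rwa [φ.right_inv h1])⟩
      obtain ⟨y, hy, hyv⟩ := h5
      refine ⟨y, ⟨hy, ?_⟩, ?_⟩
      · rw [Set.mem_preimage, hyv]; exact h4
      · rw [Function.comp, hyv, φ.right_inv h1]
  left_inv y hy := by
    rw [Function.comp, Function.comp, φ.left_inv hy.2]
    exact h.left_inv y hy.1
  analytic_symm := by
    refine h.analytic_symm.comp (hφ'.contMDiffOn.mono ?_) ?_
    · rintro _ ⟨y, hy, rfl⟩
      exact φ.map_source hy.2
    · rintro _ ⟨y, hy, rfl⟩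
      refine ⟨y, hy.1, ?_⟩
      rw [Function.comp, φ.left_inv hy.2]

/-- An analytic map with invertible derivative is an analytic coordinate change on a neighbourhood
which may be chosen arbitrarily small. -/
theorem exists_analytic_homeomorph {V V' : Type*} [NormedAddCommGroup V] [NormedSpace ℝ V]
    [CompleteSpace V] [NormedAddCommGroup V'] [NormedSpace ℝ V'] {φ : V → V'} {a : V} {B : V ≃L[ℝ] V'}
    (hφ : ContDiffAt ℝ ω φ a) (hB : HasFDerivAt φ (B : V →L[ℝ] V') a) {O : Set V} (hO : O ∈ 𝓝 a) :
    ∃ e : OpenPartialHomeomorph V V', a ∈ e.source ∧ e.source ⊆ O ∧ (e : V → V') = φ ∧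
      ContDiffOn ℝ ω e e.source ∧ ContDiffOn ℝ ω e.symm e.target := by
  have hω : (ω : WithTop ℕ∞) ≠ 0 := by simp
  have hω' : (ω : WithTop ℕ∞) ≠ ((⊤ : ℕ∞) : WithTop ℕ∞) := by simp
  set e₀ := hφ.toOpenPartialHomeomorph φ hB hω with he₀
  have ha : a ∈ e₀.source := hφ.mem_toOpenPartialHomeomorph_source hB hω
  have hsymm : ContDiffAt ℝ ω e₀.symm (φ a) := hφ.to_localInverse hB hω
  have h1 : ∀ᶠ v in 𝓝 a, v ∈ O ∧ ContDiffAt ℝ ω φ v ∧ ContDiffAt ℝ ω e₀.symm (φ v) := by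
    filter_upwards [hO, hφ.eventually hω', hφ.continuousAt.eventually (hsymm.eventually hω')]
      with v h1 h2 h3 using ⟨h1, h2, h3⟩
  obtain ⟨N, hN, hNo, haN⟩ := mem_nhds_iff.1 h1
  refine ⟨e₀.restrOpen N hNo, ⟨ha, haN⟩, fun v hv => (hN hv.2).1, rfl, fun v hv =>
    (hN hv.2).2.1.contDiffWithinAt, fun v hv => ?_⟩
  have h2 := (e₀.restrOpen N hNo).map_target hv
  have h3 := (hN h2.2).2.2
  have h4 : φ ((e₀.restrOpen N hNo).symm v) = v := (e₀.restrOpen N hNo).right_inv hv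
  rw [h4] at h3
  exact h3.contDiffWithinAt

/-- Coordinates centered at a point can be translated to nearby points. -/
theorem IsCenteredCoord.recenter {n : ℕ} {Y : Type*} [TopologicalSpace Y]
    [ChartedSpace (EuclideanQuadrant (2 * n)) Y] {x : Y} {S : Set (Fin (2 * n))} {U : Set Y}
    {u : Y → Fin (2 * n) → ℝ} (h : IsCenteredCoord x S U u) {y : Y} (hy : y ∈ U) :
    ∃ U' ⊆ U, IsCenteredCoord y {i ∈ S | u y i = 0} U' (fun x => u x - u y) := by
  obtain ⟨-, -, g, hg⟩ := h
  have hO : {v : Fin (2 * n) → ℝ | ∀ i ∈ S, u y i ≠ 0 → 0 < v i} ∈ 𝓝 (u y) := by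
    refine Filter.eventually_all.2 fun i => ?_
    by_cases hi : i ∈ S ∧ u y i ≠ 0
    · have : 0 < u y i := lt_of_le_of_ne (hg.mem hy i hi.1) hi.2.symm
      have h2 : Continuous fun v : Fin (2 * n) → ℝ => v i := continuous_apply i
      exact (h2.continuousAt.eventually_const_lt this).mono fun v hv _ _ => hv
    · exact Filter.Eventually.of_forall fun v h1 h2 => absurd ⟨h1, h2⟩ hi
  obtain ⟨e, he1, he2, he3, he4, he5⟩ := exists_analytic_homeomorph (a := u y)
    (φ := fun v => v - u y) (B := ContinuousLinearEquiv.refl ℝ _)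
    (contDiffAt_id.sub contDiffAt_const) ((hasFDerivAt_id _).sub_const _) hO
  have hloc := hg.comp e he4 he5 (C' := {v | ∀ i ∈ {i ∈ S | u y i = 0}, 0 ≤ v i}) (by
    intro v hv
    rw [he3]
    constructor
    · rintro h i ⟨hi, hi'⟩
      have := h i hi
      change 0 ≤ v i - u y i
      rwa [hi', sub_zero]
    · intro h i hi
      by_cases hi' : u y i = 0
      · have : 0 ≤ v i - u y i := h i ⟨hi, hi'⟩
        rwa [hi', sub_zero] at this
      · exact (he2 hv i hi hi').le)
  rw [he3] at hloc
  exact ⟨U ∩ u ⁻¹' e.source, Set.inter_subset_left, ⟨hy, he1⟩, sub_self _, _, hloc⟩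

namespace RegularFan

variable {n : ℕ} {F : RegularFan n}

/-! ### The polar coordinates of the blowing up -/

variable (F) in
/-- The parametrization of a chart of the polar blowing up by `(r, θ)` for the strictly positive
vertices and a complex coordinate for the other ones. -/
abbrev polarMk (s : F.maxCones) : ParamSpace s.1 → F.PolarBlowup :=
  F.blowupParam polarPlane s fun _ => polarParam

theorem exists_polarMk (y : F.PolarBlowup) :
    ∃ s : F.maxCones, ∃ v ∈ coordRegion polarPlane s.1, F.polarMk s v = y := by
  obtain ⟨⟨s, p, hp⟩, a, ha, h⟩ := (F.isParamSystem polarAnalytic).cover y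
  obtain rfl : p = fun _ => polarParam := funext fun P => hp P
  exact ⟨s, a, ha, h⟩

theorem val_polarParam {a : ℝ × ℝ} (ha : 0 ≤ a.1) :
    polarPlane.val (polarParam a) = a.1 * Complex.exp (a.2 * Complex.I) := by
  change ((a.1.toNNReal : ℝ) : ℂ) * (Circle.exp a.2 : ℂ) = _
  rw [Real.coe_toNNReal _ ha, Circle.coe_exp]

theorem coord_polar_pos {s : Finset (Fin n → ℕ)} {v : ParamSpace s}
    (hv : v ∈ coordRegion polarPlane s) (P : PosIdx s) :
    (chartParam (M := polarPlane) (fun _ => polarParam) v).coord P.1 =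
      (v.1 P).1 * Complex.exp ((v.1 P).2 * Complex.I) :=
  (BlowupChart.coord_pos _ P).trans (val_polarParam (hv P))

theorem coord_polar_nonpos {s : Finset (Fin n → ℕ)} (v : ParamSpace s) (P : NonposIdx s) :
    (chartParam (M := polarPlane) (fun _ => polarParam) v).coord P.1 = v.2 P :=
  BlowupChart.coord_nonpos _ P

theorem polarMk_mem_divisor_iff {s : F.maxCones} {v : ParamSpace s.1}
    (hv : v ∈ coordRegion polarPlane s.1) {P : Fin n → ℕ} (hP : StrictlyPos P) :
    F.polarMk s v ∈ F.blowupDivisor polarPlane P ↔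
      ∃ h : P ∈ s.1, (v.1 ⟨⟨P, h⟩, hP⟩).1 = 0 := by
  refine (F.mk_mem_blowupDivisor_iff P s _).trans (exists_congr fun h => ?_)
  have : (chartParam (M := polarPlane) (fun _ => polarParam) v).coord ⟨P, h⟩ = _ :=
    coord_polar_pos hv ⟨⟨P, h⟩, hP⟩
  refine (Eq.congr_left this).trans ?_
  simp [Complex.exp_ne_zero]

/-- The number of the coordinate `r_P`. -/
def radIdx (s : F.maxCones) (P : PosIdx s.1) : Fin (2 * n) := F.coordNum s (Sum.inl (P, 0))

theorem radIdx_injective (s : F.maxCones) : Function.Injective (radIdx s) := by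
  intro P Q h
  have := (F.coordNum s).injective h
  simpa using this

/-- The real coordinates of a chart, numbered. -/
def numCoord (s : F.maxCones) : ParamSpace s.1 ≃L[ℝ] (Fin (2 * n) → ℝ) :=
  (realCoord s.1).trans (ContinuousLinearEquiv.piCongrLeft ℝ (fun _ => ℝ) (F.coordNum s))

theorem numCoord_radIdx {s : F.maxCones} (v : ParamSpace s.1) (P : PosIdx s.1) :
    numCoord s v (radIdx s P) = (v.1 P).1 := by
  change (Equiv.piCongrLeft (fun _ => ℝ) (F.coordNum s)) (realCoord s.1 v)
    (F.coordNum s (Sum.inl (P, 0))) = _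
  rw [Equiv.piCongrLeft_apply_apply]
  rfl

variable [ChartedSpace (EuclideanQuadrant (2 * n)) F.PolarBlowup]

/-- Every analytic map with invertible derivative that preserves the vanishing radial coordinates
yields coordinates centered at the given point. -/
theorem exists_centeredCoord {s : F.maxCones} {U : Set F.PolarBlowup}
    {u : F.PolarBlowup → ParamSpace s.1}
    (h : IsLocalCoord (cornerModel n) (coordRegion polarPlane s.1) U u (F.polarMk s))
    {x : F.PolarBlowup} (hx : x ∈ U) {φ : ParamSpace s.1 → Fin (2 * n) → ℝ}
    {B : ParamSpace s.1 ≃L[ℝ] (Fin (2 * n) → ℝ)} (hφ : ContDiffAt ℝ ω φ (u x))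
    (hB : HasFDerivAt φ (B : ParamSpace s.1 →L[ℝ] (Fin (2 * n) → ℝ)) (u x)) (h0 : φ (u x) = 0)
    (hr : ∀ P, ((u x).1 P).1 = 0 → ∀ v, φ v (radIdx s P) = (v.1 P).1)
    {O : Set (ParamSpace s.1)} (hO : O ∈ 𝓝 (u x)) :
    ∃ U' ⊆ U, IsCenteredCoord x (radIdx s '' {P | ((u x).1 P).1 = 0}) U' (φ ∘ u) ∧
      ∀ y ∈ U', u y ∈ O ∧ ∀ P, ((u x).1 P).1 ≠ 0 → ((u y).1 P).1 ≠ 0 := by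
  have hO' : {v : ParamSpace s.1 | ∀ P, ((u x).1 P).1 ≠ 0 → 0 < (v.1 P).1} ∈ 𝓝 (u x) := by
    refine Filter.eventually_all.2 fun P => ?_
    by_cases hP : ((u x).1 P).1 = 0
    · exact Filter.Eventually.of_forall fun v h => absurd hP h
    · have h1 : 0 < ((u x).1 P).1 := lt_of_le_of_ne (h.mem hx P) (Ne.symm hP)
      have h2 : Continuous fun v : ParamSpace s.1 => (v.1 P).1 := by fun_prop
      exact (h2.continuousAt.eventually_const_lt h1).mono fun v hv _ => hv
  obtain ⟨e, he1, he2, he3, he4, he5⟩ := exists_analytic_homeomorph hφ hB (Filter.inter_mem hO hO')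
  have hloc := h.comp e he4 he5
    (C' := {v | ∀ i ∈ radIdx s '' {P | ((u x).1 P).1 = 0}, 0 ≤ v i}) (by
    intro v hv
    rw [he3]
    constructor
    · rintro h _ ⟨P, hP, rfl⟩
      rw [hr P hP]
      exact h P
    · intro h P
      by_cases hP : ((u x).1 P).1 = 0
      · have := h _ ⟨P, hP, rfl⟩
        rwa [hr P hP] at this
      · exact ((he2 hv).2 P hP).le)
  rw [he3] at hloc
  exact ⟨U ∩ u ⁻¹' e.source, Set.inter_subset_left, ⟨⟨hx, he1⟩, h0, _, hloc⟩,
    fun y hy => ⟨(he2 hy.2).1, fun P hP => ((he2 hy.2).2 P hP).ne'⟩⟩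

variable (hI : F.IsBlowupStructure polarPlane (cornerModel n))
include hI

theorem exists_polarCoord (y : F.PolarBlowup) : ∃ (s : F.maxCones) (U : Set F.PolarBlowup)
    (u : F.PolarBlowup → ParamSpace s.1), y ∈ U ∧
      IsLocalCoord (cornerModel n) (coordRegion polarPlane s.1) U u (F.polarMk s) := by
  obtain ⟨s, p, U, u, hp, hy, h⟩ := exists_localCoord polarAnalytic hI y
  obtain rfl : p = fun _ => polarParam := funext fun P => hp P
  exact ⟨s, U, u, hy, h⟩

omit hI in
theorem _root_.MixedResolution.IsLocalCoord.mem_divisor_iff {s : F.maxCones}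
    {U : Set F.PolarBlowup} {u : F.PolarBlowup → ParamSpace s.1}
    (h : IsLocalCoord (cornerModel n) (coordRegion polarPlane s.1) U u (F.polarMk s))
    {y : F.PolarBlowup} (hy : y ∈ U) {P : Fin n → ℕ} (hP : StrictlyPos P) :
    y ∈ F.blowupDivisor polarPlane P ↔ ∃ h : P ∈ s.1, ((u y).1 ⟨⟨P, h⟩, hP⟩).1 = 0 := by
  rw [← polarMk_mem_divisor_iff (h.mem hy) hP, h.left_inv y hy]

/-- The divisors are smooth hypersurfaces in the boundary. -/
theorem smooth_blowupDivisor {P : Fin n → ℕ} (hP : StrictlyPos P) {x : F.PolarBlowup}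
    (hx : x ∈ F.blowupDivisor polarPlane P) :
    ∃ (S : Set (Fin (2 * n))) (U : Set F.PolarBlowup) (u : F.PolarBlowup → Fin (2 * n) → ℝ)
      (k : Fin (2 * n)), IsCenteredCoord x S U u ∧ k ∈ S ∧
        U ∩ F.blowupDivisor polarPlane P = {y | y ∈ U ∧ u y k = 0} := by
  obtain ⟨s, U, u, hxU, h⟩ := exists_polarCoord hI x
  obtain ⟨hPs, h0⟩ := (h.mem_divisor_iff hxU hP).1 hx
  obtain ⟨U', hU', hc, hO⟩ := exists_centeredCoord h hxU (φ := fun v => numCoord s v - numCoord s (u x))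
    (B := numCoord s) ((numCoord s).contDiff.contDiffAt.sub contDiffAt_const)
    ((numCoord s).hasFDerivAt.sub_const _) (sub_self _)
    (fun P hP v => by rw [Pi.sub_apply, numCoord_radIdx, numCoord_radIdx, hP, sub_zero])
    Filter.univ_mem
  refine ⟨_, U', _, radIdx s ⟨⟨P, hPs⟩, hP⟩, hc, ⟨_, h0, rfl⟩, ?_⟩
  ext y
  refine and_congr_right fun hy => ?_
  rw [h.mem_divisor_iff (hU' hy) hP]
  simp only [Function.comp, Pi.sub_apply, numCoord_radIdx, h0, sub_zero]
  exact ⟨fun ⟨_, h⟩ => h, fun h => ⟨hPs, h⟩⟩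

end RegularFan

/-! ### Irreducibility of the divisors -/

section AnalyticSubset

variable {E H Y : Type*} [NormedAddCommGroup E] [NormedSpace ℝ E] [TopologicalSpace H]
  {I : ModelWithCorners ℝ E H} [TopologicalSpace Y] [ChartedSpace H Y] {A B : Set Y}

theorem IsAnalyticSubset.inter (hA : IsAnalyticSubset I A) (hB : IsAnalyticSubset I B) :
    IsAnalyticSubset I (A ∩ B) := by
  refine ⟨hA.1.inter hB.1, fun x hx => ?_⟩
  obtain ⟨U, h, hU, hxU, hh, hUA⟩ := hA.2 x hx.1
  obtain ⟨U', h', hU', hxU', hh', hUB⟩ := hB.2 x hx.2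
  refine ⟨U ∩ U', fun y => h y ^ 2 + h' y ^ 2, hU.inter hU', ⟨hxU, hxU'⟩, ?_, ?_⟩
  · exact ((hh.mono Set.inter_subset_left).pow 2).add ((hh'.mono Set.inter_subset_right).pow 2)
  · ext y
    have h1 : y ∈ U → (y ∈ A ↔ h y = 0) := fun hy =>
      ⟨fun hA => (hUA ▸ (⟨hy, hA⟩ : y ∈ U ∩ A) : y ∈ {y | y ∈ U ∧ h y = 0}).2,
        fun h0 => (hUA ▸ (⟨hy, h0⟩ : y ∈ {y | y ∈ U ∧ h y = 0}) : y ∈ U ∩ A).2⟩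
    have h2 : y ∈ U' → (y ∈ B ↔ h' y = 0) := fun hy =>
      ⟨fun hB => (hUB ▸ (⟨hy, hB⟩ : y ∈ U' ∩ B) : y ∈ {y | y ∈ U' ∧ h' y = 0}).2,
        fun h0 => (hUB ▸ (⟨hy, h0⟩ : y ∈ {y | y ∈ U' ∧ h' y = 0}) : y ∈ U' ∩ B).2⟩
    refine and_congr_right fun hy => ?_
    rw [Set.mem_inter_iff, h1 hy.1, h2 hy.2]
    constructor
    · rintro ⟨h1, h2⟩
      simp [h1, h2]
    · intro h0
      constructor <;> nlinarith [sq_nonneg (h y), sq_nonneg (h' y)]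

theorem IsAnalyticSubset.union (hA : IsAnalyticSubset I A) (hB : IsAnalyticSubset I B) :
    IsAnalyticSubset I (A ∪ B) := by
  have key : ∀ {A B : Set Y}, IsAnalyticSubset I A → IsAnalyticSubset I B → ∀ x ∈ A,
      ∃ (U : Set Y) (h : Y → ℝ), IsOpen U ∧ x ∈ U ∧ ContMDiffOn I 𝓘(ℝ, ℝ) ω h U ∧
        U ∩ (A ∪ B) = {y | y ∈ U ∧ h y = 0} := by
    intro A B hA hB x hx
    obtain ⟨U, h, hU, hxU, hh, hUA⟩ := hA.2 x hx
    by_cases hxB : x ∈ B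
    · obtain ⟨U', h', hU', hxU', hh', hUB⟩ := hB.2 x hxB
      refine ⟨U ∩ U', fun y => h y * h' y, hU.inter hU', ⟨hxU, hxU'⟩, ?_, ?_⟩
      · exact (hh.mono Set.inter_subset_left).mul (hh'.mono Set.inter_subset_right)
      · ext y
        have h1 := Set.ext_iff.1 hUA y
        have h2 := Set.ext_iff.1 hUB y
        simp only [Set.mem_inter_iff, Set.mem_union, Set.mem_ofPred_eq, mul_eq_zero] at h1 h2 ⊢
        tauto
    · refine ⟨U ∩ Bᶜ, h, hU.inter hB.1.isOpen_compl, ⟨hxU, hxB⟩, hh.mono Set.inter_subset_left, ?_⟩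
      ext y
      have h1 := Set.ext_iff.1 hUA y
      simp only [Set.mem_inter_iff, Set.mem_union, Set.mem_ofPred_eq, Set.mem_compl_iff] at h1 ⊢
      tauto
  refine ⟨hA.1.union hB.1, fun x hx => ?_⟩
  rcases hx with hx | hx
  · exact key hA hB x hx
  · rw [Set.union_comm]
    exact key hB hA x hx

theorem isAnalyticSubset_empty : IsAnalyticSubset I (∅ : Set Y) := ⟨isClosed_empty, by simp⟩

theorem isAnalyticSubset_biUnion {ι : Type*} {D : ι → Set Y}
    (hD : ∀ i, IsAnalyticSubset I (D i)) (T : Finset ι) : IsAnalyticSubset I (⋃ i ∈ T, D i) := by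
  classical
  induction T using Finset.induction_on with
  | empty => simpa using isAnalyticSubset_empty
  | insert i T _ ih =>
    rw [Finset.set_biUnion_insert]
    exact (hD i).union ih

/-- An irreducible analytic subset of a finite union of analytic subsets lies in one of them. -/
theorem IsIrreducibleAnalytic.exists_subset (hA : IsIrreducibleAnalytic I A) {ι : Type*}
    {D : ι → Set Y} (hD : ∀ i, IsAnalyticSubset I (D i)) (T : Finset ι) (h : A ⊆ ⋃ i ∈ T, D i) :
    ∃ i ∈ T, A ⊆ D i := by
  classical
  induction T using Finset.induction_on with
  | empty =>
    obtain ⟨x, hx⟩ := hA.2.1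
    simpa using h hx
  | insert i T _ ih =>
    rw [Finset.set_biUnion_insert] at h
    have h1 : A = A ∩ D i ∪ A ∩ ⋃ i ∈ T, D i := by
      rw [← Set.inter_union_distrib_left]
      exact (Set.inter_eq_left.2 h).symm
    rcases hA.2.2 _ _ (hA.1.inter (hD i)) (hA.1.inter (isAnalyticSubset_biUnion hD T)) h1 with h2 | h2
    · exact ⟨i, Finset.mem_insert_self _ _, Set.inter_eq_left.1 h2.symm⟩
    · obtain ⟨j, hj, h3⟩ := ih (Set.inter_eq_left.1 h2.symm)
      exact ⟨j, Finset.mem_insert_of_mem hj, h3⟩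

/-- If irreducible sets, none contained in another one, cover `S`, they are the irreducible
components of `S`. -/
theorem isIrredComponent_iff {ι : Type*} [Fintype ι] {D : ι → Set Y} {S : Set Y}
    (hD : ∀ i, IsIrreducibleAnalytic I (D i)) (hS : S = ⋃ i, D i)
    (hinj : ∀ i j, D i ⊆ D j → i = j) (A : Set Y) : (∃ i, D i = A) ↔ IsIrredComponent I A S := by
  have hsub : ∀ B, IsIrreducibleAnalytic I B → B ⊆ S → ∃ i, B ⊆ D i := by
    intro B hB hBS
    obtain ⟨i, -, hi⟩ := hB.exists_subset (fun i => (hD i).1) Finset.univ (by simpa [← hS] using hBS)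
    exact ⟨i, hi⟩
  have hDS : ∀ i, D i ⊆ S := fun i => hS ▸ Set.subset_iUnion D i
  constructor
  · rintro ⟨i, rfl⟩
    refine ⟨⟨hD i, hDS i⟩, fun B hB hiB => ?_⟩
    obtain ⟨j, hj⟩ := hsub B hB.1 hB.2
    obtain rfl := hinj i j (hiB.trans hj)
    exact hj
  · intro hA
    obtain ⟨i, hi⟩ := hsub A hA.prop.1 hA.prop.2
    exact ⟨i, (hA.2 ⟨hD i, hDS i⟩ hi).antisymm hi⟩

/-- An analytic subset `D` is irreducible if it is connected and if an analytic subset that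
contains a relatively open part of `D` arbitrarily close to a point contains all of `D` near it. -/
theorem isIrreducibleAnalytic_of_preconnected {D : Set Y} (hD : IsAnalyticSubset I D)
    (hne : D.Nonempty) (hc : IsPreconnected D)
    (hid : ∀ B, IsAnalyticSubset I B → ∀ x ∈ D,
      (∃ᶠ y in 𝓝 x, y ∈ D ∧ ∀ᶠ z in 𝓝 y, z ∈ D → z ∈ B) → ∀ᶠ z in 𝓝 x, z ∈ D → z ∈ B) :
    IsIrreducibleAnalytic I D := by
  refine ⟨hD, hne, fun B C hB hC h => ?_⟩
  by_cases hDC : D ⊆ C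
  · exact Or.inr (hDC.antisymm (h ▸ Set.subset_union_right))
  left
  refine Set.Subset.antisymm ?_ (h ▸ Set.subset_union_left)
  obtain ⟨x, hxD, hxC⟩ := Set.not_subset.1 hDC
  -- `D` is contained in `B` near the points of `T`, and the rest of `D` is open in `D` by `hid`
  set T : Set Y := {x | ∀ᶠ z in 𝓝 x, z ∈ D → z ∈ B} with hT
  set T' : Set Y := {x | ∀ᶠ y in 𝓝 x, y ∈ D → y ∉ T} with hT'
  have hxT : x ∈ T := by
    filter_upwards [hC.1.isOpen_compl.mem_nhds hxC] with z hz hzD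
    rw [h] at hzD
    exact hzD.resolve_right hz
  have hTo : IsOpen T := isOpen_setOfPred_eventually_nhds
  have hTo' : IsOpen T' := isOpen_setOfPred_eventually_nhds
  have hcov : D ⊆ T ∪ T' := by
    intro y hy
    by_contra hcon
    simp only [Set.mem_union, not_or] at hcon
    refine hcon.1 (hid B hB y hy ?_)
    have := Filter.not_eventually.1 hcon.2
    refine this.mono fun z hz => ?_
    push Not at hz
    exact hz
  have hDT : D ⊆ T := by
    intro y hy
    by_contra hyT
    obtain ⟨z, hz, hz1, hz2⟩ := hc T T' hTo hTo' hcov ⟨x, hxD, hxT⟩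
      ⟨y, hy, (hcov hy).resolve_left hyT⟩
    exact (show ∀ᶠ y in 𝓝 z, y ∈ D → y ∉ T from hz2).self_of_nhds hz hz1
  exact fun y hy => (show ∀ᶠ z in 𝓝 y, z ∈ D → z ∈ B from hDT hy).self_of_nhds hy

end AnalyticSubset

namespace RegularFan

variable {n : ℕ} {F : RegularFan n}

/-! ### The divisors of the polar blowing up -/

theorem blowupMap_polarMk_eq_zero_iff (hF : F.IsGood) {s : F.maxCones} {v : ParamSpace s.1}
    (hv : v ∈ coordRegion polarPlane s.1) :
    F.blowupMap polarPlane (F.polarMk s v) = 0 ↔ ∃ P, (v.1 P).1 = 0 := by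
  rw [blowupMap_eq_zero_iff hF]
  constructor
  · rintro ⟨P, hP, h⟩
    obtain ⟨hs, h0⟩ := (polarMk_mem_divisor_iff hv (mem_posVertices_iff.1 hP).2).1 h
    exact ⟨_, h0⟩
  · rintro ⟨P, hP⟩
    exact ⟨P.1.1, mem_posVertices_iff.2 ⟨⟨s, P.1.2⟩, P.2⟩,
      (polarMk_mem_divisor_iff hv P.2).2 ⟨P.1.2, hP⟩⟩

theorem isClosed_blowupDivisor {M : PlaneModification} (hM : M.IsAnalytic) (P : Fin n → ℕ) :
    IsClosed (F.blowupDivisor M P) := by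
  have hq : Topology.IsQuotientMap (Quot.mk (F.blowupRel M)) := isQuotientMap_quot_mk
  refine hq.isClosed_preimage.1 (isClosed_sigma_iff.2 fun s => ?_)
  by_cases hP : P ∈ s.1
  · have h1 : IsClosed {x : BlowupChart M s.1 | x.coord ⟨P, hP⟩ = 0} :=
      isClosed_eq (BlowupChart.continuous_coord hM _) continuous_const
    refine (congrArg IsClosed (Set.ext fun x => ?_)).mpr h1
    exact (F.mk_mem_blowupDivisor_iff P s x).trans ⟨fun ⟨_, h⟩ => h, fun h => ⟨hP, h⟩⟩
  · refine (congrArg IsClosed (Set.ext fun x => ?_)).mpr isClosed_empty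
    exact (F.mk_mem_blowupDivisor_iff P s x).trans ⟨fun ⟨h, _⟩ => absurd h hP, False.elim⟩

open Classical in
/-- Coordinates of a point that lies on the divisor of `P` and on no other one. -/
def genericCoord (s : Finset (Fin n → ℕ)) (P : Fin n → ℕ) : ParamSpace s :=
  (fun Q => (if Q.1.1 = P then 0 else 1, 0), fun _ => 1)

theorem genericCoord_mem (s : Finset (Fin n → ℕ)) (P : Fin n → ℕ) :
    genericCoord s P ∈ coordRegion polarPlane s := by
  intro Q
  change (0 : ℝ) ≤ if Q.1.1 = P then 0 else 1
  split_ifs <;> norm_num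

theorem coord_genericCoord {s : Finset (Fin n → ℕ)} {P : Fin n → ℕ} (hP : StrictlyPos P) (Q : s) :
    (chartParam (M := polarPlane) (fun _ => polarParam) (genericCoord s P)).coord Q =
      if Q.1 = P then 0 else 1 := by
  by_cases hQ : StrictlyPos Q.1
  · rw [coord_polar_pos (genericCoord_mem s P) ⟨Q, hQ⟩]
    by_cases h : Q.1 = P <;> simp [genericCoord, h]
  · rw [coord_polar_nonpos _ ⟨Q, hQ⟩, if_neg]
    · rfl
    · rintro rfl
      exact hQ hP

theorem dir_genericCoord {s : Finset (Fin n → ℕ)} {P : Fin n → ℕ} (Q : s) :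
    (chartParam (M := polarPlane) (fun _ => polarParam) (genericCoord s P)).dir Q = 1 := by
  by_cases hQ : StrictlyPos Q.1
  · refine (BlowupChart.dir_pos _ ⟨Q, hQ⟩).trans ?_
    exact Circle.exp_zero
  · refine (dif_neg hQ).trans ?_
    change Circle.exp (Complex.arg 1) = 1
    rw [Complex.arg_one, Circle.exp_zero]

theorem polarMk_genericCoord_eq {s t : F.maxCones} {P : Fin n → ℕ} (hP : StrictlyPos P)
    (hs : P ∈ s.1) (ht : P ∈ t.1) :
    F.polarMk s (genericCoord s.1 P) = F.polarMk t (genericCoord t.1 P) := by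
  have h : ∀ Q : s.1, Q.1 ∉ t.1 →
      (chartParam (M := polarPlane) (fun _ => polarParam) (genericCoord s.1 P)).coord Q ≠ 0 := by
    intro Q hQ
    rw [coord_genericCoord hP, if_neg]
    · exact one_ne_zero
    · rintro rfl
      exact hQ ht
  refine (F.blowupMk_eq_iff polarAnalytic).2 ⟨h, ?_⟩
  refine BlowupChart.ext polarAnalytic (fun Q => ?_) fun Q hQ => ?_
  · refine Eq.trans ?_ (F.coord_trans polarAnalytic h Q).symm
    refine (coord_genericCoord hP Q).trans ?_
    simp only [coord_genericCoord hP]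
    rw [Finset.prod_eq_single ⟨P, hs⟩]
    · rw [F.transMat_of_mem _ ht]
      by_cases hQP : Q.1 = P
      · simp [hQP]
      · simp [hQP, Ne.symm hQP]
    · intro R _ hR
      rw [if_neg fun h => hR (Subtype.ext h), one_zpow]
    · simp
  · refine (dir_genericCoord Q).trans (Eq.trans ?_ (F.dir_trans polarAnalytic h Q (Or.inl hQ)).symm)
    symm
    refine Finset.prod_eq_one fun R _ => ?_
    exact (congrArg (· ^ _) (dir_genericCoord R)).trans (one_zpow _)

theorem polarMk_genericCoord_mem_iff {s : F.maxCones} {P Q : Fin n → ℕ} (hP : StrictlyPos P)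
    (hs : P ∈ s.1) : F.polarMk s (genericCoord s.1 P) ∈ F.blowupDivisor polarPlane Q ↔ Q = P := by
  refine (F.mk_mem_blowupDivisor_iff Q s _).trans ?_
  constructor
  · rintro ⟨hQ, h⟩
    have := (coord_genericCoord hP ⟨Q, hQ⟩).symm.trans h
    by_contra hne
    rw [if_neg hne] at this
    exact one_ne_zero this
  · rintro rfl
    exact ⟨hs, (coord_genericCoord hP ⟨Q, hs⟩).trans (if_pos rfl)⟩

theorem blowupDivisor_subset_iff {P Q : Fin n → ℕ} (hP : P ∈ F.posVertices) :
    F.blowupDivisor polarPlane P ⊆ F.blowupDivisor polarPlane Q ↔ P = Q := by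
  obtain ⟨⟨s, hs⟩, hpos⟩ := mem_posVertices_iff.1 hP
  constructor
  · intro h
    exact ((polarMk_genericCoord_mem_iff hpos hs).1
      (h ((polarMk_genericCoord_mem_iff hpos hs).2 rfl))).symm
  · rintro rfl
    exact subset_rfl

theorem nonempty_blowupDivisor {P : Fin n → ℕ} (hP : P ∈ F.posVertices) :
    (F.blowupDivisor polarPlane P).Nonempty := by
  obtain ⟨⟨s, hs⟩, hpos⟩ := mem_posVertices_iff.1 hP
  exact ⟨_, (polarMk_genericCoord_mem_iff hpos hs).2 rfl⟩

theorem continuous_polarMk (s : F.maxCones) : Continuous (F.polarMk s) := by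
  refine (F.continuous_blowupMk s).comp ?_
  refine Continuous.prodMk (continuous_pi fun P => ?_) continuous_snd
  have h1 : Continuous fun a : ℝ × ℝ => (a.1.toNNReal, Circle.exp a.2) :=
    (continuous_real_toNNReal.comp continuous_fst).prodMk (Circle.exp.continuous.comp continuous_snd)
  exact h1.comp ((continuous_apply P).comp continuous_fst)

/-- The divisors are connected: the parts in the charts are images of convex sets and have a
common point. -/
theorem isPreconnected_blowupDivisor {P : Fin n → ℕ} (hP : StrictlyPos P) :
    IsPreconnected (F.blowupDivisor polarPlane P) := by
  set T : {s : F.maxCones // P ∈ s.1} → Set F.PolarBlowup := fun s =>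
    F.polarMk s.1 '' {v | v ∈ coordRegion polarPlane s.1.1 ∧ (v.1 ⟨⟨P, s.2⟩, hP⟩).1 = 0} with hT
  have h1 : F.blowupDivisor polarPlane P = ⋃ s, T s := by
    ext y
    rw [Set.mem_iUnion]
    constructor
    · intro hy
      obtain ⟨s, v, hv, rfl⟩ := exists_polarMk y
      obtain ⟨hs, h0⟩ := (polarMk_mem_divisor_iff hv hP).1 hy
      exact ⟨⟨s, hs⟩, v, ⟨hv, h0⟩, rfl⟩
    · rintro ⟨⟨s, hs⟩, v, ⟨hv, h0⟩, rfl⟩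
      exact (polarMk_mem_divisor_iff hv hP).2 ⟨hs, h0⟩
  rw [h1]
  rcases isEmpty_or_nonempty {s : F.maxCones // P ∈ s.1} with he | ⟨⟨s₀⟩⟩
  · rw [Set.iUnion_of_empty]
    exact isPreconnected_empty
  refine isPreconnected_iUnion ⟨F.polarMk s₀.1 (genericCoord s₀.1.1 P), Set.mem_iInter.2 fun s => ?_⟩
    fun s => ?_
  · refine ⟨genericCoord s.1.1 P, ⟨genericCoord_mem _ _, ?_⟩, polarMk_genericCoord_eq hP s.2 s₀.2⟩
    exact if_pos rfl
  · refine IsPreconnected.image ?_ _ (continuous_polarMk s.1).continuousOn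
    refine Convex.isPreconnected ?_
    rintro v ⟨hv, hv0⟩ w ⟨hw, hw0⟩ a b ha hb hab
    refine ⟨fun Q => ?_, ?_⟩
    · exact add_nonneg (mul_nonneg ha (hv Q)) (mul_nonneg hb (hw Q))
    · change a * (v.1 _).1 + b * (w.1 _).1 = 0
      rw [hv0, hw0, mul_zero, mul_zero, add_zero]

/-- A point of the coordinate region is a limit of points where a given set of radial coordinates
has become positive and the other coordinates are unchanged. -/
theorem frequently_radius_pos {s : Finset (Fin n → ℕ)} (v : ParamSpace s) (J : Set (PosIdx s)) :
    ∃ᶠ w in 𝓝 v, (∀ P ∈ J, (v.1 P).1 < (w.1 P).1) ∧ (∀ P ∉ J, (w.1 P).1 = (v.1 P).1) ∧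
      (∀ P, (w.1 P).2 = (v.1 P).2) ∧ w.2 = v.2 := by
  classical
  set e : ParamSpace s := (fun P => (if P ∈ J then 1 else 0, 0), 0) with he
  have h1 : Filter.Tendsto (fun t : ℝ => v + t • e) (𝓝[>] 0) (𝓝 v) := by
    have : Continuous fun t : ℝ => v + t • e := by fun_prop
    have h := this.tendsto 0
    simp only [zero_smul, add_zero] at h
    exact h.mono_left nhdsWithin_le_nhds
  refine h1.frequently (Filter.Eventually.frequently ?_)
  filter_upwards [self_mem_nhdsWithin] with t ht
  have ht' : 0 < t := ht
  refine ⟨fun P hP => ?_, fun P hP => ?_, fun P => ?_, ?_⟩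
  · simp [he, hP, ht']
  · simp [he, hP]
  · simp [he]
  · simp [he]

/-- The projection to the hyperplane `r_P = 0`. -/
def dropRadius {s : Finset (Fin n → ℕ)} (P : PosIdx s) : ParamSpace s →L[ℝ] ParamSpace s :=
  LinearMap.toContinuousLinearMap
    { toFun := fun v => (Function.update v.1 P (0, (v.1 P).2), v.2)
      map_add' := by
        intro v w
        refine Prod.ext (funext fun Q => ?_) rfl
        by_cases h : Q = P
        · subst h; simp
        · simp [Function.update_of_ne h]
      map_smul' := by
        intro c v
        refine Prod.ext (funext fun Q => ?_) rfl
        by_cases h : Q = P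
        · subst h; simp
        · simp [Function.update_of_ne h] }

theorem dropRadius_apply {s : Finset (Fin n → ℕ)} (P : PosIdx s) (v : ParamSpace s) :
    dropRadius P v = (Function.update v.1 P (0, (v.1 P).2), v.2) := rfl

theorem dropRadius_eq_self {s : Finset (Fin n → ℕ)} {P : PosIdx s} {v : ParamSpace s}
    (h : (v.1 P).1 = 0) : dropRadius P v = v := by
  rw [dropRadius_apply]
  refine Prod.ext ?_ rfl
  have : (0, (v.1 P).2) = v.1 P := Prod.ext h.symm rfl
  simp only [this, Function.update_eq_self]

theorem dropRadius_mem {s : Finset (Fin n → ℕ)} {P : PosIdx s} {v : ParamSpace s}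
    (h : v ∈ coordRegion polarPlane s) : dropRadius P v ∈ coordRegion polarPlane s := by
  intro Q
  change 0 ≤ ((Function.update v.1 P (0, (v.1 P).2)) Q).1
  by_cases hQ : Q = P
  · subst hQ; simp
  · rw [Function.update_of_ne hQ]; exact h Q

variable [ChartedSpace (EuclideanQuadrant (2 * n)) F.PolarBlowup]
  (hI : F.IsBlowupStructure polarPlane (cornerModel n))
include hI

theorem isAnalyticSubset_blowupDivisor {P : Fin n → ℕ} (hP : StrictlyPos P) :
    IsAnalyticSubset (cornerModel n) (F.blowupDivisor polarPlane P) := by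
  refine ⟨isClosed_blowupDivisor polarAnalytic P, fun x hx => ?_⟩
  obtain ⟨S, U, u, k, ⟨hxU, -, g, hg⟩, -, h⟩ := smooth_blowupDivisor hI hP hx
  exact ⟨U, fun y => u y k, hg.isOpen, hxU, contMDiffOn_pi_space.1 hg.analytic k, h⟩

/-- The divisors are irreducible, by the identity theorem on the slices `r_P = 0`. -/
theorem isIrreducibleAnalytic_blowupDivisor {P : Fin n → ℕ} (hP : P ∈ F.posVertices) :
    IsIrreducibleAnalytic (cornerModel n) (F.blowupDivisor polarPlane P) := by
  have hpos := (mem_posVertices_iff.1 hP).2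
  refine isIrreducibleAnalytic_of_preconnected (isAnalyticSubset_blowupDivisor hI hpos)
    (nonempty_blowupDivisor hP) (isPreconnected_blowupDivisor hpos) fun B hB x hx hfreq => ?_
  have hxB : x ∈ B := by
    rw [← hB.1.closure_eq]
    exact mem_closure_iff_frequently.2 (hfreq.mono fun y hy => hy.2.self_of_nhds hy.1)
  obtain ⟨U₀, h₀, hU₀, hxU₀, hh₀, hUB⟩ := hB.2 x hxB
  have hmemB : ∀ y ∈ U₀, y ∈ B ↔ h₀ y = 0 := by
    intro y hy
    have := Set.ext_iff.1 hUB y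
    simp only [Set.mem_inter_iff, Set.mem_ofPred_eq] at this
    tauto
  obtain ⟨s, U, u, hxU, h⟩ := exists_polarCoord hI x
  obtain ⟨hPs, h0⟩ := (h.mem_divisor_iff hxU hpos).1 hx
  set p : PosIdx s.1 := ⟨⟨P, hPs⟩, hpos⟩ with hp
  set C := coordRegion polarPlane s.1 with hC
  have hmemD : ∀ v ∈ C, (v.1 p).1 = 0 → F.polarMk s v ∈ F.blowupDivisor polarPlane P :=
    fun v hv hv0 => (polarMk_mem_divisor_iff hv hpos).2 ⟨hPs, hv0⟩
  have hmk : F.polarMk s (u x) = x := h.left_inv x hxU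
  -- the equation of `B` in the coordinates extends to an analytic function `K` on a ball
  have h1 : ContDiffWithinAt ℝ ω (fun v => h₀ (F.polarMk s v)) C (u x) := by
    rw [← contMDiffWithinAt_iff_contDiffWithinAt]
    have h2 : ContMDiffAt (cornerModel n) 𝓘(ℝ, ℝ) ω h₀ (F.polarMk s (u x)) := by
      rw [hmk]
      exact (hh₀ x hxU₀).contMDiffAt (hU₀.mem_nhds hxU₀)
    exact h2.comp_contMDiffWithinAt (u x) (h.contMDiffWithinAt_symm hxU)
  obtain ⟨K, hK1, hK2⟩ := analyticWithinAt_iff_exists_analyticAt.1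
    (contDiffWithinAt_omega_iff_analyticWithinAt.1 h1)
  rw [Set.insert_eq_of_mem (h.mem hxU)] at hK1
  have hev : ∀ᶠ v in 𝓝 (u x), AnalyticAt ℝ K v ∧ (v ∈ C → h₀ (F.polarMk s v) = K v) ∧
      F.polarMk s v ∈ U₀ := by
    refine hK2.eventually_analyticAt.and ((eventually_nhdsWithin_iff.1 hK1).and ?_)
    refine (continuous_polarMk s).continuousAt.eventually_mem ?_
    rw [hmk]
    exact hU₀.mem_nhds hxU₀
  obtain ⟨ε, hε, hball⟩ := Metric.eventually_nhds_iff_ball.1 hev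
  set q := dropRadius p with hq
  set N : Set (ParamSpace s.1) := q ⁻¹' Metric.ball (u x) ε with hN
  have hNo : IsOpen N := Metric.isOpen_ball.preimage q.continuous
  have hNc : IsPreconnected N :=
    ((convex_ball (u x) ε).linear_preimage (q : ParamSpace s.1 →ₗ[ℝ] ParamSpace s.1)).isPreconnected
  have hKq : AnalyticOnNhd ℝ (fun v => K (q v)) N := fun v hv =>
    AnalyticAt.comp (g := K) (hball _ hv).1 (q.analyticAt v)
  have hux : Metric.ball (u x) ε ∈ 𝓝 (u x) := Metric.ball_mem_nhds _ hε
  have hucont := (h.contMDiffAt hxU).continuousAt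
  have hUx : ∀ᶠ y in 𝓝 x, y ∈ U ∧ u y ∈ Metric.ball (u x) ε :=
    Filter.Eventually.and (h.isOpen.mem_nhds hxU) (hucont.eventually_mem hux)
  have hrad : ∀ y ∈ U, y ∈ F.blowupDivisor polarPlane P → ((u y).1 p).1 = 0 := by
    intro y hy hyD
    obtain ⟨_, h0⟩ := (h.mem_divisor_iff hy hpos).1 hyD
    exact h0
  obtain ⟨y, ⟨hyD, hyB⟩, hyU, hyball⟩ := (hfreq.and_eventually hUx).exists
  have hqy : q (u y) = u y := dropRadius_eq_self (hrad y hyU hyD)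
  have hgood : ∀ᶠ v in 𝓝 (u y), q v ∈ Metric.ball (u x) ε ∧
      (F.polarMk s (q v) ∈ F.blowupDivisor polarPlane P → F.polarMk s (q v) ∈ B) := by
    refine Filter.Eventually.and ?_ ?_
    · refine q.continuous.continuousAt.eventually_mem (Metric.isOpen_ball.mem_nhds ?_)
      rwa [hqy]
    · have h2 : Filter.Tendsto (fun v => F.polarMk s (q v)) (𝓝 (u y)) (𝓝 y) := by
        have := ((continuous_polarMk s).comp q.continuous).tendsto (u y)
        rwa [Function.comp_apply, hqy, h.left_inv y hyU] at this
      exact h2.eventually hyB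
  -- a point with positive radii, near which `K ∘ q` vanishes identically
  obtain ⟨w, ⟨hw, -⟩, hwgood⟩ := ((frequently_radius_pos (u y) Set.univ).and_eventually
    hgood.eventually_nhds).exists
  have hwpos : ∀ᶠ v in 𝓝 w, v ∈ C := by
    refine Filter.eventually_all.2 fun Q => ?_
    have h2 : Continuous fun v : ParamSpace s.1 => (v.1 Q).1 := by fun_prop
    exact (h2.continuousAt.eventually_const_lt ((h.mem hyU Q).trans_lt (hw Q trivial))).mono
      fun v hv => hv.le
  have hzero : (fun v => K (q v)) =ᶠ[𝓝 w] 0 := by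
    filter_upwards [hwgood, hwpos] with v hv hvC
    have hqC : q v ∈ C := dropRadius_mem hvC
    obtain ⟨-, h3, h4⟩ := hball _ hv.1
    rw [← h3 hqC]
    refine (hmemB _ h4).1 (hv.2 (hmemD _ hqC ?_))
    change ((Function.update v.1 p (0, (v.1 p).2)) p).1 = 0
    rw [Function.update_self]
  have hEq := hKq.eqOn_zero_of_preconnected_of_eventuallyEq_zero hNc hwgood.self_of_nhds.1 hzero
  filter_upwards [hUx] with z hz hzD
  have hqz : q (u z) = u z := dropRadius_eq_self (hrad z hz.1 hzD)
  have h3 : K (u z) = 0 := by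
    have h4 : K (q (u z)) = 0 := hEq (show u z ∈ N by rw [hN, Set.mem_preimage, hqz]; exact hz.2)
    rwa [hqz] at h4
  obtain ⟨-, h4, h5⟩ := hball _ hz.2
  rw [← h4 (h.mem hz.1), h.left_inv z hz.1] at h3
  rw [h.left_inv z hz.1] at h5
  exact (hmemB z h5).2 h3

end RegularFan

/-! ### Convergent power series in several variables -/

/-- The monomial with exponents `e`, as a multilinear map evaluated on the diagonal. -/
theorem exists_multilinear_monomial {ι : Type*} [Fintype ι] (e : ι → ℕ) (m : ℕ)
    (he : ∑ i, e i = m) : ∃ L : ContinuousMultilinearMap ℂ (fun _ : Fin m => ι → ℂ) ℂ,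
      ‖L‖ ≤ 1 ∧ ∀ Z : ι → ℂ, (L fun _ => Z) = ∏ i, Z i ^ e i := by
  have hcard : Fintype.card (Σ i, Fin (e i)) = m := by simp [he]
  set φ : Fin m → ι := fun k => ((Fintype.equivFinOfCardEq hcard).symm k).1 with hφ
  refine ⟨(ContinuousMultilinearMap.mkPiAlgebra ℂ (Fin m) ℂ).compContinuousLinearMap
    fun k => ContinuousLinearMap.proj (φ k), ?_, fun Z => ?_⟩
  · refine ContinuousMultilinearMap.opNorm_le_bound zero_le_one fun v => ?_
    rw [one_mul]
    simp only [ContinuousMultilinearMap.compContinuousLinearMap_apply,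
      ContinuousMultilinearMap.mkPiAlgebra_apply, ContinuousLinearMap.proj_apply, norm_prod]
    exact Finset.prod_le_prod (fun _ _ => norm_nonneg _) fun k _ => norm_le_pi_norm (v k) (φ k)
  · simp only [ContinuousMultilinearMap.compContinuousLinearMap_apply,
      ContinuousMultilinearMap.mkPiAlgebra_apply, ContinuousLinearMap.proj_apply, hφ]
    rw [Fintype.prod_equiv (Fintype.equivFinOfCardEq hcard).symm _
      (fun x : Σ i, Fin (e i) => Z x.1) fun k => rfl, Fintype.prod_sigma]
    simp

/-- An absolutely convergent power series in several variables is analytic at the origin. -/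
theorem analyticAt_tsum_monomial {ι : Type*} [Fintype ι] {c : (ι → ℕ) → ℂ} {ρ : ℝ} (hρ : 0 < ρ)
    (hc : Summable fun e => ‖c e‖ * ρ ^ ∑ i, e i) :
    AnalyticAt ℂ (fun Z : ι → ℂ => ∑' e, c e * ∏ i, Z i ^ e i) 0 := by
  classical
  set deg : (ι → ℕ) → ℕ := fun e => ∑ i, e i with hdeg
  have hcast : ∀ m (e : {e // deg e = m}), ∃ L : ContinuousMultilinearMap ℂ
      (fun _ : Fin m => ι → ℂ) ℂ, ‖L‖ ≤ 1 ∧ ∀ Z : ι → ℂ, (L fun _ => Z) = ∏ i, Z i ^ e.1 i :=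
    fun m e => exists_multilinear_monomial e.1 m e.2
  choose L hL hL' using hcast
  have hfin : ∀ m, Finite {e // deg e = m} := by
    intro m
    refine Set.Finite.to_subtype (s := {e | deg e = m}) ?_
    refine (Set.Finite.pi' (t := fun _ : ι => Set.Iic m) fun _ => Set.finite_Iic m).subset ?_
    rintro e rfl i
    exact Finset.single_le_sum (f := e) (fun _ _ => Nat.zero_le _) (Finset.mem_univ i)
  have := fun m => Fintype.ofFinite {e // deg e = m}
  set p : FormalMultilinearSeries ℂ (ι → ℂ) ℂ := fun m => ∑ e : {e // deg e = m}, c e.1 • L m e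
  have hp : ∀ m, ‖p m‖ ≤ ∑ e : {e // deg e = m}, ‖c e.1‖ := by
    intro m
    refine (norm_sum_le _ _).trans (Finset.sum_le_sum fun e _ => ?_)
    rw [norm_smul]
    exact mul_le_of_le_one_right (norm_nonneg _) (hL m e)
  have hsig : Summable fun x : Σ m, {e // deg e = m} => ‖c x.2.1‖ * ρ ^ x.1 := by
    rw [← (Equiv.sigmaFiberEquiv deg).summable_iff] at hc
    refine hc.congr ?_
    rintro ⟨m, e, rfl⟩
    rfl
  have hsum : Summable fun m => ‖p m‖ * ρ ^ m := by
    refine Summable.of_nonneg_of_le (fun m => by positivity) (fun m => ?_) hsig.sigma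
    rw [tsum_fintype]
    refine (mul_le_mul_of_nonneg_right (hp m) (by positivity)).trans ?_
    rw [Finset.sum_mul]
  have hrad : (ρ.toNNReal : ENNReal) ≤ p.radius := by
    refine p.le_radius_of_summable_norm ?_
    simpa [Real.coe_toNNReal ρ hρ.le] using hsum
  refine HasFPowerSeriesAt.analyticAt (p := p) ⟨ρ.toNNReal, hrad, by simpa using hρ, ?_⟩
  intro Z hZ
  rw [zero_add]
  have hZ' : ∀ i, ‖Z i‖ ≤ ρ := by
    intro i
    have h1 : ‖Z‖ < ρ := by
      have h2 := hZ
      simp only [Metric.mem_eball, edist_zero_right] at h2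
      rw [← ofReal_norm, ← ENNReal.ofReal] at h2
      exact (ENNReal.ofReal_lt_ofReal_iff hρ).1 h2
    exact (norm_le_pi_norm Z i).trans h1.le
  have hs : Summable fun e => c e * ∏ i, Z i ^ e i := by
    refine Summable.of_norm_bounded hc fun e => ?_
    rw [norm_mul, norm_prod, ← Finset.prod_pow_eq_pow_sum]
    refine mul_le_mul_of_nonneg_left (Finset.prod_le_prod (fun _ _ => norm_nonneg _) fun i _ => ?_)
      (norm_nonneg _)
    rw [norm_pow]
    exact pow_le_pow_left₀ (norm_nonneg _) (hZ' i) _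
  have h1 := (Equiv.sigmaFiberEquiv deg).hasSum_iff.2 hs.hasSum
  have h2 := h1.sigma fun m => hasSum_fintype _
  have h3 : (fun m => p m fun _ => Z) = fun m => ∑ e : {e // deg e = m}, c e.1 * ∏ i, Z i ^ e.1 i := by
    funext m
    change (∑ e : {e // deg e = m}, c e.1 • L m e) (fun _ => Z) = _
    rw [sum_apply]
    refine Finset.sum_congr rfl fun e _ => ?_
    rw [smul_apply, hL', smul_eq_mul]
  rw [h3]
  exact h2

/-- A convergent power series is the sum of the monomials with all exponents less than `N` and of
multiples of the powers `Z_j ^ N`. -/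
theorem exists_tsum_monomial_split {ι : Type*} [Fintype ι] {c : (ι → ℕ) → ℂ} {ρ : ℝ} (hρ : 0 < ρ)
    (hc : Summable fun e => ‖c e‖ * ρ ^ ∑ i, e i) (N : ℕ) :
    ∃ A : ι → (ι → ℂ) → ℂ, (∀ j, AnalyticAt ℂ (A j) 0) ∧ ∀ Z : ι → ℂ, (∀ i, ‖Z i‖ ≤ ρ) →
      ∑' e, c e * ∏ i, Z i ^ e i = ∑' e, (if ∀ i, e i < N then c e * ∏ i, Z i ^ e i else 0) +
        ∑ j, Z j ^ N * A j Z := by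
  classical
  -- every exponent with some entry at least `N` is assigned to one such entry
  set jj : (ι → ℕ) → Option ι := fun e => if h : ∃ i, N ≤ e i then some h.choose else none with hjj
  have hjj1 : ∀ e j, jj e = some j → N ≤ e j := by
    intro e j h
    simp only [hjj] at h
    split_ifs at h with h'
    · cases h
      exact h'.choose_spec
  have hjj2 : ∀ e, jj e = none ↔ ∀ i, e i < N := by
    intro e
    simp only [hjj]
    split_ifs with h'
    · simp only [false_iff, not_forall, not_lt]
      exact h'
    · simpa using h'
  set sh : ι → (ι → ℕ) → ι → ℕ := fun j e => e + Pi.single j N with hsh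
  have hinj : ∀ j, Function.Injective (sh j) := fun j e e' h => add_right_cancel h
  set c' : ι → (ι → ℕ) → ℂ := fun j e => if jj (sh j e) = some j then c (sh j e) else 0 with hc'
  have hdeg : ∀ j e, ∑ i, sh j e i = ∑ i, e i + N := by
    intro j e
    simp [hsh, Finset.sum_add_distrib]
  refine ⟨fun j Z => ∑' e, c' j e * ∏ i, Z i ^ e i, fun j => analyticAt_tsum_monomial hρ ?_, ?_⟩
  · have h1 := (hc.comp_injective (hinj j)).mul_left (ρ ^ N)⁻¹
    refine Summable.of_nonneg_of_le (fun e => by positivity) (fun e => ?_) h1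
    simp only [Function.comp, hdeg, pow_add]
    have h2 : ‖c' j e‖ ≤ ‖c (sh j e)‖ := by
      simp only [hc']
      split_ifs
      · exact le_rfl
      · simp
    calc ‖c' j e‖ * ρ ^ ∑ i, e i ≤ ‖c (sh j e)‖ * ρ ^ ∑ i, e i := by gcongr
      _ = (ρ ^ N)⁻¹ * (‖c (sh j e)‖ * (ρ ^ (∑ i, e i) * ρ ^ N)) := by field_simp
  · intro Z hZ
    have hs : Summable fun e => ‖c e * ∏ i, Z i ^ e i‖ := by
      refine Summable.of_nonneg_of_le (fun e => norm_nonneg _) (fun e => ?_) hc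
      rw [norm_mul, norm_prod, ← Finset.prod_pow_eq_pow_sum]
      refine mul_le_mul_of_nonneg_left (Finset.prod_le_prod (fun _ _ => norm_nonneg _)
        fun i _ => ?_) (norm_nonneg _)
      rw [norm_pow]
      exact pow_le_pow_left₀ (norm_nonneg _) (hZ i) _
    have hs' : ∀ o : Option ι, Summable fun e => if jj e = o then c e * ∏ i, Z i ^ e i else 0 := by
      intro o
      refine Summable.of_norm_bounded hs fun e => ?_
      split_ifs
      · exact le_rfl
      · rw [norm_zero]
        exact norm_nonneg _
    have h1 : ∀ j, ∑' e, (if jj e = some j then c e * ∏ i, Z i ^ e i else 0) =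
        Z j ^ N * ∑' e, c' j e * ∏ i, Z i ^ e i := by
      intro j
      rw [← tsum_mul_left, ← (hinj j).tsum_eq]
      · refine tsum_congr fun e => ?_
        simp only [hc']
        split_ifs with h
        · have h2 : ∏ i, Z i ^ sh j e i = Z j ^ N * ∏ i, Z i ^ e i := by
            simp only [hsh, Pi.add_apply, pow_add, Finset.prod_mul_distrib]
            rw [mul_comm]
            congr 1
            rw [Finset.prod_eq_single j]
            · simp
            · intro i _ hi
              simp [Pi.single_eq_of_ne hi]
            · simp
          rw [h2]
          ring
        · ring
      · intro e he
        have h2 : jj e = some j := by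
          by_contra h
          exact he (if_neg h)
        refine ⟨e - Pi.single j N, ?_⟩
        refine tsub_add_cancel_of_le fun i => ?_
        by_cases hi : i = j
        · subst hi
          simpa using hjj1 e i h2
        · simp [Pi.single_eq_of_ne hi]
    have h2 : ∀ e, c e * ∏ i, Z i ^ e i = ∑ o : Option ι,
        if jj e = o then c e * ∏ i, Z i ^ e i else 0 := by
      intro e
      simp
    calc ∑' e, c e * ∏ i, Z i ^ e i
        = ∑' e, ∑ o : Option ι, if jj e = o then c e * ∏ i, Z i ^ e i else 0 := tsum_congr h2
      _ = ∑ o : Option ι, ∑' e, if jj e = o then c e * ∏ i, Z i ^ e i else 0 :=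
          Summable.tsum_finsetSum fun o _ => hs' o
      _ = _ := by
          rw [Fintype.sum_option]
          simp only [h1, hjj2]

/-! ### Mixed functions along the divisors -/

theorem contDiff_mixedMonomial {n : ℕ} (ν μ : Fin n → ℕ) :
    ContDiff ℝ ω fun z : Fin n → ℂ => mixedMonomial z ν μ := by
  refine contDiff_prod fun j _ => ?_
  have h : ContDiff ℝ ω fun z : Fin n → ℂ => z j := contDiff_apply ℝ ℂ j
  exact (h.pow _).mul ((Complex.conjCLE.contDiff.comp h).pow _)

/-- The variables `z` and `conj z`. -/
def mixedVar {n : ℕ} (z : Fin n → ℂ) : Fin n ⊕ Fin n → ℂ :=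
  Sum.elim z fun j => starRingEnd ℂ (z j)

theorem contDiff_mixedVar {n : ℕ} : ContDiff ℝ ω (mixedVar (n := n)) := by
  refine contDiff_pi.2 fun j => ?_
  rcases j with j | j
  · exact contDiff_apply ℝ ℂ j
  · exact Complex.conjCLE.contDiff.comp (contDiff_apply ℝ ℂ j)

theorem prod_mixedVar {n : ℕ} (z : Fin n → ℂ) (e : Fin n ⊕ Fin n → ℕ) :
    ∏ i, mixedVar z i ^ e i = mixedMonomial z (fun j => e (Sum.inl j)) fun j => e (Sum.inr j) := by
  simp [mixedVar, mixedMonomial, Finset.prod_mul_distrib]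

namespace MixedFunction

variable {n : ℕ} (f : MixedFunction n)

/-- Near the origin, a mixed function is a polynomial up to multiples of high powers of the
variables. -/
theorem exists_polynomial_approx (N : ℕ) : ∃ (T : Finset ((Fin n → ℕ) × (Fin n → ℕ)))
    (A : Fin n ⊕ Fin n → (Fin n ⊕ Fin n → ℂ) → ℂ),
    (∀ e, e ∈ T ↔ e ∈ f.exps ∧ ∀ j, e.1 j < N ∧ e.2 j < N) ∧ (∀ j, AnalyticAt ℂ (A j) 0) ∧
      ∀ᶠ z in 𝓝 0, z ∈ f.domain ∧ f.toFun z =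
        ∑ e ∈ T, f.coeff e.1 e.2 * mixedMonomial z e.1 e.2 +
          ∑ j, mixedVar z j ^ N * A j (mixedVar z) := by
  classical
  set Θ := Equiv.sumArrowEquivProdArrow (Fin n) (Fin n) ℕ with hΘ
  set c : (Fin n ⊕ Fin n → ℕ) → ℂ := fun e => f.coeff (Θ e).1 (Θ e).2 with hc
  obtain ⟨ρ, hρ, hball⟩ := Metric.isOpen_iff.1 f.isOpen_domain 0 f.zero_mem
  have hρ2 : (fun _ => ((ρ / 2 : ℝ) : ℂ)) ∈ f.domain := by
    apply hball
    rw [mem_ball_zero_iff, pi_norm_lt_iff hρ]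
    intro k
    rw [Complex.norm_real, Real.norm_of_nonneg (by positivity)]
    linarith
  have hmono : ∀ z e, c e * ∏ i, mixedVar z i ^ e i =
      f.coeff (Θ e).1 (Θ e).2 * mixedMonomial z (Θ e).1 (Θ e).2 := fun z e => by
    rw [prod_mixedVar]; rfl
  have hsum : Summable fun e => ‖c e‖ * (ρ / 2) ^ ∑ i, e i := by
    have h1 := (Θ.summable_iff.2 (f.hasSum _ hρ2).summable).norm
    refine h1.congr fun e => ?_
    rw [Function.comp, ← hmono, norm_mul, norm_prod, ← Finset.prod_pow_eq_pow_sum]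
    congr 1
    refine Finset.prod_congr rfl fun i _ => ?_
    rw [norm_pow]
    congr 1
    rcases i with i | i <;> simp [mixedVar, abs_of_pos hρ]
  obtain ⟨A, hA, hAsum⟩ := exists_tsum_monomial_split (half_pos hρ) hsum N
  have hfin : {e : (Fin n → ℕ) × (Fin n → ℕ) | e ∈ f.exps ∧ ∀ j, e.1 j < N ∧ e.2 j < N}.Finite := by
    refine Set.Finite.subset (Set.Finite.prod
      (Set.Finite.pi' (t := fun _ : Fin n => Set.Iio N) fun _ => Set.finite_Iio N)
      (Set.Finite.pi' (t := fun _ : Fin n => Set.Iio N) fun _ => Set.finite_Iio N)) ?_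
    rintro e ⟨-, he⟩
    exact ⟨fun j => (he j).1, fun j => (he j).2⟩
  refine ⟨hfin.toFinset, A, fun e => hfin.mem_toFinset, hA, ?_⟩
  filter_upwards [Metric.ball_mem_nhds 0 (half_pos hρ)] with z hz
  rw [mem_ball_zero_iff] at hz
  have hzd : z ∈ f.domain := hball (by rw [mem_ball_zero_iff]; linarith)
  refine ⟨hzd, ?_⟩
  have h1 := hAsum (mixedVar z) fun i => by
    have h2 : ∀ j, ‖z j‖ ≤ ρ / 2 := fun j => (norm_le_pi_norm z j).trans hz.le
    rcases i with i | i <;> simpa [mixedVar] using h2 i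
  have h2 : f.toFun z = ∑' e, c e * ∏ i, mixedVar z i ^ e i := by
    rw [← (f.hasSum z hzd).tsum_eq, ← Θ.tsum_eq]
    exact tsum_congr fun e => (hmono z e).symm
  rw [h2, h1]
  congr 1
  rw [← Θ.symm.tsum_eq, tsum_eq_sum (s := hfin.toFinset)]
  · refine Finset.sum_congr rfl fun e he => ?_
    rw [hfin.mem_toFinset] at he
    rw [if_pos, hmono, Equiv.apply_symm_apply]
    rintro (i | i)
    · exact (he.2 i).1
    · exact (he.2 i).2
  · intro e he
    rw [hfin.mem_toFinset] at he
    split_ifs with h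
    · rw [hmono, Equiv.apply_symm_apply]
      have : f.coeff e.1 e.2 = 0 := by
        by_contra h0
        exact he ⟨h0, fun j => ⟨h (Sum.inl j), h (Sum.inr j)⟩⟩
      rw [this, zero_mul]
    · rfl

end MixedFunction

/-- The pairing of weights and exponents. -/
def pairing {n : ℕ} (P ν : Fin n → ℕ) : ℕ := ∑ j, P j * ν j

theorem wdeg_eq_pairing {n : ℕ} (P : Fin n → ℕ) (e : (Fin n → ℕ) × (Fin n → ℕ)) :
    wdeg P e = pairing P e.1 + pairing P e.2 := by
  simp [wdeg, pairing, mul_add, Finset.sum_add_distrib]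

theorem mixedMonomial_chartProj {n : ℕ} {s : Finset (Fin n → ℕ)} (u : s → ℂ) (ν μ : Fin n → ℕ) :
    mixedMonomial (chartProj s u) ν μ =
      ∏ P : s, u P ^ pairing P.1 ν * starRingEnd ℂ (u P) ^ pairing P.1 μ := by
  simp only [mixedMonomial, chartProj, map_prod, map_pow, ← Finset.prod_pow, ← pow_mul, pairing,
    ← Finset.prod_pow_eq_pow_sum, Finset.prod_mul_distrib]
  congr 1 <;> exact Finset.prod_comm

/-- The effect of real rescalings of the coordinates on a mixed monomial. -/
theorem mixedMonomial_chartProj_smul {n : ℕ} {s : Finset (Fin n → ℕ)} (R : s → ℝ) (u : s → ℂ)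
    (e : (Fin n → ℕ) × (Fin n → ℕ)) :
    mixedMonomial (chartProj s fun P => R P * u P) e.1 e.2 =
      ((∏ P : s, R P ^ wdeg P.1 e : ℝ) : ℂ) * mixedMonomial (chartProj s u) e.1 e.2 := by
  rw [mixedMonomial_chartProj, mixedMonomial_chartProj]
  push_cast
  rw [← Finset.prod_mul_distrib]
  refine Finset.prod_congr rfl fun P _ => ?_
  rw [map_mul, Complex.conj_ofReal, wdeg_eq_pairing, mul_pow, mul_pow, pow_add]
  ring

theorem chartProj_smul {n : ℕ} {s : Finset (Fin n → ℕ)} (R : s → ℝ) (u : s → ℂ) (k : Fin n) :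
    chartProj s (fun P => R P * u P) k = ((∏ P : s, R P ^ P.1 k : ℝ) : ℂ) * chartProj s u k := by
  simp only [chartProj, mul_pow, Finset.prod_mul_distrib]
  push_cast
  rfl

section Coordinates

variable {n : ℕ} {s : Finset (Fin n → ℕ)}

/-- The coordinate `r_P`. -/
def radius (v : ParamSpace s) (P : s) : ℝ := if h : StrictlyPos P.1 then (v.1 ⟨P, h⟩).1 else 0

/-- The coordinate `θ_P`. -/
def angle (v : ParamSpace s) (P : s) : ℝ := if h : StrictlyPos P.1 then (v.1 ⟨P, h⟩).2 else 0

/-- The complex coordinates, as functions of all polar coordinates, with `r_P` of any sign. -/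
def polarCoord (v : ParamSpace s) (P : s) : ℂ :=
  if h : StrictlyPos P.1 then radius v P * Complex.exp (angle v P * Complex.I) else v.2 ⟨P, h⟩

open Classical in
/-- The complex coordinates, with the radii `r_P`, `P ∈ J`, replaced by `1`. -/
def unitCoord (J : Finset s) (v : ParamSpace s) (P : s) : ℂ :=
  if P ∈ J then Complex.exp (angle v P * Complex.I) else polarCoord v P

theorem contDiff_radius (P : s) : ContDiff ℝ ω fun v : ParamSpace s => radius v P := by
  unfold radius
  split_ifs with h
  · exact contDiff_fst.comp ((contDiff_apply ℝ (ℝ × ℝ) (⟨P, h⟩ : PosIdx s)).comp contDiff_fst)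
  · exact contDiff_const

theorem contDiff_angle (P : s) : ContDiff ℝ ω fun v : ParamSpace s => angle v P := by
  unfold angle
  split_ifs with h
  · exact contDiff_snd.comp ((contDiff_apply ℝ (ℝ × ℝ) (⟨P, h⟩ : PosIdx s)).comp contDiff_fst)
  · exact contDiff_const

theorem contDiff_exp_angle (P : s) :
    ContDiff ℝ ω fun v : ParamSpace s => Complex.exp (angle v P * Complex.I) :=
  ((Complex.ofRealCLM.contDiff.comp (contDiff_angle P)).mul contDiff_const).cexp

theorem contDiff_polarCoord : ContDiff ℝ ω (polarCoord (s := s)) := by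
  refine contDiff_pi.2 fun P => ?_
  unfold polarCoord
  split_ifs with h
  · exact (Complex.ofRealCLM.contDiff.comp (contDiff_radius P)).mul (contDiff_exp_angle P)
  · exact (contDiff_apply ℝ ℂ (⟨P, h⟩ : NonposIdx s)).comp contDiff_snd

theorem contDiff_unitCoord (J : Finset s) : ContDiff ℝ ω (unitCoord J) := by
  refine contDiff_pi.2 fun P => ?_
  unfold unitCoord
  split_ifs with h
  · exact contDiff_exp_angle P
  · exact contDiff_pi.1 contDiff_polarCoord P

theorem contDiff_chartProj : ContDiff ℝ ω (chartProj s) :=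
  contDiff_pi.2 fun _ => contDiff_prod fun P _ => (contDiff_apply ℝ ℂ P).pow _

open Classical in
theorem polarCoord_eq_mul {J : Finset s} (hJ : ∀ P ∈ J, StrictlyPos P.1) (v : ParamSpace s) :
    polarCoord v = fun P => ((if P ∈ J then radius v P else 1 : ℝ) : ℂ) * unitCoord J v P := by
  funext P
  unfold unitCoord
  split_ifs with h
  · exact dif_pos (hJ P h)
  · simp

theorem prod_ite_radius (J : Finset s) (v : ParamSpace s) (m : s → ℕ) :
    ∏ P : s, (open Classical in if P ∈ J then radius v P else 1 : ℝ) ^ m P =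
      ∏ P ∈ J, radius v P ^ m P := by
  classical
  simp only [ite_pow, one_pow, Finset.prod_ite_mem, Finset.univ_inter]

end Coordinates

namespace MixedFunction

variable {n : ℕ} (f : MixedFunction n)

/-- The pull-back of a mixed function to a chart is divisible, near a point on the divisors of the
vertices `P ∈ J`, by the powers `r_P ^ d(P; f)`, and the quotient is given on the intersection of
these divisors by the monomials of lowest degree. -/
theorem exists_factorization {s : Finset (Fin n → ℕ)} {J : Finset s}
    (hJ : ∀ P ∈ J, StrictlyPos P.1) (hne : J.Nonempty) {a : ParamSpace s}
    (ha : ∀ P ∈ J, radius a P = 0) :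
    ∃ (g : ParamSpace s → ℂ) (T : Finset ((Fin n → ℕ) × (Fin n → ℕ))), ContDiffAt ℝ ω g a ∧
      (∀ e, e ∈ T ↔ e ∈ f.exps ∧ ∀ P ∈ J, wdeg P.1 e = f.minDegree P.1) ∧
      (∀ᶠ v in 𝓝 a, chartProj s (polarCoord v) ∈ f.domain ∧ f.toFun (chartProj s (polarCoord v)) =
        ((∏ P ∈ J, radius v P ^ f.minDegree P.1 : ℝ) : ℂ) * g v) ∧
      ∀ v, (∀ P ∈ J, radius v P = 0) →
        g v = ∑ e ∈ T, f.coeff e.1 e.2 * mixedMonomial (chartProj s (unitCoord J v)) e.1 e.2 := by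
  classical
  set d : s → ℕ := fun P => f.minDegree P.1 with hd
  obtain ⟨N, hN⟩ : ∃ N, ∀ P ∈ J, d P < N :=
    ⟨J.sup d + 1, fun P hP => Nat.lt_succ_of_le (Finset.le_sup (f := d) hP)⟩
  obtain ⟨T₀, A, hT₀, hA, hf⟩ := f.exists_polynomial_approx N
  set ix : Fin n ⊕ Fin n → Fin n := Sum.elim id id with hix
  set z : ParamSpace s → Fin n → ℂ := fun v => chartProj s (polarCoord v) with hz
  set w : ParamSpace s → Fin n → ℂ := fun v => chartProj s (unitCoord J v) with hw
  have hzc : ContDiff ℝ ω z := contDiff_chartProj.comp contDiff_polarCoord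
  have hwc : ContDiff ℝ ω w := contDiff_chartProj.comp (contDiff_unitCoord J)
  have hza : z a = 0 := by
    obtain ⟨P, hP⟩ := hne
    funext k
    refine Finset.prod_eq_zero (Finset.mem_univ P) ?_
    have : polarCoord a P = 0 := by
      rw [polarCoord, dif_pos (hJ P hP), ha P hP]
      simp
    rw [this, zero_pow (hJ P hP k).ne']
  have hle : ∀ e ∈ f.exps, ∀ P : s, d P ≤ wdeg P.1 e := fun e he P => f.minDegree_le he
  have hNle : ∀ j, ∀ P ∈ J, d P < N * P.1 (ix j) := fun j P hP =>
    (hN P hP).trans_le (Nat.le_mul_of_pos_right _ (hJ P hP _))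
  have hzw : ∀ v j, mixedVar (z v) j =
      ((∏ P ∈ J, radius v P ^ P.1 (ix j) : ℝ) : ℂ) * mixedVar (w v) j := by
    intro v j
    have h1 : ∀ k, z v k = ((∏ P ∈ J, radius v P ^ P.1 k : ℝ) : ℂ) * w v k := by
      intro k
      simp only [hz]
      rw [polarCoord_eq_mul hJ, chartProj_smul, prod_ite_radius]
    rcases j with j | j
    · exact h1 j
    · simp only [mixedVar, Sum.elim_inr, h1 j, map_mul, Complex.conj_ofReal]
      rfl
  -- every monomial of small degree, and every multiple of a power `Z_j ^ N`, is divisible by the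
  -- divisorial part
  set g : ParamSpace s → ℂ := fun v =>
    ∑ e ∈ T₀, ((∏ P ∈ J, radius v P ^ (wdeg P.1 e - d P) : ℝ) : ℂ) *
      (f.coeff e.1 e.2 * mixedMonomial (w v) e.1 e.2) +
    ∑ j, ((∏ P ∈ J, radius v P ^ (N * P.1 (ix j) - d P) : ℝ) : ℂ) *
      (mixedVar (w v) j ^ N * A j (mixedVar (z v))) with hg
  have hT : ∀ e, e ∈ T₀.filter (fun e => ∀ P ∈ J, wdeg P.1 e = d P) ↔
      e ∈ f.exps ∧ ∀ P ∈ J, wdeg P.1 e = d P := by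
    intro e
    rw [Finset.mem_filter, hT₀]
    refine ⟨fun h => ⟨h.1.1, h.2⟩, fun h => ⟨⟨h.1, fun j => ?_⟩, h.2⟩⟩
    obtain ⟨P, hP⟩ := hne
    have h1 := Finset.single_le_sum (f := fun j => P.1 j * (e.1 j + e.2 j))
      (fun _ _ => Nat.zero_le _) (Finset.mem_univ j)
    have h2 : e.1 j + e.2 j < N := by
      calc e.1 j + e.2 j ≤ P.1 j * (e.1 j + e.2 j) := Nat.le_mul_of_pos_left _ (hJ P hP j)
        _ ≤ wdeg P.1 e := h1
        _ = d P := h.2 P hP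
        _ < N := hN P hP
    omega
  refine ⟨g, T₀.filter (fun e => ∀ P ∈ J, wdeg P.1 e = d P), ?_, hT, ?_, ?_⟩
  · have hrad : ∀ m : s → ℕ, ContDiff ℝ ω fun v : ParamSpace s =>
        ((∏ P ∈ J, radius v P ^ m P : ℝ) : ℂ) := fun m =>
      Complex.ofRealCLM.contDiff.comp (contDiff_prod fun P _ => (contDiff_radius P).pow _)
    refine ContDiffAt.add (ContDiffAt.sum fun e _ => ?_) (ContDiffAt.sum fun j _ => ?_)
    · exact ((hrad _).mul (contDiff_const.mul ((contDiff_mixedMonomial _ _).comp hwc))).contDiffAt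
    · refine (hrad fun P => N * P.1 (ix j) - d P).contDiffAt.mul (ContDiffAt.mul ?_ ?_)
      · exact ((contDiff_pi.1 (contDiff_mixedVar.comp hwc) j).pow N).contDiffAt
      · have h0 : mixedVar (z a) = 0 := by
          rw [hza]
          funext j
          rcases j with j | j <;> simp [mixedVar]
        have h1 : ContDiffAt ℝ ω (A j) (mixedVar (z a)) := by
          rw [h0]
          exact ((hA j).restrictScalars (𝕜 := ℝ)).contDiffAt
        exact ContDiffAt.comp a h1 (contDiff_mixedVar.comp hzc).contDiffAt
  · have hev : ∀ᶠ v in 𝓝 a, z v ∈ f.domain ∧ f.toFun (z v) =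
        ∑ e ∈ T₀, f.coeff e.1 e.2 * mixedMonomial (z v) e.1 e.2 +
          ∑ j, mixedVar (z v) j ^ N * A j (mixedVar (z v)) := by
      have h1 : Filter.Tendsto z (𝓝 a) (𝓝 0) := by
        have := hzc.continuous.tendsto a
        rwa [hza] at this
      exact h1.eventually hf
    filter_upwards [hev] with v hv
    refine ⟨hv.1, hv.2.trans ?_⟩
    simp only [hg]
    rw [mul_add, Finset.mul_sum, Finset.mul_sum]
    have hcomb : ∀ m : s → ℕ, (∀ P ∈ J, d P ≤ m P) →
        ((∏ P ∈ J, radius v P ^ d P : ℝ) : ℂ) * ((∏ P ∈ J, radius v P ^ (m P - d P) : ℝ) : ℂ) =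
          ((∏ P ∈ J, radius v P ^ m P : ℝ) : ℂ) := by
      intro m hm
      rw [← Complex.ofReal_mul, ← Finset.prod_mul_distrib]
      congr 1
      refine Finset.prod_congr rfl fun P hP => ?_
      rw [← pow_add, Nat.add_sub_cancel' (hm P hP)]
    congr 1
    · refine Finset.sum_congr rfl fun e he => ?_
      rw [← mul_assoc, hcomb _ fun P _ => hle e ((hT₀ e).1 he).1 P]
      simp only [hz]
      rw [polarCoord_eq_mul hJ, mixedMonomial_chartProj_smul, prod_ite_radius]
      ring
    · refine Finset.sum_congr rfl fun j _ => ?_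
      rw [← mul_assoc, hcomb (fun P => N * P.1 (ix j)) fun P hP => (hNle j P hP).le, hzw, mul_pow,
        mul_assoc]
      congr 1
      rw [← Complex.ofReal_pow, ← Finset.prod_pow]
      congr 1
      refine Finset.prod_congr rfl fun P _ => ?_
      rw [← pow_mul, mul_comm]
  · intro v hv
    have hprod : ∀ m : s → ℕ, ∏ P ∈ J, radius v P ^ m P = if ∀ P ∈ J, m P = 0 then 1 else 0 := by
      intro m
      split_ifs with h
      · exact Finset.prod_eq_one fun P hP => by rw [h P hP, pow_zero]
      · push Not at h
        obtain ⟨P, hP, h0⟩ := h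
        exact Finset.prod_eq_zero hP (by rw [hv P hP, zero_pow h0])
    simp only [hg, hprod]
    have h2 : ∀ j, ¬ ∀ P ∈ J, N * P.1 (ix j) - d P = 0 := by
      intro j h
      obtain ⟨P, hP⟩ := hne
      have := hNle j P hP
      have := h P hP
      omega
    rw [Finset.sum_filter]
    simp only [if_neg (h2 _), Complex.ofReal_zero, zero_mul, Finset.sum_const_zero, add_zero]
    refine Finset.sum_congr rfl fun e he => ?_
    have h3 : (∀ P ∈ J, wdeg P.1 e - d P = 0) ↔ ∀ P ∈ J, wdeg P.1 e = d P := by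
      refine forall₂_congr fun P _ => ?_
      have := hle e ((hT₀ e).1 he).1 P
      omega
    by_cases h4 : ∀ P ∈ J, wdeg P.1 e = d P
    · rw [if_pos (h3.2 h4), if_pos h4]
      simp only [Complex.ofReal_one, one_mul, hw]
    · rw [if_neg (fun h => h4 (h3.1 h)), if_neg h4]
      simp

end MixedFunction

/-! ### Non-degeneracy in the charts -/

section Coordinates

variable {n : ℕ} {s : Finset (Fin n → ℕ)}

open Classical in
/-- The projection to the subspace where the radii `r_P`, `P ∈ J`, and the coordinates of the
vertices in `I` vanish. -/
def dropCoord (J I : Finset s) : ParamSpace s →L[ℝ] ParamSpace s :=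
  LinearMap.toContinuousLinearMap
    { toFun := fun v => (fun P => (if P.1 ∈ J then 0 else (v.1 P).1, (v.1 P).2),
        fun P => if P.1 ∈ I then 0 else v.2 P)
      map_add' := by
        intro v w
        refine Prod.ext (funext fun P => ?_) (funext fun P => ?_)
        · by_cases h : P.1 ∈ J
          · simp [h]
          · simp only [Prod.fst_add, Pi.add_apply, Prod.snd_add, if_neg h]
            rfl
        · by_cases h : P.1 ∈ I <;> simp [h]
      map_smul' := by
        intro c v
        refine Prod.ext (funext fun P => ?_) (funext fun P => ?_)
        · by_cases h : P.1 ∈ J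
          · simp [h]
          · simp only [Pi.smul_apply, Prod.smul_fst, Prod.smul_snd, if_neg h]
            rfl
        · by_cases h : P.1 ∈ I <;> simp [h] }

open Classical in
theorem radius_dropCoord (J I : Finset s) (v : ParamSpace s) (P : s) :
    radius (dropCoord J I v) P = if P ∈ J then 0 else radius v P := by
  unfold radius
  split_ifs with h1 h2 h2
  · exact if_pos h2
  · exact if_neg h2
  · rfl
  · rfl

theorem angle_dropCoord (J I : Finset s) (v : ParamSpace s) (P : s) :
    angle (dropCoord J I v) P = angle v P := rfl

open Classical in
/-- The complex coordinates, translated by `1` along the coordinates of the vertices in `K`. -/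
def shiftCoord (K : Finset s) (v : ParamSpace s) (P : s) : ℂ :=
  if h : StrictlyPos P.1 then
    ((radius v P + if P ∈ K then 1 else 0 : ℝ) : ℂ) * Complex.exp (angle v P * Complex.I)
  else v.2 ⟨P, h⟩ + if P ∈ K then 1 else 0

theorem contDiff_shiftCoord (K : Finset s) : ContDiff ℝ ω (shiftCoord K) := by
  refine contDiff_pi.2 fun P => ?_
  unfold shiftCoord
  by_cases h : StrictlyPos P.1
  · simp only [dif_pos h]
    exact (Complex.ofRealCLM.contDiff.comp ((contDiff_radius P).add contDiff_const)).mul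
      (contDiff_exp_angle P)
  · simp only [dif_neg h]
    exact ((contDiff_apply ℝ ℂ (⟨P, h⟩ : NonposIdx s)).comp contDiff_snd).add contDiff_const

/-- The coordinate map is a submersion where no coordinate vanishes. -/
theorem surjective_of_shiftCoord_ne_zero {K : Finset s} {a : ParamSpace s}
    (h : ∀ P, shiftCoord K a P ≠ 0) {D : ParamSpace s →L[ℝ] (s → ℂ)}
    (hD : HasFDerivAt (shiftCoord K) D a) : Function.Surjective D := by
  classical
  intro ξ
  set b : s → ℂ := fun P => ξ P * Complex.exp (-(angle a P * Complex.I)) with hb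
  set R : s → ℝ := fun P => radius a P + if P ∈ K then 1 else 0 with hR
  set δ : ParamSpace s := (fun P => ((b P.1).re, (b P.1).im / R P.1), fun P => ξ P.1) with hδ
  refine ⟨δ, ?_⟩
  have h1 : HasDerivAt (fun t : ℝ => a + t • δ) δ 0 := by
    simpa using ((hasDerivAt_id (0 : ℝ)).smul_const δ).const_add a
  have h2 : HasDerivAt (fun t : ℝ => shiftCoord K (a + t • δ)) (D δ) 0 := by
    have hD' : HasFDerivAt (shiftCoord K) D (a + (0 : ℝ) • δ) := by simpa using hD
    exact hD'.comp_hasDerivAt 0 h1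
  refine h2.unique (hasDerivAt_pi.2 fun P => ?_)
  by_cases hP : StrictlyPos P.1
  · have hRP : R P ≠ 0 := by
      have := h P
      rw [shiftCoord, dif_pos hP] at this
      exact Complex.ofReal_ne_zero.1 (left_ne_zero_of_mul this)
    have h3 : ∀ t : ℝ, shiftCoord K (a + t • δ) P = ((R P + t * (b P).re : ℝ) : ℂ) *
        Complex.exp (((angle a P + t * ((b P).im / R P) : ℝ) : ℂ) * Complex.I) := by
      intro t
      have hRP' : R P = (a.1 ⟨P, hP⟩).1 + if P ∈ K then 1 else 0 := by
        simp only [hR, radius, dif_pos hP]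
      simp only [shiftCoord, radius, angle, dif_pos hP]
      simp only [Prod.fst_add, Prod.smul_fst, Pi.add_apply, Pi.smul_apply, Prod.snd_add,
        Prod.smul_snd, smul_eq_mul, hδ]
      rw [hRP']
      congr 2
      ring
    simp only [h3]
    have h4 : HasDerivAt (fun t : ℝ => ((R P + t * (b P).re : ℝ) : ℂ)) ((b P).re : ℂ) 0 := by
      have : HasDerivAt (fun t : ℝ => R P + t * (b P).re) (b P).re 0 := by
        simpa using ((hasDerivAt_id (0 : ℝ)).mul_const (b P).re).const_add (R P)
      exact this.ofReal_comp
    have h5 : HasDerivAt (fun t : ℝ => ((angle a P + t * ((b P).im / R P) : ℝ) : ℂ))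
        (((b P).im / R P : ℝ) : ℂ) 0 := by
      have : HasDerivAt (fun t : ℝ => angle a P + t * ((b P).im / R P)) ((b P).im / R P) 0 := by
        simpa using ((hasDerivAt_id (0 : ℝ)).mul_const ((b P).im / R P)).const_add (angle a P)
      exact this.ofReal_comp
    have h6 := h4.mul (h5.mul_const Complex.I).cexp
    refine h6.congr_deriv ?_
    simp only [zero_mul, add_zero]
    have h7 : ξ P = b P * Complex.exp (angle a P * Complex.I) := by
      simp only [hb]
      rw [mul_assoc, ← Complex.exp_add]
      simp
    conv_rhs => rw [h7, ← Complex.re_add_im (b P)]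
    have h8 : (R P : ℂ) ≠ 0 := by exact_mod_cast hRP
    push_cast
    field_simp
  · have h3 : ∀ t : ℝ, shiftCoord K (a + t • δ) P =
        a.2 ⟨P, hP⟩ + (t : ℂ) * ξ P + if P ∈ K then 1 else 0 := by
      intro t
      simp only [shiftCoord, dif_neg hP]
      simp [hδ]
    simp only [h3]
    have h4 : HasDerivAt (fun t : ℝ => (t : ℂ)) 1 0 := Complex.ofRealCLM.hasDerivAt
    simpa using ((h4.mul_const (ξ P)).const_add (a.2 ⟨P, hP⟩)).add_const
      (if P ∈ K then (1 : ℂ) else 0)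

end Coordinates

namespace RegularFan

variable {n : ℕ} {F : RegularFan n}

theorem surjective_fderiv_chartProj (hF : F.IsGood) (hn : 1 ≤ n) {s : F.maxCones} {u : s.1 → ℂ}
    (hu : ∀ P, u P ≠ 0) {D : (s.1 → ℂ) →L[ℝ] (Fin n → ℂ)}
    (hD : HasFDerivAt (chartProj s.1) D u) : Function.Surjective D := by
  have hw : ∀ k, chartProj s.1 u k ≠ 0 := fun k h0 => by
    obtain ⟨P, hP, -⟩ := (chartProj_eq_zero_iff _ _).1 h0
    exact hu P hP
  have hw0 : chartProj s.1 u ≠ 0 := fun h => hw ⟨0, hn⟩ (congrFun h _)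
  have h1 : DifferentiableAt ℝ (invCoord s) (chartProj s.1 u) :=
    (contDiffAt_invCoord fun i h => absurd h (hw i)).differentiableAt (by simp)
  have h2 : HasFDerivAt (chartProj s.1) D (invCoord s (chartProj s.1 u)) := by
    rwa [invCoord_chartProj hF hw0]
  have h3 := h2.comp _ h1.hasFDerivAt
  have h4 : HasFDerivAt (chartProj s.1 ∘ invCoord s) (ContinuousLinearMap.id ℝ (Fin n → ℂ))
      (chartProj s.1 u) := by
    refine (hasFDerivAt_id _).congr_of_eventuallyEq ?_
    have : ∀ᶠ z : Fin n → ℂ in 𝓝 (chartProj s.1 u), ∀ k, z k ≠ 0 :=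
      Filter.eventually_all.2 fun k => (continuous_apply k).continuousAt.eventually_ne (hw k)
    filter_upwards [this] with z hz
    exact chartProj_invCoord fun i h => absurd h (hz i)
  have h5 := h3.unique h4
  intro η
  exact ⟨_, congrArg (fun L : (Fin n → ℂ) →L[ℝ] (Fin n → ℂ) => L η) h5⟩

theorem minDegree_nonpos {f : MixedFunction n} (hF : F.IsGood) (hconv : f.IsConvenient)
    {s : F.maxCones} {P : s.1} (hP : ¬ StrictlyPos P.1) : f.minDegree P.1 = 0 := by
  obtain ⟨i, hi⟩ := (hF.vertex s P.1 P.2).resolve_left hP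
  rw [hi]
  refine f.minDegree_single ?_ hconv i
  by_contra hn
  apply hP
  intro k
  have : Subsingleton (Fin n) := Fin.subsingleton_iff_le_one.2 (by omega)
  rw [hi, Subsingleton.elim k i]
  simp

/-- By non-degeneracy, the quotient `g` of the pull-back of `f` by its divisorial part is a
submersion along the intersection of the divisors through one of its zeros. Indeed, let `K` be the
set of the vertices with vanishing coordinate and `Q` their sum, which is strictly positive. If the
coordinates in `K` are shifted by `1`, so that the point moves to the torus, then the face function
`f_Q` is `g` up to the radial factor `m`: it is homogeneous in the radii of the strictly positive
vertices in `K` and does not depend on the coordinates of the other ones. -/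
theorem exists_fderiv_factor_eq {f : MixedFunction n} (hn : 1 ≤ n) (hnd : f.IsNondegenerate)
    (hconv : f.IsConvenient) (hF : F.IsGood) (hadm : F.IsAdmissible f) {s : F.maxCones}
    {J : Finset s.1} (hJ : ∀ P ∈ J, StrictlyPos P.1) (hne : J.Nonempty) {a : ParamSpace s.1}
    (ha : ∀ P ∈ J, radius a P = 0) (ha' : ∀ P : s.1, StrictlyPos P.1 → P ∉ J → radius a P ≠ 0)
    {g : ParamSpace s.1 → ℂ} {T : Finset ((Fin n → ℕ) × (Fin n → ℕ))} (hg : ContDiffAt ℝ ω g a)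
    (hT : ∀ e, e ∈ T ↔ e ∈ f.exps ∧ ∀ P ∈ J, wdeg P.1 e = f.minDegree P.1)
    (hgT : ∀ v, (∀ P ∈ J, radius v P = 0) →
      g v = ∑ e ∈ T, f.coeff e.1 e.2 * mixedMonomial (chartProj s.1 (unitCoord J v)) e.1 e.2)
    (hga : g a = 0) (c : ℂ) :
    ∃ δ, (∀ P ∈ J, radius δ P = 0) ∧ fderiv ℝ g a δ = c := by
  classical
  set I : Finset s.1 := Finset.univ.filter fun P => ¬ StrictlyPos P.1 ∧ polarCoord a P = 0 with hI
  have hIpos : ∀ P ∈ I, ¬ StrictlyPos P.1 := fun P hP => (Finset.mem_filter.1 hP).2.1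
  set K := J ∪ I with hK
  set K' : Finset (Fin n → ℕ) := K.map (Function.Embedding.subtype _) with hK'
  have hK's : K' ⊆ s.1 := by
    intro P hP
    obtain ⟨Q, -, rfl⟩ := Finset.mem_map.1 hP
    exact Q.2
  set Q : Fin n → ℕ := ∑ P ∈ K', P with hQ
  have hQpos : StrictlyPos Q := by
    obtain ⟨P, hP⟩ := hne
    intro k
    have h1 : P.1 ∈ K' := Finset.mem_map.2 ⟨P, Finset.mem_union_left _ hP, rfl⟩
    have h2 := Finset.single_le_sum (f := fun P : Fin n → ℕ => P k) (fun _ _ => Nat.zero_le _) h1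
    rw [hQ, Finset.sum_apply]
    exact (hJ P hP k).trans_le h2
  set p := dropCoord J I with hp
  -- the face function of the sum of the vertices with vanishing coordinates
  have hface : f.faceExponents Q = ↑(T.filter fun e => ∀ P ∈ I, wdeg P.1 e = 0) := by
    ext e
    rw [Finset.mem_coe, Finset.mem_filter, hT, hQ,
      f.mem_faceExponents_iff hadm (f.exps_nonempty hn hconv) s hK's]
    have h1 : (∀ P ∈ K', wdeg P e = f.minDegree P) ↔ ∀ P ∈ K, wdeg P.1 e = f.minDegree P.1 := by
      simp only [hK', Finset.mem_map, Function.Embedding.coe_subtype, forall_exists_index, and_imp,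
        forall_apply_eq_imp_iff₂]
    rw [h1]
    constructor
    · rintro ⟨h2, h3⟩
      refine ⟨⟨h2, fun P hP => h3 P (Finset.mem_union_left _ hP)⟩, fun P hP => ?_⟩
      rw [h3 P (Finset.mem_union_right _ hP), minDegree_nonpos hF hconv (hIpos P hP)]
    · rintro ⟨⟨h2, h3⟩, h4⟩
      refine ⟨h2, fun P hP => ?_⟩
      rcases Finset.mem_union.1 hP with hP | hP
      · exact h3 P hP
      · rw [h4 P hP, minDegree_nonpos hF hconv (hIpos P hP)]
  have hfQ : ∀ z, f.faceFunction Q z = ∑ e ∈ T.filter fun e => ∀ P ∈ I, wdeg P.1 e = 0,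
      f.coeff e.1 e.2 * mixedMonomial z e.1 e.2 := by
    intro z
    rw [MixedFunction.faceFunction, hface]
    exact finsum_mem_coe_finset _ _
  have hradp : ∀ v, ∀ P ∈ J, radius (p v) P = 0 := fun v P hP => by
    rw [hp, radius_dropCoord, if_pos hP]
  set m : ParamSpace s.1 → ℝ := fun v => ∏ P ∈ J, (radius v P + 1) ^ f.minDegree P.1 with hm
  have hkey : ∀ v, f.faceFunction Q (chartProj s.1 (shiftCoord K v)) = (m v : ℂ) * g (p v) := by
    intro v
    rw [hfQ, hgT _ (hradp v), Finset.mul_sum, Finset.sum_filter]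
    refine Finset.sum_congr rfl fun e he => ?_
    have heT := ((hT e).1 he).2
    have hmono : (if ∀ P ∈ I, wdeg P.1 e = 0 then
        mixedMonomial (chartProj s.1 (shiftCoord K v)) e.1 e.2 else 0) =
        (m v : ℂ) * mixedMonomial (chartProj s.1 (unitCoord J (p v))) e.1 e.2 := by
      have hmv : (m v : ℂ) = ∏ P : s.1, if P ∈ J then ((radius v P + 1 : ℝ) : ℂ) ^ wdeg P.1 e else 1 := by
        rw [Finset.prod_ite_mem, Finset.univ_inter]
        simp only [hm]
        push_cast
        exact Finset.prod_congr rfl fun P hP => by rw [heT P hP]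
      have hdrop : ∀ P ∈ I, unitCoord J (p v) P = 0 := by
        intro P hP
        have hPJ : P ∉ J := fun h => hIpos P hP (hJ P h)
        rw [unitCoord, if_neg hPJ, polarCoord, dif_neg (hIpos P hP)]
        exact if_pos hP
      rw [mixedMonomial_chartProj, mixedMonomial_chartProj, hmv, ← Finset.prod_mul_distrib]
      split_ifs with hcase
      · refine Finset.prod_congr rfl fun P _ => ?_
        by_cases hPJ : P ∈ J
        · rw [if_pos hPJ, unitCoord, if_pos hPJ, shiftCoord, dif_pos (hJ P hPJ),
            if_pos (Finset.mem_union_left _ hPJ), wdeg_eq_pairing, map_mul, Complex.conj_ofReal,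
            hp, angle_dropCoord, mul_pow, mul_pow, pow_add]
          ring
        · rw [if_neg hPJ, one_mul]
          by_cases hPI : P ∈ I
          · have h1 := hcase P hPI
            rw [wdeg_eq_pairing] at h1
            obtain ⟨h2, h3⟩ := Nat.add_eq_zero_iff.1 h1
            rw [h2, h3]
            simp
          · have hPK : P ∉ K := fun h => (Finset.mem_union.1 h).elim hPJ hPI
            have : shiftCoord K v P = unitCoord J (p v) P := by
              rw [unitCoord, if_neg hPJ, shiftCoord, polarCoord]
              split_ifs with hpos
              · rw [hp, radius_dropCoord, if_neg hPJ, angle_dropCoord, add_zero]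
              · rw [add_zero]
                exact (if_neg hPI).symm
            rw [this]
      · push Not at hcase
        obtain ⟨P, hPI, hPe⟩ := hcase
        symm
        refine Finset.prod_eq_zero (Finset.mem_univ P) ?_
        rw [hdrop P hPI, map_zero, ← pow_add, ← wdeg_eq_pairing, zero_pow hPe, mul_zero]
    rw [mul_left_comm, ← hmono]
    split_ifs <;> simp
  have hpa : p a = a := by
    refine Prod.ext (funext fun P => Prod.ext ?_ rfl) (funext fun P => ?_)
    · change (if P.1 ∈ J then 0 else (a.1 P).1) = (a.1 P).1
      split_ifs with h
      · have := ha _ h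
        rw [radius, dif_pos P.2] at this
        exact this.symm
      · rfl
    · change (if P.1 ∈ I then 0 else a.2 P) = a.2 P
      split_ifs with h
      · have := (Finset.mem_filter.1 h).2.2
        rw [polarCoord, dif_neg P.2] at this
        exact this.symm
      · rfl
  have hma : m a = 1 := Finset.prod_eq_one fun P hP => by rw [ha P hP, zero_add, one_pow]
  have hmd : DifferentiableAt ℝ (fun v => (m v : ℂ)) a := by
    have : ContDiff ℝ ω fun v => (m v : ℂ) := Complex.ofRealCLM.contDiff.comp
      (contDiff_prod fun P _ => ((contDiff_radius P).add contDiff_const).pow _)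
    exact this.contDiffAt.differentiableAt (by simp)
  have hgd : HasFDerivAt g (fderiv ℝ g a) (p a) := by
    rw [hpa]
    exact (hg.differentiableAt (by simp)).hasFDerivAt
  have h1 := hmd.hasFDerivAt.mul (hgd.comp a p.hasFDerivAt)
  set u := shiftCoord K a with hu
  have hune : ∀ P, u P ≠ 0 := by
    intro P
    simp only [hu, shiftCoord]
    split_ifs with h2 h3 h3
    · refine mul_ne_zero ?_ (Complex.exp_ne_zero _)
      rcases Finset.mem_union.1 h3 with h3 | h3
      · rw [ha P h3]; simp
      · exact absurd h2 (hIpos P h3)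
    · refine mul_ne_zero ?_ (Complex.exp_ne_zero _)
      rw [add_zero]
      exact_mod_cast ha' P h2 fun h => h3 (Finset.mem_union_left _ h)
    · rcases Finset.mem_union.1 h3 with h3 | h3
      · exact absurd (hJ P h3) h2
      · have := (Finset.mem_filter.1 h3).2.2
        rw [polarCoord, dif_neg h2] at this
        rw [this]; simp
    · rw [add_zero]
      intro h0
      refine h3 (Finset.mem_union_right _ (Finset.mem_filter.2 ⟨Finset.mem_univ _, h2, ?_⟩))
      rw [polarCoord, dif_neg h2, h0]
  set w := chartProj s.1 u with hw
  have hwne : ∀ k, w k ≠ 0 := fun k h0 => by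
    obtain ⟨P, hP, -⟩ := (chartProj_eq_zero_iff _ _).1 h0
    exact hune P hP
  have hfw : f.faceFunction Q w = 0 := by
    rw [hw, hu, hkey, hpa, hga, mul_zero]
  have hfd : DifferentiableAt ℝ (f.faceFunction Q) w := by
    have : f.faceFunction Q = fun z => ∑ e ∈ T.filter fun e => ∀ P ∈ I, wdeg P.1 e = 0,
      f.coeff e.1 e.2 * mixedMonomial z e.1 e.2 := funext hfQ
    rw [this]
    have h2 : ContDiff ℝ ω fun z : Fin n → ℂ => ∑ e ∈ T.filter fun e => ∀ P ∈ I, wdeg P.1 e = 0,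
        f.coeff e.1 e.2 * mixedMonomial z e.1 e.2 :=
      ContDiff.sum fun e _ => contDiff_const.mul (contDiff_mixedMonomial _ _)
    exact h2.contDiffAt.differentiableAt (by simp)
  have hpd : DifferentiableAt ℝ (chartProj s.1) u :=
    contDiff_chartProj.contDiffAt.differentiableAt (by simp)
  have hsd : DifferentiableAt ℝ (shiftCoord K) a :=
    (contDiff_shiftCoord K).contDiffAt.differentiableAt (by simp)
  have h2 := (hfd.hasFDerivAt.comp u hpd.hasFDerivAt).comp a hsd.hasFDerivAt
  have h3 : (f.faceFunction Q ∘ chartProj s.1) ∘ shiftCoord K = fun v => (m v : ℂ) * (g ∘ p) v :=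
    funext hkey
  rw [h3] at h2
  -- as `g` vanishes at `a`, the derivative of the factor `m` does not contribute
  have h4 := h2.unique h1
  obtain ⟨η, hη⟩ := hnd Q hQpos w hwne hfw c
  obtain ⟨ξ, hξ⟩ := surjective_fderiv_chartProj hF hn hune hpd.hasFDerivAt η
  obtain ⟨δ, hδ⟩ := surjective_of_shiftCoord_ne_zero hune hsd.hasFDerivAt ξ
  refine ⟨p δ, hradp δ, ?_⟩
  have h5 := congrArg (fun L : ParamSpace s.1 →L[ℝ] ℂ => L δ) h4
  simp only [ContinuousLinearMap.comp_apply, hδ, hξ, hη, Function.comp, hpa, hga, hma,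
    add_apply, smul_apply] at h5
  simpa using h5.symm

end RegularFan

/-! ### The normal form -/

/-- Exchange: a linear functional which does not vanish on the subspace `{v | v_i = 0, i ∈ S}` can
replace one of the coordinates not in `S`. -/
theorem exists_exchange_coord {ι V : Type*} [Fintype ι] [DecidableEq ι] [NormedAddCommGroup V]
    [NormedSpace ℝ V] [FiniteDimensional ℝ V] (T : V ≃L[ℝ] (ι → ℝ)) (l : V →L[ℝ] ℝ) (S : Set ι)
    {v : V} (hv : ∀ i ∈ S, T v i = 0) (hl : l v ≠ 0) :
    ∃ k ∉ S, ∃ T' : V ≃L[ℝ] (ι → ℝ), ∀ w, T' w = Function.update (T w) k (l w) := by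
  have hsum : ∀ w, l w = ∑ i, T w i * l (T.symm (Pi.single i 1)) := by
    intro w
    conv_lhs => rw [← T.symm_apply_apply w, pi_eq_sum_univ' (T w)]
    simp only [map_sum, map_smul, smul_eq_mul]
  obtain ⟨k, -, hk⟩ := Finset.exists_ne_zero_of_sum_ne_zero (hsum v ▸ hl)
  refine ⟨k, fun hkS => hk (by rw [hv k hkS, zero_mul]), ?_⟩
  let L : V →ₗ[ℝ] (ι → ℝ) :=
    { toFun := fun w => Function.update (T w) k (l w)
      map_add' := fun w w' => by
        funext i
        by_cases h : i = k
        · subst h; simp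
        · simp [Function.update_of_ne h]
      map_smul' := fun c w => by
        funext i
        by_cases h : i = k
        · subst h; simp
        · simp [Function.update_of_ne h] }
  have hinj : Function.Injective L := by
    rw [injective_iff_map_eq_zero]
    intro w hw
    have h1 : ∀ i, i ≠ k → T w i = 0 := by
      intro i hi
      have : Function.update (T w) k (l w) i = 0 := congrFun hw i
      rwa [Function.update_of_ne hi] at this
    have h2 : l w = 0 := by
      have : Function.update (T w) k (l w) k = 0 := congrFun hw k
      rwa [Function.update_self] at this
    rw [hsum, Finset.sum_eq_single k (fun i _ hi => by rw [h1 i hi, zero_mul]) (by simp)] at h2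
    have h3 : T w k = 0 := (mul_eq_zero.1 h2).resolve_right (right_ne_zero_of_mul hk)
    have h4 : T w = 0 := by
      funext i
      by_cases hi : i = k
      · rw [hi, h3]; rfl
      · exact h1 i hi
    simpa using h4
  have hfin : Module.finrank ℝ V = Module.finrank ℝ (ι → ℝ) := T.toLinearEquiv.finrank_eq
  exact ⟨(LinearEquiv.ofInjectiveOfFinrankEq L hinj hfin).toContinuousLinearEquiv, fun w => rfl⟩

namespace RegularFan

variable {n : ℕ} {F : RegularFan n}

theorem blowupMap_polarMk {s : F.maxCones} {v : ParamSpace s.1}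
    (hv : v ∈ coordRegion polarPlane s.1) :
    F.blowupMap polarPlane (F.polarMk s v) = chartProj s.1 (polarCoord v) := by
  refine congrArg (chartProj s.1) (funext fun P => ?_)
  by_cases h : StrictlyPos P.1
  · refine (coord_polar_pos hv ⟨P, h⟩).trans ?_
    simp only [polarCoord, radius, angle, dif_pos h]
  · refine (coord_polar_nonpos v ⟨P, h⟩).trans ?_
    exact (show polarCoord v P = v.2 ⟨P, h⟩ from dif_neg h).symm

open Classical in
/-- The vertices on whose divisors the point with coordinates `a` lies. -/
def vanishing {s : Finset (Fin n → ℕ)} (a : ParamSpace s) : Finset (PosIdx s) :=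
  Finset.univ.filter fun P => (a.1 P).1 = 0

theorem mem_vanishing {s : Finset (Fin n → ℕ)} {a : ParamSpace s} {P : PosIdx s} :
    P ∈ vanishing a ↔ (a.1 P).1 = 0 := by
  simp [vanishing]

/-- Near an exceptional point, the pull-back of `f` is the product of the powers of the radii
prescribed by the Newton boundary and of a function which, on the intersection of the divisors, is a
submersion at its zeros. -/
theorem exists_local_factor {f : MixedFunction n} (hn : 1 ≤ n) (hnd : f.IsNondegenerate)
    (hconv : f.IsConvenient) (hF : F.IsGood) (hadm : F.IsAdmissible f) {s : F.maxCones}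
    {a : ParamSpace s.1} (hne : (vanishing a).Nonempty) :
    ∃ g : ParamSpace s.1 → ℂ, ContDiffAt ℝ ω g a ∧
      (∀ᶠ v in 𝓝 a, v ∈ coordRegion polarPlane s.1 →
        F.blowupMap polarPlane (F.polarMk s v) ∈ f.domain ∧
        f.toFun (F.blowupMap polarPlane (F.polarMk s v)) =
          ((∏ P ∈ vanishing a, (v.1 P).1 ^ f.minDegree P.1.1 : ℝ) : ℂ) * g v) ∧
      (g a = 0 → ∀ c, ∃ δ, (∀ P ∈ vanishing a, (δ.1 P).1 = 0) ∧ fderiv ℝ g a δ = c) := by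
  set J : Finset s.1 := (vanishing a).map (Function.Embedding.subtype _) with hJ
  have hmem : ∀ P : PosIdx s.1, P.1 ∈ J ↔ P ∈ vanishing a := by
    intro P
    simp only [hJ, Finset.mem_map, Function.Embedding.coe_subtype]
    exact ⟨fun ⟨Q, hQ, h⟩ => Subtype.ext h ▸ hQ, fun h => ⟨P, h, rfl⟩⟩
  have hrad : ∀ (v : ParamSpace s.1) (P : PosIdx s.1), radius v P.1 = (v.1 P).1 := fun v P =>
    dif_pos P.2
  have hJpos : ∀ P ∈ J, StrictlyPos P.1 := by
    intro P hP
    obtain ⟨Q, -, rfl⟩ := Finset.mem_map.1 hP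
    exact Q.2
  have hJall : ∀ v : ParamSpace s.1, (∀ P ∈ J, radius v P = 0) ↔ ∀ P ∈ vanishing a, (v.1 P).1 = 0 := by
    intro v
    constructor
    · intro h P hP
      rw [← hrad]
      exact h _ ((hmem P).2 hP)
    · intro h P hP
      obtain ⟨Q, hQ, rfl⟩ := Finset.mem_map.1 hP
      exact (hrad v Q).trans (h Q hQ)
  have hJne : J.Nonempty := hne.map
  have haJ := (hJall a).2 fun P hP => mem_vanishing.1 hP
  obtain ⟨g, T, hg, hT, hev, hgT⟩ := f.exists_factorization hJpos hJne haJ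
  refine ⟨g, hg, ?_, fun hga c => ?_⟩
  · filter_upwards [hev] with v hv hvC
    rw [blowupMap_polarMk hvC]
    refine ⟨hv.1, hv.2.trans ?_⟩
    rw [hJ, Finset.prod_map]
    simp only [Function.Embedding.coe_subtype, hrad]
  · obtain ⟨δ, h1, h2⟩ := exists_fderiv_factor_eq hn hnd hconv hF hadm hJpos hJne haJ
      (fun P hP hPJ h0 => hPJ ((hmem ⟨P, hP⟩).2 (mem_vanishing.2 (by rw [← hrad]; exact h0))))
      hg hT hgT hga c
    exact ⟨δ, (hJall δ).1 h1, h2⟩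

/-- The cofactor of the divisorial part does not vanish identically on a divisor near a point. -/
theorem frequently_factor_ne_zero {s : Finset (Fin n → ℕ)} {a : ParamSpace s}
    (ha : a ∈ coordRegion polarPlane s) {g : ParamSpace s → ℂ} (hg : ContDiffAt ℝ ω g a)
    (hsub : g a = 0 → ∀ c, ∃ δ, (∀ P ∈ vanishing a, (δ.1 P).1 = 0) ∧ fderiv ℝ g a δ = c)
    {P : PosIdx s} (hP : P ∈ vanishing a) :
    ∃ᶠ v in 𝓝 a, v ∈ coordRegion polarPlane s ∧ (v.1 P).1 = 0 ∧
      (∀ Q ∈ vanishing a, Q ≠ P → (v.1 Q).1 ≠ 0) ∧ g v ≠ 0 := by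
  classical
  set e : ParamSpace s := (fun Q => (if Q ∈ vanishing a ∧ Q ≠ P then 1 else 0, 0), 0) with he
  -- a direction pointing into the interior of the other divisors, along which `g` is not constant
  obtain ⟨δ, hδ0, hδ1, hδ2⟩ : ∃ δ : ParamSpace s, (δ.1 P).1 = 0 ∧
      (∀ Q ∈ vanishing a, Q ≠ P → 0 < (δ.1 Q).1) ∧ (g a = 0 → fderiv ℝ g a δ ≠ 0) := by
    by_cases h0 : g a = 0
    · obtain ⟨δ, h1, h2⟩ := hsub h0 1
      have h3 : ∃ η : ℝ, 0 < η ∧ 1 + η * fderiv ℝ g a e ≠ 0 := by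
        by_cases h4 : fderiv ℝ g a e = -1
        · exact ⟨2, by norm_num, by rw [h4]; norm_num⟩
        · refine ⟨1, one_pos, fun h5 => h4 ?_⟩
          rw [Complex.ofReal_one, one_mul] at h5
          exact eq_neg_of_add_eq_zero_right h5
      obtain ⟨η, hη, h5⟩ := h3
      refine ⟨δ + η • e, ?_, fun Q hQ hQP => ?_, fun _ => ?_⟩
      · simp [he, h1 P hP]
      · simp [he, h1 Q hQ, hQ, hQP, hη]
      · rw [map_add, h2, map_smul]
        exact h5
    · refine ⟨e, by simp [he], fun Q hQ hQP => ?_, fun h => absurd h h0⟩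
      simp [he, hQ, hQP]
  have hlin : HasDerivAt (fun t : ℝ => a + t • δ) δ 0 := by
    simpa using ((hasDerivAt_id (0 : ℝ)).smul_const δ).const_add a
  have ht : Filter.Tendsto (fun t : ℝ => a + t • δ) (𝓝[>] 0) (𝓝 a) := by
    have h := hlin.continuousAt.tendsto
    simp only [zero_smul, add_zero] at h
    exact h.mono_left nhdsWithin_le_nhds
  refine ht.frequently (Filter.Eventually.frequently ?_)
  have hgne : ∀ᶠ t in 𝓝[>] (0 : ℝ), g (a + t • δ) ≠ 0 := by
    by_cases h0 : g a = 0
    · have h1 : HasFDerivAt g (fderiv ℝ g a) (a + (0 : ℝ) • δ) := by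
        rw [zero_smul, add_zero]
        exact (hg.differentiableAt (by simp)).hasFDerivAt
      have h2 := (h1.comp_hasDerivAt 0 hlin).eventually_ne (c := 0) (hδ2 h0)
      exact h2.filter_mono (nhdsWithin_mono _ fun t (ht : 0 < t) => ht.ne')
    · exact ht.eventually (hg.continuousAt.eventually_ne h0)
  have hreg : ∀ᶠ t in 𝓝[>] (0 : ℝ), ∀ Q : PosIdx s, Q ∉ vanishing a → 0 < ((a + t • δ).1 Q).1 := by
    refine Filter.eventually_all.2 fun Q => ?_
    by_cases hQ : Q ∈ vanishing a
    · exact Filter.Eventually.of_forall fun t h => absurd hQ h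
    · have h1 : 0 < (a.1 Q).1 := lt_of_le_of_ne (ha Q) fun h => hQ (mem_vanishing.2 h.symm)
      have h2 : Continuous fun v : ParamSpace s => (v.1 Q).1 := by fun_prop
      exact (ht.eventually (h2.continuousAt.eventually_const_lt h1)).mono fun t h _ => h
  filter_upwards [hgne, hreg, self_mem_nhdsWithin] with t h1 h2 h3
  have h3' : 0 < t := h3
  have hQ0 : ∀ Q ∈ vanishing a, ((a + t • δ).1 Q).1 = t * (δ.1 Q).1 := by
    intro Q hQ
    simp [mem_vanishing.1 hQ]
  refine ⟨fun Q => ?_, ?_, fun Q hQ hQP => ?_, h1⟩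
  · by_cases hQ : Q ∈ vanishing a
    · change 0 ≤ ((a + t • δ).1 Q).1
      rw [hQ0 Q hQ]
      by_cases hQP : Q = P
      · rw [hQP, hδ0, mul_zero]
      · exact mul_nonneg h3'.le (hδ1 Q hQ hQP).le
    · exact (h2 Q hQ).le
  · rw [hQ0 P hP, hδ0, mul_zero]
  · rw [hQ0 Q hQ]
    exact (mul_pos h3' (hδ1 Q hQ hQP)).ne'

/-- Coordinates that contain the real and imaginary parts of a function with surjective derivative
along the intersection of the divisors. -/
theorem exists_coord_of_submersion {s : F.maxCones} {a : ParamSpace s.1} {g : ParamSpace s.1 → ℂ}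
    (hg : ContDiffAt ℝ ω g a) (hga : g a = 0)
    (hsub : ∀ c, ∃ δ, (∀ P ∈ vanishing a, (δ.1 P).1 = 0) ∧ fderiv ℝ g a δ = c) :
    ∃ (φ : ParamSpace s.1 → Fin (2 * n) → ℝ) (B : ParamSpace s.1 ≃L[ℝ] (Fin (2 * n) → ℝ))
      (k l : Fin (2 * n)), ContDiffAt ℝ ω φ a ∧
      HasFDerivAt φ (B : ParamSpace s.1 →L[ℝ] (Fin (2 * n) → ℝ)) a ∧ φ a = 0 ∧
      (∀ P ∈ vanishing a, ∀ v, φ v (radIdx s P) = (v.1 P).1) ∧ k ≠ l ∧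
      (∀ P ∈ vanishing a, k ≠ radIdx s P ∧ l ≠ radIdx s P) ∧
      (∀ v, φ v k = (g v).re) ∧ ∀ v, φ v l = (g v).im := by
  classical
  set S : Set (Fin (2 * n)) := radIdx s '' {P | P ∈ vanishing a} with hS
  obtain ⟨δ₁, h1, h1'⟩ := hsub 1
  obtain ⟨δ₂, h2, h2'⟩ := hsub Complex.I
  have hgd := (hg.differentiableAt (by simp)).hasFDerivAt
  have hnum : ∀ δ : ParamSpace s.1, (∀ P ∈ vanishing a, (δ.1 P).1 = 0) →
      ∀ i ∈ S, numCoord s δ i = 0 := by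
    rintro δ hδ _ ⟨P, hP, rfl⟩
    rw [numCoord_radIdx, hδ P hP]
  obtain ⟨k, hk, T₁, hT₁⟩ := exists_exchange_coord (numCoord s)
    (Complex.reCLM.comp (fderiv ℝ g a)) S (hnum δ₁ h1) (by simp [h1'])
  obtain ⟨l, hl, B, hB⟩ := exists_exchange_coord T₁ (Complex.imCLM.comp (fderiv ℝ g a))
    (insert k S) (v := δ₂) (by
      rintro i (rfl | hi)
      · rw [hT₁, Function.update_self]
        simp [h2']
      · rw [hT₁, Function.update_of_ne (show i ≠ k from fun h => hk (h ▸ hi))]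
        exact hnum δ₂ h2 i hi) (by simp [h2'])
  have hlk : l ≠ k := fun h => hl (h ▸ Set.mem_insert k S)
  have hlS : l ∉ S := fun h => hl (Set.mem_insert_of_mem k h)
  set φ : ParamSpace s.1 → Fin (2 * n) → ℝ := fun v =>
    Function.update (Function.update (numCoord s v - numCoord s a) k (g v).re) l (g v).im with hφ
  have hφl : ∀ v, φ v l = (g v).im := fun v => Function.update_self _ _ _
  have hφk : ∀ v, φ v k = (g v).re := fun v => by
    simp only [hφ]
    rw [Function.update_of_ne hlk.symm, Function.update_self]
  have hφi : ∀ v i, i ≠ k → i ≠ l → φ v i = numCoord s v i - numCoord s a i := fun v i hi hi' => by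
    simp only [hφ]
    rw [Function.update_of_ne hi', Function.update_of_ne hi, Pi.sub_apply]
  have hre : ContDiffAt ℝ ω (fun v => (g v).re) a := Complex.reCLM.contDiff.contDiffAt.comp a hg
  have him : ContDiffAt ℝ ω (fun v => (g v).im) a := Complex.imCLM.contDiff.contDiffAt.comp a hg
  refine ⟨φ, B, k, l, contDiffAt_pi.2 fun i => ?_, hasFDerivAt_pi'' fun i => ?_, ?_, ?_,
    hlk.symm, ?_, hφk, hφl⟩
  · by_cases hil : i = l
    · subst hil
      exact him.congr_of_eventuallyEq (Filter.Eventually.of_forall hφl)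
    by_cases hik : i = k
    · subst hik
      exact hre.congr_of_eventuallyEq (Filter.Eventually.of_forall hφk)
    · have : ContDiff ℝ ω fun v => numCoord s v i - numCoord s a i :=
        (contDiff_pi.1 (numCoord s).contDiff i).sub contDiff_const
      exact this.contDiffAt.congr_of_eventuallyEq
        (Filter.Eventually.of_forall fun v => hφi v i hik hil)
  · by_cases hil : i = l
    · subst hil
      have h3 := (Complex.imCLM.hasFDerivAt.comp a hgd).congr_of_eventuallyEq
        (Filter.Eventually.of_forall hφl)
      refine h3.congr_fderiv ?_
      refine ContinuousLinearMap.ext fun v => ?_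
      change _ = B v i
      rw [hB, Function.update_self]
    by_cases hik : i = k
    · subst hik
      have h3 := (Complex.reCLM.hasFDerivAt.comp a hgd).congr_of_eventuallyEq
        (Filter.Eventually.of_forall hφk)
      refine h3.congr_fderiv ?_
      refine ContinuousLinearMap.ext fun v => ?_
      change _ = B v i
      rw [hB, Function.update_of_ne hil, hT₁, Function.update_self]
    · have h3 : HasFDerivAt (fun v => numCoord s v i - numCoord s a i)
          ((ContinuousLinearMap.proj (R := ℝ) (φ := fun _ : Fin (2 * n) => ℝ) i).comp
            (numCoord s : ParamSpace s.1 →L[ℝ] (Fin (2 * n) → ℝ))) a :=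
        ((ContinuousLinearMap.proj (R := ℝ) (φ := fun _ : Fin (2 * n) => ℝ) i).comp
          (numCoord s : ParamSpace s.1 →L[ℝ] (Fin (2 * n) → ℝ))).hasFDerivAt.sub_const
            (numCoord s a i)
      have h4 := h3.congr_of_eventuallyEq
        (Filter.Eventually.of_forall fun v => hφi v i hik hil)
      refine h4.congr_fderiv ?_
      refine ContinuousLinearMap.ext fun v => ?_
      change numCoord s v i = B v i
      rw [hB, Function.update_of_ne hil, hT₁, Function.update_of_ne hik]
  · funext i
    by_cases hil : i = l
    · rw [hil, hφl, hga]; rfl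
    by_cases hik : i = k
    · rw [hik, hφk, hga]; rfl
    · rw [hφi a i hik hil, sub_self]; rfl
  · intro P hP v
    have hPS : radIdx s P ∈ S := ⟨P, hP, rfl⟩
    rw [hφi v _ (fun h => hk (h ▸ hPS)) (fun h => hlS (h ▸ hPS)), numCoord_radIdx,
      numCoord_radIdx, mem_vanishing.1 hP, sub_zero]
  · intro P hP
    exact ⟨fun h => hk ⟨P, hP, h.symm⟩, fun h => hlS ⟨P, hP, h.symm⟩⟩

end RegularFan

/-! ### The strict transform and the multiplicities -/

/-- In coordinates in which `f ∘ Φ` is a divisorial part times `u_k + i u_l`, the strict transform is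
the plane `u_k = u_l = 0`: a point of this plane is the limit of points of the plane which are
interior points of the corner. -/
theorem inter_strictTransform_eq {n : ℕ} {Y : Type*} [TopologicalSpace Y]
    [ChartedSpace (EuclideanQuadrant (2 * n)) Y] {f : MixedFunction n} {Φ : Y → Fin n → ℂ} {x : Y}
    {S : Set (Fin (2 * n))} {U : Set Y} {u : Y → Fin (2 * n) → ℝ} (h : IsCenteredCoord x S U u)
    {k l : Fin (2 * n)} (hk : k ∉ S) (hl : l ∉ S) (hz : ∀ y ∈ U, Φ y = 0 ↔ ∃ i ∈ S, u y i = 0)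
    (hdom : ∀ y ∈ U, Φ y ∈ f.domain) {q : Y → ℂ} (hq : ∀ y ∈ U, q y = 0 → Φ y = 0)
    (hf : ∀ y ∈ U, f.toFun (Φ y) = q y * ((u y k : ℂ) + Complex.I * (u y l : ℂ))) :
    U ∩ strictTransform f Φ = {y | y ∈ U ∧ u y k = 0 ∧ u y l = 0} := by
  classical
  obtain ⟨-, -, g, hg⟩ := h
  have hzero : ∀ y, ((u y k : ℂ) + Complex.I * (u y l : ℂ)) = 0 ↔ u y k = 0 ∧ u y l = 0 := by
    intro y
    rw [mul_comm, Complex.ext_iff]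
    simp
  ext y
  refine and_congr_right fun hy => ?_
  constructor
  · intro hyV
    by_contra hne
    rw [← hzero] at hne
    have hcont : ContinuousAt (fun y => ((u y k : ℂ) + Complex.I * (u y l : ℂ))) y := by
      have hc := (hg.contMDiffAt hy).continuousAt
      exact (Complex.continuous_ofReal.continuousAt.comp (continuousAt_pi.1 hc k)).add
        (continuousAt_const.mul (Complex.continuous_ofReal.continuousAt.comp (continuousAt_pi.1 hc l)))
    have hev := (hcont.eventually_ne hne).and (hg.isOpen.mem_nhds hy)
    obtain ⟨y', ⟨⟨-, h1⟩, h2⟩, h3, h4⟩ := ((mem_closure_iff_frequently.1 hyV).and_eventually hev).exists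
    rw [hf y' h4] at h1
    exact h2 (hq y' h4 ((mul_eq_zero.1 h1).resolve_right h3))
  · rintro ⟨hyk, hyl⟩
    set e : Fin (2 * n) → ℝ := fun i => if i ∈ S then 1 else 0 with he
    have hC : ∀ t : ℝ, 0 < t → ∀ i ∈ S, 0 < (u y + t • e) i := by
      intro t ht i hi
      have h1 : 0 ≤ u y i := hg.mem hy i hi
      simp only [Pi.add_apply, Pi.smul_apply, he, if_pos hi, smul_eq_mul, mul_one]
      exact add_pos_of_nonneg_of_pos h1 ht
    have ht : Filter.Tendsto (fun t : ℝ => u y + t • e) (𝓝[>] 0) (𝓝 (u y)) := by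
      have h1 : Continuous fun t : ℝ => u y + t • e := by fun_prop
      have h2 := h1.tendsto 0
      simp only [zero_smul, add_zero] at h2
      exact h2.mono_left nhdsWithin_le_nhds
    have htC : Filter.Tendsto (fun t : ℝ => u y + t • e) (𝓝[>] 0)
        (𝓝[{v | ∀ i ∈ S, 0 ≤ v i}] (u y)) :=
      tendsto_nhdsWithin_iff.2 ⟨ht, by
        filter_upwards [self_mem_nhdsWithin] with t h1 i hi using (hC t h1 i hi).le⟩
    have hgt : Filter.Tendsto (fun t : ℝ => g (u y + t • e)) (𝓝[>] 0) (𝓝 y) := by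
      have h1 := (hg.contMDiffWithinAt_symm hy).continuousWithinAt.tendsto.comp htC
      rwa [hg.left_inv y hy] at h1
    refine mem_closure_of_tendsto hgt ?_
    filter_upwards [ht.eventually (hg.eventually_mem_image hy), self_mem_nhdsWithin] with t h1 h2
    have h3 := h1 fun i hi => (hC t h2 i hi).le
    have h4 := hg.symm_mem h3
    have h5 := hg.right_inv h3
    refine ⟨⟨hdom _ h4, ?_⟩, fun h6 => ?_⟩
    · rw [hf _ h4, (hzero _).2, mul_zero]
      rw [h5]
      simp [he, hk, hl, hyk, hyl]
    · obtain ⟨i, hi, h7⟩ := (hz _ h4).1 h6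
      rw [h5] at h7
      exact (hC t h2 i hi).ne' h7

namespace RegularFan

variable {n : ℕ} {F : RegularFan n} [ChartedSpace (EuclideanQuadrant (2 * n)) F.PolarBlowup]
  {f : MixedFunction n}

/-- The normal form of the pull-back of `f` at an exceptional point of the strict transform. -/
theorem exists_normal_coordinates (hn : 1 ≤ n) (hnd : f.IsNondegenerate) (hconv : f.IsConvenient)
    (hF : F.IsGood) (hadm : F.IsAdmissible f) (hI : F.IsBlowupStructure polarPlane (cornerModel n))
    {x : F.PolarBlowup} (hx : x ∈ strictTransform f (F.blowupMap polarPlane))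
    (h0 : F.blowupMap polarPlane x = 0) :
    ∃ (s : F.maxCones) (A : Finset (PosIdx s.1)) (k l : Fin (2 * n)) (U : Set F.PolarBlowup)
      (w : F.PolarBlowup → Fin (2 * n) → ℝ),
      IsCenteredCoord x (radIdx s '' A) U w ∧ k ≠ l ∧ k ∉ radIdx s '' (A : Set (PosIdx s.1)) ∧
      l ∉ radIdx s '' (A : Set (PosIdx s.1)) ∧
      (∀ (P : Fin n → ℕ) (hP : StrictlyPos P), x ∈ F.blowupDivisor polarPlane P ↔
        ∃ h : P ∈ s.1, (⟨⟨P, h⟩, hP⟩ : PosIdx s.1) ∈ A) ∧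
      (∀ P ∈ A, U ∩ F.blowupDivisor polarPlane P.1.1 = {y | y ∈ U ∧ w y (radIdx s P) = 0}) ∧
      U ∩ strictTransform f (F.blowupMap polarPlane) = {y | y ∈ U ∧ w y k = 0 ∧ w y l = 0} ∧
      F.blowupMap polarPlane '' U ⊆ f.domain ∧
      ∀ y ∈ U, f.toFun (F.blowupMap polarPlane y) =
        ((∏ P ∈ A, w y (radIdx s P) ^ f.minDegree P.1.1 : ℝ) : ℂ) *
          ((w y k : ℂ) + Complex.I * (w y l : ℂ)) := by
  obtain ⟨s, U, u, hxU, h⟩ := exists_polarCoord hI x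
  have hzero : ∀ y ∈ U, F.blowupMap polarPlane y = 0 ↔ ∃ P, ((u y).1 P).1 = 0 := by
    intro y hy
    rw [← blowupMap_polarMk_eq_zero_iff hF (h.mem hy), h.left_inv y hy]
  obtain ⟨P₀, hP₀⟩ := (hzero x hxU).1 h0
  obtain ⟨g, hg, hfac, hsub⟩ := exists_local_factor hn hnd hconv hF hadm (s := s) (a := u x)
    ⟨P₀, mem_vanishing.2 hP₀⟩
  have hprod : ∀ v : ParamSpace s.1,
      (((∏ P ∈ vanishing (u x), (v.1 P).1 ^ f.minDegree P.1.1 : ℝ) : ℂ)) = 0 →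
        ∃ P, (v.1 P).1 = 0 := by
    intro v hv
    obtain ⟨P, -, hP⟩ := Finset.prod_eq_zero_iff.1 (Complex.ofReal_eq_zero.1 hv)
    exact ⟨P, eq_zero_of_pow_eq_zero hP⟩
  -- away from the zeros of `g` the pull-back of `f` vanishes only on the exceptional set
  have hga : g (u x) = 0 := by
    by_contra hga
    have hev := (h.contMDiffAt hxU).continuousAt.eventually
      (hfac.and (hg.continuousAt.eventually_ne hga))
    obtain ⟨y, ⟨⟨-, h1⟩, h2⟩, ⟨h3, h4⟩, h5⟩ := ((mem_closure_iff_frequently.1 hx).and_eventually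
      (hev.and (h.isOpen.mem_nhds hxU))).exists
    have h6 := (h3 (h.mem h5)).2
    rw [h.left_inv y h5, h1] at h6
    exact h2 ((hzero y h5).2 (hprod _ ((mul_eq_zero.1 h6.symm).resolve_right h4)))
  obtain ⟨φ, B, k, l, hφ, hB, hφ0, hr, hkl, hklA, hφk, hφl⟩ :=
    exists_coord_of_submersion hg hga (hsub hga)
  obtain ⟨U', hU', hc, hU'O⟩ := exists_centeredCoord h hxU hφ hB hφ0
    (fun P hP v => hr P (mem_vanishing.2 hP) v) hfac
  have hS : radIdx s '' {P | ((u x).1 P).1 = 0} =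
      radIdx s '' (vanishing (u x) : Set (PosIdx s.1)) := by
    congr 1
    ext P
    exact mem_vanishing.symm
  rw [hS] at hc
  have hkS : k ∉ radIdx s '' (vanishing (u x) : Set (PosIdx s.1)) := by
    rintro ⟨P, hP, h1⟩
    exact (hklA P hP).1 h1.symm
  have hlS : l ∉ radIdx s '' (vanishing (u x) : Set (PosIdx s.1)) := by
    rintro ⟨P, hP, h1⟩
    exact (hklA P hP).2 h1.symm
  have hz : ∀ y ∈ U', F.blowupMap polarPlane y = 0 ↔
      ∃ i ∈ radIdx s '' (vanishing (u x) : Set (PosIdx s.1)), (φ ∘ u) y i = 0 := by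
    intro y hy
    rw [hzero y (hU' hy)]
    constructor
    · rintro ⟨P, hP⟩
      have hPA : P ∈ vanishing (u x) := by
        by_contra hPA
        exact (hU'O y hy).2 P (fun h => hPA (mem_vanishing.2 h)) hP
      exact ⟨_, ⟨P, hPA, rfl⟩, (hr P hPA _).trans hP⟩
    · rintro ⟨_, ⟨P, hPA, rfl⟩, hP⟩
      exact ⟨P, (hr P hPA _).symm.trans hP⟩
  have hval : ∀ y ∈ U', F.blowupMap polarPlane y ∈ f.domain ∧
      f.toFun (F.blowupMap polarPlane y) =
        ((∏ P ∈ vanishing (u x), (φ ∘ u) y (radIdx s P) ^ f.minDegree P.1.1 : ℝ) : ℂ) *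
          (((φ ∘ u) y k : ℂ) + Complex.I * ((φ ∘ u) y l : ℂ)) := by
    intro y hy
    have h1 := (hU'O y hy).1 (h.mem (hU' hy))
    rw [h.left_inv y (hU' hy)] at h1
    refine ⟨h1.1, h1.2.trans ?_⟩
    congr 1
    · exact congrArg _ (Finset.prod_congr rfl fun P hP => by rw [Function.comp, hr P hP])
    · simp only [Function.comp, hφk, hφl]
      rw [mul_comm Complex.I, Complex.re_add_im]
  refine ⟨s, vanishing (u x), k, l, U', φ ∘ u, hc, hkl, hkS, hlS, fun P hP => ?_, fun P hP => ?_,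
    ?_, ?_, fun y hy => (hval y hy).2⟩
  · rw [h.mem_divisor_iff hxU hP]
    simp only [mem_vanishing]
  · ext y
    refine and_congr_right fun hy => ?_
    rw [h.mem_divisor_iff (hU' hy) P.2, Function.comp, hr P hP]
    exact ⟨fun ⟨_, h⟩ => h, fun h => ⟨P.1.2, h⟩⟩
  · refine inter_strictTransform_eq hc hkS hlS hz (fun y hy => (hval y hy).1)
      (fun y hy h1 => ?_) fun y hy => (hval y hy).2
    refine (hzero y (hU' hy)).2 (hprod (u y) ?_)
    rw [← h1]
    exact congrArg _ (Finset.prod_congr rfl fun P hP => by rw [Function.comp, hr P hP])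
  · rintro _ ⟨y, hy, rfl⟩
    exact (hval y hy).1

/-- The pull-back of `f` has multiplicity `d(P; f)` along the divisor of `P`. -/
theorem hasMultiplicityAlong_blowupDivisor (hn : 1 ≤ n) (hnd : f.IsNondegenerate)
    (hconv : f.IsConvenient) (hF : F.IsGood) (hadm : F.IsAdmissible f)
    (hI : F.IsBlowupStructure polarPlane (cornerModel n)) {P : Fin n → ℕ} (hP : StrictlyPos P) :
    HasMultiplicityAlong (n := n) (fun y => f.toFun (F.blowupMap polarPlane y))
      (F.blowupDivisor polarPlane P) (f.minDegree P) := by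
  classical
  intro x hx
  obtain ⟨s, U, u, hxU, h⟩ := exists_polarCoord hI x
  obtain ⟨hPs, hx0⟩ := (h.mem_divisor_iff hxU hP).1 hx
  set P' : PosIdx s.1 := ⟨⟨P, hPs⟩, hP⟩ with hP'
  have hP'A : P' ∈ vanishing (u x) := mem_vanishing.2 hx0
  obtain ⟨g, hg, hfac, hsub⟩ := exists_local_factor hn hnd hconv hF hadm (s := s) (a := u x)
    ⟨P', hP'A⟩
  obtain ⟨U', hU', hc, hU'O⟩ := exists_centeredCoord h hxU
    (φ := fun v => numCoord s v - numCoord s (u x)) (B := numCoord s)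
    ((numCoord s).contDiff.contDiffAt.sub contDiffAt_const)
    ((numCoord s).hasFDerivAt.sub_const _) (sub_self _)
    (fun P hP v => by rw [Pi.sub_apply, numCoord_radIdx, numCoord_radIdx, hP, sub_zero])
    (hfac.and (hg.eventually (by simp)))
  have hcoord : ∀ y, ((fun v => numCoord s v - numCoord s (u x)) ∘ u) y (radIdx s P') =
      ((u y).1 P').1 := by
    intro y
    rw [Function.comp, Pi.sub_apply, numCoord_radIdx, numCoord_radIdx, hx0, sub_zero]
  set Q : ParamSpace s.1 → ℂ := fun v =>
    ((∏ R ∈ (vanishing (u x)).erase P', (v.1 R).1 ^ f.minDegree R.1.1 : ℝ) : ℂ) * g v with hQ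
  have hD : U' ∩ F.blowupDivisor polarPlane P =
      {y | y ∈ U' ∧ ((fun v => numCoord s v - numCoord s (u x)) ∘ u) y (radIdx s P') = 0} := by
    ext y
    refine and_congr_right fun hy => ?_
    rw [h.mem_divisor_iff (hU' hy) hP, hcoord]
    exact ⟨fun ⟨_, h⟩ => h, fun h => ⟨hPs, h⟩⟩
  obtain ⟨hxU', -, g', hg'⟩ := id hc
  refine ⟨_, U', _, radIdx s P', Q ∘ u, hc, ⟨P', hx0, rfl⟩, hD, fun y hy => ?_, fun y hy => ?_, ?_⟩
  · have h1 : ContDiffAt ℝ ω Q (u y) := by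
      have h2 : ContDiff ℝ ω fun v : ParamSpace s.1 =>
          (∏ R ∈ (vanishing (u x)).erase P', (v.1 R).1 ^ f.minDegree R.1.1 : ℝ) := by
        refine contDiff_prod fun R _ => ContDiff.pow ?_ _
        exact contDiff_fst.comp ((contDiff_apply ℝ (ℝ × ℝ) R).comp contDiff_fst)
      exact (Complex.ofRealCLM.contDiff.comp h2).contDiffAt.mul (hU'O y hy).1.2
    exact (h1.contMDiffAt.comp y (h.contMDiffAt (hU' hy))).contMDiffWithinAt
  · have h1 := ((hU'O y hy).1.1 (h.mem (hU' hy))).2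
    rw [h.left_inv y (hU' hy)] at h1
    refine h1.trans ?_
    rw [hcoord, ← Finset.mul_prod_erase _ _ hP'A, Function.comp, hQ]
    push_cast
    ring
  · -- approach `x` along the divisor, in the chart
    have hmk : F.polarMk s (u x) = x := h.left_inv x hxU
    have hfr := frequently_factor_ne_zero (h.mem hxU) hg hsub hP'A
    have hev : ∀ᶠ v in 𝓝 (u x), F.polarMk s v ∈ U' := by
      have h1 : U' ∈ 𝓝 (F.polarMk s (u x)) := by
        rw [hmk]
        exact hg'.isOpen.mem_nhds hxU'
      exact (continuous_polarMk s).continuousAt.eventually h1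
    have ht : Filter.Tendsto (F.polarMk s) (𝓝 (u x)) (𝓝 x) := by
      have h1 := (continuous_polarMk s).tendsto (u x)
      rwa [hmk] at h1
    refine mem_closure_iff_frequently.2 (ht.frequently ?_)
    refine (hfr.and_eventually (hev.and (h.eventually_mem_image hxU))).mono ?_
    rintro v ⟨⟨hv, hvP, hvR, hgv⟩, hvU', hvim⟩
    refine ⟨hvU', (polarMk_mem_divisor_iff hv hP).2 ⟨hPs, hvP⟩, ?_⟩
    rw [Function.comp, h.right_inv (hvim hv), hQ]
    refine mul_ne_zero (Complex.ofReal_ne_zero.2 (Finset.prod_ne_zero_iff.2 fun R hR => ?_)) hgv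
    exact pow_ne_zero _ (hvR R (Finset.mem_of_mem_erase hR) (Finset.ne_of_mem_erase hR))

end RegularFan

/-! ### The resolution -/

namespace RegularFan

variable {n : ℕ} {F : RegularFan n} [ChartedSpace (EuclideanQuadrant (2 * n)) F.PolarBlowup]
  {f : MixedFunction n}

theorem smooth_strictTransform (hn : 1 ≤ n) (hnd : f.IsNondegenerate) (hconv : f.IsConvenient)
    (hF : F.IsGood) (hadm : F.IsAdmissible f)
    (hI : F.IsBlowupStructure polarPlane (cornerModel n)) :
    ∃ O : Set F.PolarBlowup, IsOpen O ∧ F.blowupMap polarPlane ⁻¹' {0} ⊆ O ∧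
      ∀ x ∈ strictTransform f (F.blowupMap polarPlane) ∩ O,
      ∃ (S : Set (Fin (2 * n))) (U : Set F.PolarBlowup) (u : F.PolarBlowup → Fin (2 * n) → ℝ)
        (k l : Fin (2 * n)), IsCenteredCoord x S U u ∧ k ≠ l ∧ k ∉ S ∧ l ∉ S ∧
        U ∩ strictTransform f (F.blowupMap polarPlane) = {y | y ∈ U ∧ u y k = 0 ∧ u y l = 0} := by
  set V := strictTransform f (F.blowupMap polarPlane) with hV
  -- the points of the strict transform in a coordinate system centered at an exceptional point
  set W : Set F.PolarBlowup := ⋃₀ {U | ∃ (x : F.PolarBlowup) (S : Set (Fin (2 * n)))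
    (u : F.PolarBlowup → Fin (2 * n) → ℝ) (k l : Fin (2 * n)), IsCenteredCoord x S U u ∧ k ≠ l ∧
      k ∉ S ∧ l ∉ S ∧ U ∩ V = {y | y ∈ U ∧ u y k = 0 ∧ u y l = 0}} with hW
  have hWo : IsOpen W := by
    refine isOpen_sUnion ?_
    rintro U ⟨x, S, u, k, l, ⟨-, -, g, hg⟩, -⟩
    exact hg.isOpen
  have hVc : IsClosed V := isClosed_closure
  refine ⟨W ∪ Vᶜ, hWo.union hVc.isOpen_compl, fun x hx => ?_, ?_⟩
  · by_cases hxV : x ∈ V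
    · obtain ⟨s, A, k, l, U, w, hc, hkl, hk, hl, -, -, hUV, -⟩ :=
        exists_normal_coordinates hn hnd hconv hF hadm hI hxV hx
      exact Or.inl ⟨U, ⟨x, _, w, k, l, hc, hkl, hk, hl, hUV⟩, hc.1⟩
    · exact Or.inr hxV
  · rintro y ⟨hyV, hyW | hyV'⟩
    · obtain ⟨U, ⟨x, S, u, k, l, hc, hkl, hk, hl, hUV⟩, hyU⟩ := hyW
      obtain ⟨-, hyk, hyl⟩ : y ∈ {y | y ∈ U ∧ u y k = 0 ∧ u y l = 0} := hUV ▸ ⟨hyU, hyV⟩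
      obtain ⟨U', hU', hc'⟩ := hc.recenter hyU
      refine ⟨_, U', _, k, l, hc', hkl, fun h => hk h.1, fun h => hl h.1, ?_⟩
      ext z
      refine and_congr_right fun hz => ?_
      have h1 : z ∈ U ∩ V ↔ z ∈ {y | y ∈ U ∧ u y k = 0 ∧ u y l = 0} := by rw [hUV]
      simp only [Pi.sub_apply, hyk, hyl, sub_zero]
      exact ⟨fun h => (h1.1 ⟨hU' hz, h⟩).2, fun h => (h1.2 ⟨hU' hz, h⟩).2⟩
    · exact absurd hyV hyV'

/-- The polar modification is a good resolution of polar type. -/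
theorem isPolarResolution_blowupMap [IsManifold (cornerModel n) ω F.PolarBlowup] (hn : 1 ≤ n)
    (hnd : f.IsNondegenerate) (hconv : f.IsConvenient) (hF : F.IsGood) (hadm : F.IsAdmissible f)
    (hI : F.IsBlowupStructure polarPlane (cornerModel n))
    (hbd : ∀ y : F.PolarBlowup, ∃ (s : F.maxCones) (a : ParamSpace s.1), (∀ P, 0 ≤ (a.1 P).1) ∧
      F.blowupParam polarPlane s (fun _ => polarParam) a = y ∧
        (y ∈ (cornerModel n).boundary F.PolarBlowup ↔ ∃ P, (a.1 P).1 = 0)) :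
    IsPolarResolution f (F.blowupMap polarPlane)
      (fun P : F.posVertices => F.blowupDivisor polarPlane P.1) (fun P => f.minDegree P.1) := by
  classical
  have hinj : ∀ P Q : F.posVertices,
      F.blowupDivisor polarPlane P.1 ⊆ F.blowupDivisor polarPlane Q.1 → P = Q := fun P Q h =>
    Subtype.ext ((blowupDivisor_subset_iff P.2).1 h)
  have hunion : F.blowupMap polarPlane ⁻¹' {0} =
      ⋃ P : F.posVertices, F.blowupDivisor polarPlane P.1 := by
    ext y
    rw [Set.mem_iUnion]
    refine (blowupMap_eq_zero_iff hF y).trans ?_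
    exact ⟨fun ⟨P, hP, h⟩ => ⟨⟨P, hP⟩, h⟩, fun ⟨P, h⟩ => ⟨P.1, P.2, h⟩⟩
  have hpos : ∀ P : F.posVertices, StrictlyPos P.1 := fun P => (mem_posVertices_iff.1 P.2).2
  refine
    { manifold := inferInstance
      t2 := F.t2Space_blowup polarAnalytic
      secondCountable := F.secondCountable_blowup polarAnalytic
      proper := isProperMap_blowupMap
      analytic := contMDiff_blowupMap polarAnalytic hI
      injective := fun P Q h => hinj P Q h.le
      components := isIrredComponent_iff
        (fun P => isIrreducibleAnalytic_blowupDivisor hI P.2) hunion hinj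
      union := hunion
      smooth_divisor := fun P x hx => smooth_blowupDivisor hI (hpos P) hx
      boundary := ?_
      diffeo := exists_inverse_blowupMap hF polarAnalytic hI
      smooth_strict := smooth_strictTransform hn hnd hconv hF hadm hI
      normal_form := ?_ }
  · ext y
    obtain ⟨s, a, ha, rfl, h⟩ := hbd y
    exact h.trans (blowupMap_polarMk_eq_zero_iff hF ha).symm
  · rintro x ⟨hxV, hx0⟩ J hJ
    obtain ⟨s, A, k, l, U, w, hc, hkl, hk, hl, hA, hAU, hUV, hdom, hf⟩ :=
      exists_normal_coordinates hn hnd hconv hF hadm hI hxV hx0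
    set κ : F.posVertices → Fin (2 * n) := fun P =>
      if h : P.1 ∈ s.1 then radIdx s ⟨⟨P.1, h⟩, hpos P⟩ else k with hκ
    have hκA : ∀ P ∈ J, ∃ Q ∈ A, Q.1.1 = P.1 ∧ κ P = radIdx s Q := by
      intro P hP
      obtain ⟨h, hPA⟩ := (hA P.1 (hpos P)).1 ((hJ P).1 hP)
      exact ⟨_, hPA, rfl, dif_pos h⟩
    have hAκ : ∀ Q ∈ A, ∃ P ∈ J, Q.1.1 = P.1 ∧ κ P = radIdx s Q := by
      intro Q hQ
      refine ⟨⟨Q.1.1, mem_posVertices_iff.2 ⟨⟨s, Q.1.2⟩, Q.2⟩⟩, (hJ _).2 ?_, rfl, dif_pos Q.1.2⟩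
      exact (hA Q.1.1 Q.2).2 ⟨Q.1.2, hQ⟩
    have himage : κ '' (J : Set F.posVertices) = radIdx s '' (A : Set (PosIdx s.1)) := by
      ext i
      constructor
      · rintro ⟨P, hP, rfl⟩
        obtain ⟨Q, hQ, -, h⟩ := hκA P hP
        exact ⟨Q, hQ, h.symm⟩
      · rintro ⟨Q, hQ, rfl⟩
        obtain ⟨P, hP, -, h⟩ := hAκ Q hQ
        exact ⟨P, hP, h⟩
    have hκinj : Set.InjOn κ (J : Set F.posVertices) := by
      intro P hP P' hP' h
      obtain ⟨Q, -, h1, h2⟩ := hκA P hP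
      obtain ⟨Q', -, h1', h2'⟩ := hκA P' hP'
      have h3 : Q = Q' := radIdx_injective s (h2.symm.trans (h.trans h2'))
      exact Subtype.ext (by rw [← h1, ← h1', h3])
    refine ⟨κ, k, l, U, w, hκinj, hkl, himage ▸ hk, himage ▸ hl, himage ▸ hc, fun P hP => ?_, hUV,
      hdom, fun y hy => ?_⟩
    · obtain ⟨Q, hQ, h1, h2⟩ := hκA P hP
      rw [h2, ← h1]
      exact hAU Q hQ
    · rw [hf y hy]
      congr 2
      have hprod : ∀ i ∈ A, ∃ P, ∃ _ : P ∈ J, i.1.1 = P.1 ∧ κ P = radIdx s i := fun i hi => by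
        obtain ⟨P, hP, h⟩ := hAκ i hi
        exact ⟨P, hP, h⟩
      choose p hpJ hp1 hp2 using hprod
      refine Finset.prod_bij p hpJ (fun i hi j hj h => ?_) (fun P hP => ?_) (fun i hi => ?_)
      · exact radIdx_injective s (by rw [← hp2 i hi, ← hp2 j hj, h])
      · obtain ⟨Q, hQ, h1, -⟩ := hκA P hP
        exact ⟨Q, hQ, Subtype.ext ((hp1 Q hQ).symm.trans h1)⟩
      · rw [hp2, hp1 i hi]

end RegularFan

end MixedResolution

end

theorem theorem25 (n : ℕ) (hn : 1 ≤ n) (f : MixedFunction n) (hnd : f.IsNondegenerate)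
    (hconv : f.IsConvenient) (F : RegularFan n) (hadm : F.IsAdmissible f)
    (hvert : ∀ P ∈ F.vertices, StrictlyPos P ∨ ∃ i, P = Pi.single i 1) :
    ∃ (_ : ChartedSpace (EuclideanQuadrant (2 * n)) F.PolarBlowup)
      (_ : ChartedSpace (EuclideanSpace ℝ (Fin (2 * n))) F.RealBlowup),
      F.IsBlowupStructure polarPlane (cornerModel n) ∧
      F.IsBlowupStructure realPlane 𝓘(ℝ, EuclideanSpace ℝ (Fin (2 * n))) ∧
      IsManifold 𝓘(ℝ, EuclideanSpace ℝ (Fin (2 * n))) ω F.RealBlowup ∧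
      T2Space F.RealBlowup ∧ SecondCountableTopology F.RealBlowup ∧
      IsPolarResolution f (F.blowupMap polarPlane)
        (fun P : F.posVertices => F.blowupDivisor polarPlane P.1) (fun P => f.minDegree P.1) ∧
      (∀ P ∈ F.posVertices, HasMultiplicityAlong (n := n) (fun y => f.toFun (F.blowupMap polarPlane y))
        (F.blowupDivisor polarPlane P) (f.minDegree P)) ∧
      ∃ η : F.PolarBlowup → F.RealBlowup,
        ContMDiff (cornerModel n) 𝓘(ℝ, EuclideanSpace ℝ (Fin (2 * n))) ω η ∧
        (∀ (s : F.maxCones) (x : BlowupChart polarPlane s.1),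
          η (F.blowupMk polarPlane s x) =
            F.blowupMk realPlane s (fun P => polarToReal (x.1 P), x.2)) ∧
        F.blowupProj polarPlane = F.blowupProj realPlane ∘ η ∧
        F.blowupMap polarPlane = F.blowupMap realPlane ∘ η ∧
        ∀ η' : F.PolarBlowup → F.RealBlowup, Continuous η' →
          F.blowupProj polarPlane = F.blowupProj realPlane ∘ η' → η' = η := by
  have hF := F.isGood hn hconv hadm hvert
  obtain ⟨cs, hman, hI, hbd⟩ := F.exists_polar_structure
  obtain ⟨cs', hman', hI'⟩ := F.exists_real_structure
  have hη := RegularFan.contMDiff_polarToRealMap hI hI'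
  have hproj : F.blowupProj polarPlane = F.blowupProj realPlane ∘ F.polarToRealMap :=
    funext fun y => (RegularFan.blowupProj_polarToRealMap y).symm
  exact ⟨cs, cs', hI, hI', hman', F.t2Space_blowup realAnalytic,
    F.secondCountable_blowup realAnalytic,
    RegularFan.isPolarResolution_blowupMap hn hnd hconv hF hadm hI hbd,
    fun P hP => RegularFan.hasMultiplicityAlong_blowupDivisor hn hnd hconv hF hadm hI
      (RegularFan.mem_posVertices_iff.1 hP).2,
    F.polarToRealMap, hη, fun s x => rfl, hproj,
    funext fun y => congrArg F.toricMap (congrFun hproj y),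
    fun η hc h => RegularFan.eq_polarToRealMap hF hc hη.continuous h⟩
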